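/- **Weights.** A weight on a finite-dimensional real vector space $V$ is a function $\varpi:V\to\mathbb R\cup\{-\infty\}$ with $\varpi(v)=-\infty$ iff $v=0$, $\varpi(cv)=\varpi(v)$ for $c\ne0$, and $\varpi(v+w)\le\max\{\varpi(v),\varpi(w)\}$. The multiplicity of a value $c$ is $\dim(V_{\le c}/V_{<c})$, where $V_{\le c}=\{\varpi\le c\}$ and $V_{<c}=\{\varpi<c\}$. Two weights are compatible if they take the same values on nonzero vectors with the same multiplicities. $\mathbb R$ carries the weight that is $0$ on nonzero numbers. For a polynomial map $f:V\to W$ between weighted spaces let $F_k=\frac1{k!}D_0^kf$ be the polarization of its degree-$k$ part; put $\varpi(F_k)=\max\{\varpi_W(F_k(v_1,\dots,v_k))-\sum_i\varpi_V(v_i): v_i\ne0\}$ and $\varpi(f)=\max_k\varpi(F_k)$. Call $f$ subresonant if $\varpi(f)\le0$, and invertible if moreover $D_0f$ is invertible. If $V,W$ carry inner products, $\|f\|_P=\sum_k\|F_k\|$ (operator norms). **Linearization.** Let $\lambda_1<\dots<\lambda_\ell<0$, $\ell\ge1$, be the values of the weight of $V$. Let $P_{\le-\lambda_1}(V)$ be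 the finite-dimensional space of polynomials $h:V\to\mathbb R$ with $\varpi(h)\le-\lambda_1$, with the inner product it inherits from $\bigoplus_k (V^*)^{\otimes k}$ through $h\mapsto(\frac1{k!}D^k_0h)_k$. Let $\mathbf V=(P_{\le-\lambda_1}(V))^*$ with the dual inner product, and let $\mathbf V'\subset\mathbf V$ be the codimension-$1$ subspace of functionals that vanish on constants. A subresonant $f:V\to W$ between spaces with compatible weights induces $f^*:P_{\le-\lambda_1}(W)\to P_{\le-\lambda_1}(V)$, $h\mapsto h\circ f$; its adjoint is the linearization $\mathbf Lf:\mathbf V\to\mathbf W$, and $\mathbf Lf(\mathbf V')\subset\mathbf W'$. **Forwards regularity.** For linear maps $A_i:W^i\to W^{i+1}$ between inner product spaces of the same finite dimension, write $A_0^{(n)}=A_{n-1}\circ\dots\circ A_0$. The Lyapunov weight of $v\in W^0$ is $\limsup_{n\to\infty}\frac1n\log\|A_0^{(n)}v\|$. Its finite values on nonzero vectors are the Lyapunov exponents, with multiplicities as above. The sequence $\{A_0^{(n)}\}$ is forwards regular if all $A_i$ are invertible, $\limsup\frac1n\log\|A_n\|=\limsup\frac1n\log\|A_n^{-1}\|=0$,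 the Lyapunov weight is finite on nonzero vectors, and $\lim\frac1n\log|\det A_0^{(n)}|$ exists and equals the sum of the Lyapunov exponents counted with multiplicity. **Theorem.** Let $V^i$ ($i\ge0$) be finite-dimensional inner product spaces with pairwise compatible weights $\varpi_i$ taking the values $\lambda_1<\dots<\lambda_\ell<0$ on nonzero vectors, where $\ell\ge1$. For each $i$ let $f_i:V^i\to V^{i+1}$ be an invertible subresonant polynomial map, $A_i=D_0f_i$, $\mathbf A_i=\mathbf Lf_i$. Suppose that 1. $\limsup_{n\to\infty}\frac1n\log\|f_n\|_P=0$; 2. the sequence $\{A_0^{(n)}\}$ is forwards regular; 3. $\lim_{n\to\infty}\frac1n\log\|A_0^{(n)}v\|=\varpi_0(v)$ for every nonzero $v\in V^0$. Then $\{\mathbf A_0^{(n)}\}$ is forwards regular, and its set of Lyapunov exponents is exactly the set of all numbers $\sum_{i=1}^\ell n_i\lambda_i$ with $n_i$ non-negative integers and $\lambda_1\le\sum_i n_i\lambda_i\le0$. The exponent $0$ has multiplicity $1$. Each $(\mathbf V^i)'$ has codimension $1$ in $\mathbf V^i$ and $\mathbf A_i$ maps $(\mathbf V^i)'$ into $(\mathbf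 V^{i+1})'$. The set of Lyapunov exponents of the restriction of $\{\mathbf A_0^{(n)}\}$ to $(\mathbf V^0)'$ is exactly the set of all $\sum_{i=1}^\ell n_i\lambda_i$ with $n_i$ non-negative integers, not all zero, and $\lambda_1\le\sum_i n_i\lambda_i<0$. -/

import Mathlib

open Filter Topology
open scoped Nat

noncomputable section

/-! ### Weights -/

/-- A weight on a real vector space: a function `V → ℝ ∪ {-∞}`, realised as an `EReal`-valued
function that never takes the value `⊤`. -/
structure Weight (V : Type*) [AddCommGroup V] [Module ℝ V] where
  toFun : V → EReal
  ne_top : ∀ v, toFun v ≠ ⊤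
  eq_bot_iff : ∀ v, toFun v = ⊥ ↔ v = 0
  smul_eq : ∀ (c : ℝ) (v : V), c ≠ 0 → toFun (c • v) = toFun v
  le_max : ∀ v w, toFun (v + w) ≤ max (toFun v) (toFun w)

instance {V : Type*} [AddCommGroup V] [Module ℝ V] : CoeFun (Weight V) (fun _ => V → EReal) :=
  ⟨Weight.toFun⟩

/-- The real values taken by `w : V → ℝ ∪ {-∞}` on nonzero vectors. -/
def weightValues {V : Type*} [AddCommGroup V] (w : V → EReal) : Set ℝ :=
  {c | ∃ v, v ≠ 0 ∧ w v = c}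

/-- The multiplicity of `c`: the dimension of `V_{≤ c} / V_{< c}`.  (For a weight `w` the two sets
are subspaces, so that taking spans changes nothing.) -/
def weightMult {V : Type*} [AddCommGroup V] [Module ℝ V] (w : V → EReal) (c : ℝ) : ℕ :=
  Module.finrank ℝ (Submodule.span ℝ {v | w v ≤ c}) -
    Module.finrank ℝ (Submodule.span ℝ {v | w v < c})

/-- The trivial weight on `ℝ`: `0` on nonzero reals. -/
def trivialWeight : Weight ℝ where
  toFun t := if t = 0 then ⊥ else 0
  ne_top v := by split_ifs <;> simp
  eq_bot_iff v := by by_cases h : v = 0 <;> simp [h]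
  smul_eq c v hc := by simp [hc]
  le_max v w := by
    by_cases hv : v = 0 <;> by_cases hw : w = 0 <;> simp [hv, hw]
    split_ifs <;> simp

namespace Weight

/-- The weight takes only negative values. -/
class Negative {V : Type*} [AddCommGroup V] [Module ℝ V] (ϖ : Weight V) : Prop where
  neg : ∀ v, ϖ v < 0

/-- Two weights are compatible if they take the same values with the same multiplicities. -/
def Compatible {V W : Type*} [AddCommGroup V] [Module ℝ V] [AddCommGroup W] [Module ℝ W]
    (ϖ : Weight V) (ϖ' : Weight W) : Prop :=
  weightValues ϖ = weightValues ϖ' ∧ ∀ c ∈ weightValues ϖ, weightMult ϖ c = weightMult ϖ' c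

section

variable {V : Type*} [AddCommGroup V] [Module ℝ V] (ϖ : Weight V)

lemma map_zero : ϖ 0 = ⊥ := (ϖ.eq_bot_iff 0).2 rfl

lemma smul_le (c : ℝ) (v : V) : ϖ (c • v) ≤ ϖ v := by
  by_cases hc : c = 0
  · simp [hc, ϖ.map_zero]
  · exact (ϖ.smul_eq c v hc).le

lemma sum_le {ι : Type*} (s : Finset ι) (g : ι → V) (b : EReal) (h : ∀ i ∈ s, ϖ (g i) ≤ b) :
    ϖ (∑ i ∈ s, g i) ≤ b := by
  classical
  induction s using Finset.induction_on with
  | empty => simp [ϖ.map_zero]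
  | insert a s ha ih =>
    rw [Finset.sum_insert ha]
    refine (ϖ.le_max _ _).trans (max_le (h _ (by simp)) (ih fun i hi => h i (by simp [hi])))

lemma exists_neg_bound [FiniteDimensional ℝ V] [hϖ : ϖ.Negative] :
    ∃ c : ℝ, c < 0 ∧ ∀ v, ϖ v ≤ c := by
  let b := Module.finBasis ℝ V
  have key : ∀ s : Finset (Fin (Module.finrank ℝ V)),
      ∃ c : ℝ, c < 0 ∧ ∀ i ∈ s, ϖ (b i) ≤ c := by
    intro s
    induction s using Finset.induction_on with
    | empty => exact ⟨-1, by norm_num, by simp⟩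
    | insert a s ha ih =>
      obtain ⟨c, hc, h⟩ := ih
      obtain ⟨d, hd, hd'⟩ := EReal.lt_iff_exists_real_btwn.1 (hϖ.neg (b a))
      have hd0 : d < 0 := by exact_mod_cast hd'
      refine ⟨max c d, max_lt hc hd0, fun i hi => ?_⟩
      rcases Finset.mem_insert.1 hi with rfl | hi
      · exact hd.le.trans (by exact_mod_cast le_max_right c d)
      · exact (h i hi).trans (by exact_mod_cast le_max_left c d)
  obtain ⟨c, hc, h⟩ := key Finset.univ
  refine ⟨c, hc, fun v => ?_⟩
  rw [← b.sum_repr v]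
  exact ϖ.sum_le _ _ _ fun i _ => (ϖ.smul_le _ _).trans (h i (by simp))

end

end Weight

/-! ### Polynomial maps and their weights -/

section Poly

variable {V W U : Type*} [NormedAddCommGroup V] [NormedSpace ℝ V]
  [NormedAddCommGroup W] [NormedSpace ℝ W] [NormedAddCommGroup U] [NormedSpace ℝ U]

/-- Polynomial maps: finite sums of `x ↦ T (x, …, x)` with `T` multilinear. -/
def IsPolynomialMap (f : V → W) : Prop :=
  ∃ (p : FormalMultilinearSeries ℝ V W) (d : ℕ),
    ∀ x, f x = ∑ k ∈ Finset.range d, p k (fun _ => x)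

/-- The polarization `(1 / k!) D₀ᵏ f` of the degree `k` homogeneous component of `f`. -/
def polarization (k : ℕ) (f : V → W) : V [×k]→L[ℝ] W :=
  (k ! : ℝ)⁻¹ • iteratedFDeriv ℝ k f 0

/-- The norm `‖f‖_P` of a polynomial map: the sum of the operator norms of the polarizations of
its homogeneous components. -/
def polyNorm (f : V → W) : ℝ := ∑ᶠ k, ‖polarization k f‖

/-- `ϖ(f) ≤ κ`, where the weight of a multilinear map `T` is the maximum of
`ϖ_W (T (v₁, …, v_k)) - ∑ ϖ_V (v_i)` over nonzero `v_i`, and the weight of a polynomial map is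
the maximum of the weights of the polarizations of its homogeneous components. -/
def PolyWeightLE (ϖV : Weight V) (ϖW : Weight W) (κ : ℝ) (f : V → W) : Prop :=
  ∀ (k : ℕ) (v : Fin k → V), (∀ i, v i ≠ 0) →
    ϖW (polarization k f v) ≤ κ + ∑ i, ϖV (v i)

lemma IsPolynomialMap.exists_series {f : V → W} {p : FormalMultilinearSeries ℝ V W} {d : ℕ}
    (h : ∀ x, f x = ∑ k ∈ Finset.range d, p k (fun _ => x)) :
    HasFiniteFPowerSeriesOnBall f (fun k => if k < d then p k else 0) 0 d ⊤ := by
  refine HasFiniteFPowerSeriesOnBall.mk' (fun m hm => by simp [hm]) ENNReal.zero_lt_top ?_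
  intro y _
  rw [zero_add, h]
  exact Finset.sum_congr rfl fun k hk => by simp [Finset.mem_range.1 hk]

lemma IsPolynomialMap.analyticOn {f : V → W} (hf : IsPolynomialMap f) :
    AnalyticOn ℝ f Set.univ := by
  obtain ⟨p, d, h⟩ := hf
  have := (IsPolynomialMap.exists_series h).cpolynomialOn
  rw [Metric.eball_top] at this
  exact this.analyticOnNhd.analyticOn

lemma IsPolynomialMap.contDiff {f : V → W} (hf : IsPolynomialMap f) {n : WithTop ℕ∞} :
    ContDiff ℝ n f :=
  contDiffOn_univ.1 (hf.analyticOn.contDiffOn uniqueDiffOn_univ)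

lemma polarization_apply {f : V → W} {p : FormalMultilinearSeries ℝ V W} {d : ℕ}
    (h : ∀ x, f x = ∑ k ∈ Finset.range d, p k (fun _ => x)) (k : ℕ) (v : Fin k → V) :
    polarization k f v =
      (k ! : ℝ)⁻¹ • ∑ σ : Equiv.Perm (Fin k), if k < d then p k (fun i => v (σ i)) else 0 := by
  have h1 := (IsPolynomialMap.exists_series h).toHasFPowerSeriesOnBall.iteratedFDeriv_eq_sum
    (IsPolynomialMap.analyticOn ⟨p, d, h⟩) v
  rw [polarization, smul_apply, h1]
  congr 1
  refine Finset.sum_congr rfl fun σ _ => ?_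
  split_ifs <;> rfl

lemma polarization_diag {f : V → W} {p : FormalMultilinearSeries ℝ V W} {d : ℕ}
    (h : ∀ x, f x = ∑ k ∈ Finset.range d, p k (fun _ => x)) (k : ℕ) (x : V) :
    polarization k f (fun _ => x) = if k < d then p k (fun _ => x) else 0 := by
  rw [polarization_apply h]
  split_ifs
  · simp only [Finset.sum_const, Finset.card_univ, Fintype.card_perm, Fintype.card_fin]
    rw [← Nat.cast_smul_eq_nsmul ℝ, smul_smul, inv_mul_cancel₀, one_smul]
    exact_mod_cast Nat.factorial_ne_zero k
  · simp

lemma polarization_eq_zero {f : V → W} {p : FormalMultilinearSeries ℝ V W} {d : ℕ}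
    (h : ∀ x, f x = ∑ k ∈ Finset.range d, p k (fun _ => x)) {k : ℕ} (hk : d ≤ k) :
    polarization k f = 0 := by
  ext v
  rw [polarization_apply h]
  simp [not_lt.2 hk]

lemma IsPolynomialMap.eq_sum {f : V → W} (hf : IsPolynomialMap f) :
    ∃ d, (∀ k, d ≤ k → polarization k f = 0) ∧
      ∀ x, f x = ∑ k ∈ Finset.range d, polarization k f (fun _ => x) := by
  obtain ⟨p, d, h⟩ := hf
  refine ⟨d, fun k hk => polarization_eq_zero h hk, fun x => ?_⟩
  rw [h x]
  exact Finset.sum_congr rfl fun k hk => by rw [polarization_diag h]; simp [Finset.mem_range.1 hk]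

lemma IsPolynomialMap.finite_support {f : V → W} (hf : IsPolynomialMap f) :
    {k | polarization k f ≠ 0}.Finite := by
  obtain ⟨d, h, -⟩ := hf.eq_sum
  exact (Set.finite_lt_nat d).subset fun k hk => by
    by_contra hkd
    exact hk (h k (not_lt.1 hkd))

lemma IsPolynomialMap.zero : IsPolynomialMap (0 : V → W) := ⟨0, 0, by simp⟩

lemma IsPolynomialMap.add {f g : V → W} (hf : IsPolynomialMap f) (hg : IsPolynomialMap g) :
    IsPolynomialMap (f + g) := by
  obtain ⟨p, d, h⟩ := hf
  obtain ⟨q, e, h'⟩ := hg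
  refine ⟨fun k => (if k < d then p k else 0) + (if k < e then q k else 0), max d e, fun x => ?_⟩
  simp only [Pi.add_apply, h x, h' x, add_apply, Finset.sum_add_distrib]
  congr 1
  · rw [← Finset.sum_subset (Finset.range_mono (le_max_left d e))]
    · exact Finset.sum_congr rfl fun k hk => by simp [Finset.mem_range.1 hk]
    · intro k _ hk
      rw [if_neg (by simpa using hk)]; rfl
  · rw [← Finset.sum_subset (Finset.range_mono (le_max_right d e))]
    · exact Finset.sum_congr rfl fun k hk => by simp [Finset.mem_range.1 hk]
    · intro k _ hk
      rw [if_neg (by simpa using hk)]; rfl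

lemma IsPolynomialMap.smul {f : V → W} (c : ℝ) (hf : IsPolynomialMap f) :
    IsPolynomialMap (c • f) := by
  obtain ⟨p, d, h⟩ := hf
  refine ⟨fun k => c • p k, d, fun x => ?_⟩
  simp [h x, Finset.smul_sum]

lemma polarization_zero (k : ℕ) : polarization k (0 : V → W) = 0 := by
  ext v
  rw [polarization_apply (p := 0) (d := 0) (by simp)]
  simp

lemma polarization_add {f g : V → W} (hf : IsPolynomialMap f) (hg : IsPolynomialMap g) (k : ℕ) :
    polarization k (f + g) = polarization k f + polarization k g := by
  rw [polarization, iteratedFDeriv_add_apply hf.contDiff.contDiffAt hg.contDiff.contDiffAt,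
    smul_add]
  rfl

lemma polarization_smul {f : V → W} (c : ℝ) (hf : IsPolynomialMap f) (k : ℕ) :
    polarization k (c • f) = c • polarization k f := by
  rw [polarization, iteratedFDeriv_const_smul_apply hf.contDiff.contDiffAt, smul_comm]
  rfl

/-- The space `P_{≤ κ}(V, W)` of polynomial maps of weight at most `κ`.  For `κ = 0` this is the
space of subresonant polynomial maps. -/
def polyLE (ϖV : Weight V) (ϖW : Weight W) (κ : ℝ) : Submodule ℝ (V → W) where
  carrier := {f | IsPolynomialMap f ∧ PolyWeightLE ϖV ϖW κ f}
  zero_mem' := ⟨IsPolynomialMap.zero, fun k v _ => by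
    simp [polarization_zero, ϖW.map_zero]⟩
  add_mem' {f g} hf hg := ⟨hf.1.add hg.1, fun k v hv => by
    rw [polarization_add hf.1 hg.1]
    exact (ϖW.le_max _ _).trans (max_le (hf.2 k v hv) (hg.2 k v hv))⟩
  smul_mem' c f hf := ⟨hf.1.smul c, fun k v hv => by
    rw [polarization_smul c hf.1]
    exact (ϖW.smul_le _ _).trans (hf.2 k v hv)⟩

lemma polyLE_polarization_le {ϖV : Weight V} {ϖW : Weight W} {κ : ℝ} {f : V → W}
    (hf : f ∈ polyLE ϖV ϖW κ) (k : ℕ) (v : Fin k → V) :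
    ϖW (polarization k f v) ≤ κ + ∑ i, ϖV (v i) := by
  by_cases hv : ∀ i, v i ≠ 0
  · exact hf.2 k v hv
  · push Not at hv
    obtain ⟨i, hi⟩ := hv
    rw [ContinuousMultilinearMap.map_coord_zero _ i hi, ϖW.map_zero]
    exact bot_le

lemma multilinear_diag_mem_polyLE {ϖV : Weight V} {ϖW : Weight W} {κ : ℝ}
    {ι : Type*} [Fintype ι] (T : MultilinearMap ℝ (fun _ : ι => V) W)
    (hc : Continuous T) (hT : ∀ v, ϖW (T v) ≤ κ + ∑ i, ϖV (v i)) :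
    (fun x => T (fun _ => x)) ∈ polyLE ϖV ϖW κ := by
  let e := Fintype.equivFin ι
  let n := Fintype.card ι
  let S : V [×n]→L[ℝ] W :=
    { toMultilinearMap := T.domDomCongr e
      cont := hc.comp (by fun_prop : Continuous fun (v : Fin n → V) (i : ι) => v (e i)) }
  have hS : ∀ v, S v = T (fun i => v (e i)) := fun v => rfl
  let p : FormalMultilinearSeries ℝ V W := fun k =>
    if h : n = k then h ▸ S else 0
  have hpn : p n = S := by simp [p]
  have hpk : ∀ k, k ≠ n → p k = 0 := fun k hk => by simp [p, Ne.symm hk]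
  have hrep : ∀ x, (fun x => T (fun _ => x)) x
      = ∑ k ∈ Finset.range (n + 1), p k (fun _ => x) := by
    intro x
    rw [Finset.sum_eq_single n]
    · rw [hpn, hS]
    · intro k _ hk
      rw [hpk k hk]; rfl
    · simp
  refine ⟨⟨p, n + 1, hrep⟩, fun k v _ => ?_⟩
  rw [polarization_apply hrep]
  refine (ϖW.smul_le _ _).trans (ϖW.sum_le _ _ _ fun σ _ => ?_)
  by_cases hk : k = n
  · subst hk
    rw [if_pos (Nat.lt_succ_self _), hpn, hS]
    refine (hT _).trans (le_of_eq ?_)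
    congr 1
    exact Equiv.sum_comp (e.trans σ) (fun i => ϖV (v i))
  · rw [hpk k hk]
    split_ifs <;> simp [ϖW.map_zero]

/-- Precomposition with a subresonant polynomial map preserves `P_{≤ κ}`. -/
lemma comp_mem_polyLE {ϖV : Weight V} {ϖW : Weight W} {ϖU : Weight U}
    {κ : ℝ} {g : W → U} {f : V → W} (hg : g ∈ polyLE ϖW ϖU κ) (hf : f ∈ polyLE ϖV ϖW 0) :
    g ∘ f ∈ polyLE ϖV ϖU κ := by
  obtain ⟨d, -, hd⟩ := hf.1.eq_sum
  obtain ⟨e, -, he⟩ := hg.1.eq_sum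
  have hcomp : g ∘ f = ∑ j ∈ Finset.range e,
      ∑ r ∈ Fintype.piFinset (fun _ : Fin j => Finset.range d),
        fun x => polarization j g (fun m => polarization (r m) f (fun _ => x)) := by
    funext x
    simp only [Function.comp_apply, Finset.sum_apply, he (f x)]
    refine Finset.sum_congr rfl fun j _ => ?_
    rw [hd x, ContinuousMultilinearMap.map_sum_finset]
  rw [hcomp]
  refine Submodule.sum_mem _ fun j _ => Submodule.sum_mem _ fun r _ => ?_
  let T : MultilinearMap ℝ (fun _ : Σ m : Fin j, Fin (r m) => V) U :=
    (polarization j g).toMultilinearMap.compMultilinearMap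
      (fun m => (polarization (r m) f).toMultilinearMap)
  have hc : Continuous T := by
    refine (polarization j g).cont.comp (continuous_pi fun m => ?_)
    exact (polarization (r m) f).cont.comp (continuous_pi fun b => continuous_apply _)
  refine multilinear_diag_mem_polyLE T hc fun v => ?_
  have h1 := polyLE_polarization_le hg j
    (fun m => polarization (r m) f (fun b => v ⟨m, b⟩))
  refine h1.trans (add_le_add le_rfl ?_)
  rw [Fintype.sum_sigma]
  refine Finset.sum_le_sum fun m _ => ?_
  have h2 := polyLE_polarization_le hf (r m) (fun b => v ⟨m, b⟩)
  simpa using h2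

end Poly

/-! ### The linearization -/

section Linearization

variable {V W : Type*} [NormedAddCommGroup V] [InnerProductSpace ℝ V] [FiniteDimensional ℝ V]
  [NormedAddCommGroup W] [InnerProductSpace ℝ W] [FiniteDimensional ℝ W]

/-- The space `P_{≤ κ}(V)` of real-valued polynomials on `V` of weight at most `κ`. -/
def WPoly (ϖ : Weight V) (κ : ℝ) : Type _ := ↥(polyLE ϖ trivialWeight κ)

namespace WPoly

variable {ϖ : Weight V} {κ : ℝ}

instance : AddCommGroup (WPoly ϖ κ) := inferInstanceAs (AddCommGroup ↥(polyLE ϖ trivialWeight κ))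
instance : Module ℝ (WPoly ϖ κ) := inferInstanceAs (Module ℝ ↥(polyLE ϖ trivialWeight κ))
instance : CoeFun (WPoly ϖ κ) (fun _ => V → ℝ) := ⟨fun h => h.1⟩

/-- The inner product on `k`-multilinear forms, i.e. on `(V*)^{⊗ k}`, induced by the inner product
on `V`. -/
def formInner (k : ℕ) (S T : V [×k]→L[ℝ] ℝ) : ℝ :=
  ∑ j : Fin k → Fin (Module.finrank ℝ V),
    S (fun i => stdOrthonormalBasis ℝ V (j i)) * T (fun i => stdOrthonormalBasis ℝ V (j i))

lemma formInner_self_eq_zero {k : ℕ} {S : V [×k]→L[ℝ] ℝ} (h : formInner k S S = 0) : S = 0 := by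
  have h0 : ∀ j : Fin k → Fin (Module.finrank ℝ V),
      S (fun i => stdOrthonormalBasis ℝ V (j i)) = 0 := by
    intro j
    have := (Finset.sum_eq_zero_iff_of_nonneg (fun j _ => mul_self_nonneg _)).1 h j
      (Finset.mem_univ _)
    exact mul_self_eq_zero.1 this
  apply ContinuousMultilinearMap.toMultilinearMap_injective
  refine Module.Basis.ext_multilinear (fun _ => (stdOrthonormalBasis ℝ V).toBasis) fun j => ?_
  simpa using h0 j

/-- The inner product on `P_{≤ κ}(V)` as a subspace of `⨁ₖ (V*)^{⊗ k}`. -/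
def innerFun (S T : WPoly ϖ κ) : ℝ := ∑ᶠ k, formInner k (polarization k S) (polarization k T)

lemma support_finite (S T : WPoly ϖ κ) :
    (Function.support fun k => formInner k (polarization k S) (polarization k T)).Finite := by
  refine S.2.1.finite_support.subset fun k hk => ?_
  intro h0
  apply hk
  show formInner k (polarization k S) (polarization k T) = 0
  simp [h0, formInner]

/-- The inner product on `P_{≤ κ}(V)`. -/
@[reducible]
def core (ϖ : Weight V) (κ : ℝ) : InnerProductSpace.Core ℝ (WPoly ϖ κ) where
  inner := innerFun
  conj_inner_symm S T := by
    simp [innerFun, formInner, mul_comm]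
  re_inner_nonneg S := by
    refine finsum_nonneg fun k => Finset.sum_nonneg fun j _ => mul_self_nonneg _
  add_left S S' T := by
    show ∑ᶠ k, _ = ∑ᶠ k, _ + ∑ᶠ k, _
    rw [← finsum_add_distrib (support_finite S T) (support_finite S' T)]
    refine finsum_congr fun k => ?_
    have h := polarization_add S.2.1 S'.2.1 k
    change polarization k ((S + S' : WPoly ϖ κ) : V → ℝ) = _ at h
    rw [h]
    simp [formInner, add_mul, Finset.sum_add_distrib]
  smul_left S T c := by
    show ∑ᶠ k, _ = _ * ∑ᶠ k, _
    rw [mul_finsum]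
    refine finsum_congr fun k => ?_
    have h := polarization_smul c S.2.1 k
    change polarization k ((c • S : WPoly ϖ κ) : V → ℝ) = _ at h
    rw [h]
    simp [formInner, mul_assoc, Finset.mul_sum]
  definite S hS := by
    have hnn : ∀ k, 0 ≤ formInner k (polarization k S) (polarization k S) :=
      fun k => Finset.sum_nonneg fun j _ => mul_self_nonneg _
    have hS' : ∑ᶠ k, formInner k (polarization k S) (polarization k S) = 0 := hS
    rw [finsum_eq_sum _ (support_finite S S)] at hS'
    have h0 : ∀ k, polarization k (S : V → ℝ) = 0 := by
      intro k
      apply formInner_self_eq_zero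
      by_contra hne
      exact hne ((Finset.sum_eq_zero_iff_of_nonneg fun k _ => hnn k).1 hS' k (by simpa using hne))
    obtain ⟨d, -, hd⟩ := S.2.1.eq_sum
    apply Subtype.ext
    funext x
    rw [hd x]
    simp only [h0]
    simp
    rfl

instance : NormedAddCommGroup (WPoly ϖ κ) := (core ϖ κ).toNormedAddCommGroup
instance : InnerProductSpace ℝ (WPoly ϖ κ) := InnerProductSpace.ofCore (core ϖ κ).toCore

/-- If the weight is negative, `P_{≤ κ}(V)` is finite dimensional. -/
instance [ϖ.Negative] : FiniteDimensional ℝ (WPoly ϖ κ) := by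
  obtain ⟨c, hc, hϖ⟩ := ϖ.exists_neg_bound
  obtain ⟨N, hN⟩ := exists_nat_gt (κ / (-c))
  have hN' : ∀ k : ℕ, N ≤ k → κ + k * c < 0 := by
    intro k hk
    have h1 : κ < k * (-c) := by
      rw [div_lt_iff₀ (by linarith)] at hN
      have : (N : ℝ) ≤ k := by exact_mod_cast hk
      nlinarith
    linarith
  have hzero : ∀ (S : WPoly ϖ κ) (k : ℕ), N ≤ k → polarization k (S : V → ℝ) = 0 := by
    intro S k hk
    ext v
    by_contra hne
    have h1 := polyLE_polarization_le S.2 k v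
    have h2 : ∑ i, ϖ (v i) ≤ ((k * c : ℝ) : EReal) := by
      calc ∑ i, ϖ (v i) ≤ ∑ _i : Fin k, (c : EReal) := Finset.sum_le_sum fun i _ => hϖ _
        _ = ((∑ _i : Fin k, c : ℝ) : EReal) := by simp
        _ = ((k * c : ℝ) : EReal) := by simp
    have h3 : trivialWeight (polarization k (S : V → ℝ) v) = 0 := if_neg hne
    rw [h3] at h1
    have h4 : (0 : EReal) ≤ ((κ + k * c : ℝ) : EReal) := by
      rw [EReal.coe_add]
      exact h1.trans (add_le_add le_rfl h2)
    have h5 : (0 : ℝ) ≤ κ + k * c := by exact_mod_cast h4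
    linarith [hN' k hk]
  let Φ : WPoly ϖ κ →ₗ[ℝ] (∀ k : Fin N, MultilinearMap ℝ (fun _ : Fin (k : ℕ) => V) ℝ) :=
    { toFun := fun S k => (polarization (k : ℕ) (S : V → ℝ)).toMultilinearMap
      map_add' := fun S T => by
        funext k
        have h := polarization_add S.2.1 T.2.1 k
        change polarization k ((S + T : WPoly ϖ κ) : V → ℝ) = _ at h
        rw [h]; rfl
      map_smul' := fun a S => by
        funext k
        have h := polarization_smul a S.2.1 k
        change polarization k ((a • S : WPoly ϖ κ) : V → ℝ) = _ at h
        rw [h]; rfl }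
  refine FiniteDimensional.of_injective Φ ?_
  rw [← LinearMap.ker_eq_bot, LinearMap.ker_eq_bot']
  intro S hS
  have h0 : ∀ k, polarization k (S : V → ℝ) = 0 := by
    intro k
    by_cases hk : k < N
    · exact ContinuousMultilinearMap.toMultilinearMap_injective (congrFun hS ⟨k, hk⟩)
    · exact hzero S k (not_lt.1 hk)
  obtain ⟨d, -, hd⟩ := S.2.1.eq_sum
  apply Subtype.ext
  funext x
  rw [hd x]
  simp only [h0]
  simp
  rfl

instance [ϖ.Negative] : CompleteSpace (WPoly ϖ κ) := FiniteDimensional.complete ℝ _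

end WPoly

/-- The space `𝐕 = (P_{≤ κ}(V))*` on which subresonant maps act linearly (one takes `κ = -λ₁`,
where `λ₁` is the smallest weight of `V`).  It carries the dual norm. -/
abbrev LinSpace (ϖ : Weight V) (κ : ℝ) : Type _ := StrongDual ℝ (WPoly ϖ κ)

/-- The dual inner product on `𝐕`. -/
instance (ϖ : Weight V) (κ : ℝ) [ϖ.Negative] : InnerProductSpace ℝ (LinSpace ϖ κ) where
  inner ξ η := inner ℝ ((InnerProductSpace.toDual ℝ (WPoly ϖ κ)).symm ξ)
    ((InnerProductSpace.toDual ℝ (WPoly ϖ κ)).symm η)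
  norm_sq_eq_re_inner ξ := by
    rw [← LinearIsometryEquiv.norm_map (InnerProductSpace.toDual ℝ (WPoly ϖ κ)).symm ξ]
    simp
  conj_inner_symm ξ η := by
    rw [conj_trivial, real_inner_comm]
  add_left ξ ξ' η := by simp [inner_add_left]
  smul_left ξ η c := by simp [inner_smul_left]

instance (ϖ : Weight V) (κ : ℝ) [ϖ.Negative] : FiniteDimensional ℝ (LinSpace ϖ κ) :=
  LinearEquiv.finiteDimensional
    (InnerProductSpace.toDual ℝ (WPoly ϖ κ)).toContinuousLinearEquiv.toLinearEquiv

/-- The subspace `𝐕'` of `𝐕`: functionals that vanish on constant functions. -/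
def linSubspace (ϖ : Weight V) (κ : ℝ) : Submodule ℝ (LinSpace ϖ κ) where
  carrier := {ξ | ∀ h : WPoly ϖ κ, (∃ c : ℝ, ∀ x, h x = c) → ξ h = 0}
  zero_mem' _ _ := rfl
  add_mem' hξ hη h hh := by simp [hξ h hh, hη h hh]
  smul_mem' c ξ hξ h hh := by simp [hξ h hh]

/-- The linear map `f* : P_{≤ κ}(W) → P_{≤ κ}(V)`, `h ↦ h ∘ f`, of a subresonant polynomial map. -/
def pullback {ϖV : Weight V} {ϖW : Weight W} (κ : ℝ) (f : polyLE ϖV ϖW 0) :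
    WPoly ϖW κ →ₗ[ℝ] WPoly ϖV κ where
  toFun h := ⟨h ∘ f.1, comp_mem_polyLE h.2 f.2⟩
  map_add' _ _ := rfl
  map_smul' _ _ := rfl

/-- The linearization `𝐋 f : 𝐕 → 𝐖` of a subresonant polynomial map: the adjoint of `f*`. -/
def linearize {ϖV : Weight V} {ϖW : Weight W} [ϖV.Negative] [ϖW.Negative] (κ : ℝ)
    (f : polyLE ϖV ϖW 0) : LinSpace ϖV κ →L[ℝ] LinSpace ϖW κ :=
  ContinuousLinearMap.precomp ℝ (LinearMap.toContinuousLinearMap (pullback κ f))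

end Linearization

/-! ### Lyapunov exponents and forwards regularity -/

section Lyapunov

/-- `|det A|` of a linear map between inner product spaces of the same dimension, as
`√(det (Aᵀ A))`. -/
def absDet {E F : Type*} [NormedAddCommGroup E] [InnerProductSpace ℝ E] [FiniteDimensional ℝ E]
    [NormedAddCommGroup F] [InnerProductSpace ℝ F] [FiniteDimensional ℝ F] (A : E →L[ℝ] F) : ℝ :=
  √(LinearMap.det (LinearMap.adjoint (A : E →ₗ[ℝ] F) ∘ₗ (A : E →ₗ[ℝ] F)))

variable {E : ℕ → Type*} [∀ i, NormedAddCommGroup (E i)] [∀ i, InnerProductSpace ℝ (E i)]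

/-- The product `A₀⁽ⁿ⁾ = A_{n-1} ∘ ⋯ ∘ A₀`. -/
def cocycle (A : ∀ i, E i →L[ℝ] E (i + 1)) : ∀ n, E 0 →L[ℝ] E n
  | 0 => ContinuousLinearMap.id ℝ (E 0)
  | n + 1 => (A n).comp (cocycle A n)

/-- The Lyapunov weight `v ↦ limsup (1/n) log ‖A₀⁽ⁿ⁾ v‖`, with `log 0 = -∞`. -/
def lyapunovWeight (A : ∀ i, E i →L[ℝ] E (i + 1)) (v : E 0) : EReal :=
  limsup (fun n : ℕ => ENNReal.log ‖cocycle A n v‖ₑ / (n : EReal)) atTop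

/-- The Lyapunov exponents of the sequence `A`. -/
def lyapunovExponents (A : ∀ i, E i →L[ℝ] E (i + 1)) : Set ℝ := weightValues (lyapunovWeight A)

/-- The Lyapunov exponents of the restriction of `A₀⁽ⁿ⁾`, `n ∈ ℕ`, to a subspace. -/
def lyapunovExponentsOn (A : ∀ i, E i →L[ℝ] E (i + 1)) (S : Submodule ℝ (E 0)) : Set ℝ :=
  weightValues (fun v : S => lyapunovWeight A v)

/-- The sequence `A₀⁽ⁿ⁾`, `n ∈ ℕ`, is forwards regular: the `Aₙ` are invertible with
`limsup (1/n) log ‖Aₙ‖ = limsup (1/n) log ‖Aₙ⁻¹‖ = 0`, the Lyapunov weight of every nonzero vector is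
finite, and `lim (1/n) log |det A₀⁽ⁿ⁾|` exists and equals the sum of the Lyapunov exponents, counted
with multiplicity. -/
structure ForwardsRegular [∀ i, FiniteDimensional ℝ (E i)] (A : ∀ i, E i →L[ℝ] E (i + 1)) :
    Prop where
  invertible : ∀ i, (A i).IsInvertible
  limsup_norm : limsup (fun n : ℕ => ((Real.log ‖A n‖ / n : ℝ) : EReal)) atTop = 0
  limsup_norm_inverse :
    limsup (fun n : ℕ => ((Real.log ‖(A n).inverse‖ / n : ℝ) : EReal)) atTop = 0
  finite_weight : ∀ v : E 0, v ≠ 0 → ∃ χ : ℝ, lyapunovWeight A v = χ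
  regular : Tendsto (fun n : ℕ => Real.log (absDet (cocycle A n)) / n) atTop
    (𝓝 (∑ᶠ χ ∈ lyapunovExponents A, (weightMult (lyapunovWeight A) χ : ℝ) * χ))

end Lyapunov

section Sequences

variable {V : ℕ → Type*} [∀ i, NormedAddCommGroup (V i)] [∀ i, InnerProductSpace ℝ (V i)]
  [∀ i, FiniteDimensional ℝ (V i)] {ϖ : ∀ i, Weight (V i)}

/-- The linear parts `Aᵢ = D₀ fᵢ` of a sequence of subresonant polynomial maps. -/
def linearParts (f : ∀ i, polyLE (ϖ i) (ϖ (i + 1)) 0) (i : ℕ) : V i →L[ℝ] V (i + 1) :=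
  fderiv ℝ (f i).1 0

/-- The linearizations `𝐀ᵢ = 𝐋 fᵢ` of a sequence of subresonant polynomial maps. -/
def linearizations [∀ i, (ϖ i).Negative] (κ : ℝ) (f : ∀ i, polyLE (ϖ i) (ϖ (i + 1)) 0) (i : ℕ) :
    LinSpace (ϖ i) κ →L[ℝ] LinSpace (ϖ (i + 1)) κ :=
  linearize κ (f i)

end Sequences

end

/-!
Growth rates are handled through subexponential sequences (`SubExp`): sequences that are
`O(e^{εn})` for every `ε > 0`.  They are closed under sums and products, and under the linear
recursions `y (n + 1) = q y n + b n` with `0 ≤ q ≤ 1`.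

Regularity is recognized through bases.  By Hadamard's inequality `|det A₀⁽ⁿ⁾|` is at most a
constant times `∏ ‖A₀⁽ⁿ⁾ b_i‖` for every basis `b`.  If the vectors of a basis grow at most at
rates `χ i`, while `|det A₀⁽ⁿ⁾|` grows at least at the rate `∑ χ i`, then no basis has a smaller
sum of rates, and by an exchange argument the Lyapunov weight of a vector is the largest `χ i`
over the basis vectors that occur in it (`IsAdapted`, `isAdapted_lyapunovWeight`).  All exponents
and multiplicities can be read off such an adapted basis.

The hypotheses on the linear parts `A n` provide frames `B n = A₀⁽ⁿ⁾ D⁻ⁿ`, where `D` multiplies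
the vectors of a basis of `V 0` adapted to its weight by `e^{w j}`.  The frames preserve weights;
they are subexponential because the growth rates are the weights `w j`, and so are their inverses
because the sequence is regular (`exists_straightening_frame`).  In these frames the maps `f n`
become subresonant self-maps `g n` of `V 0` with linear part exactly `D` and subexponential
coefficients.

Polynomials on `V 0` of weight at most `κ` have the basis of monomials `x^α` with `⟨α, w⟩ ≥ -κ` in
adapted coordinates (`monBasis`).  Substituting `g n` in `x^α` gives `e^{⟨α, w⟩} x^α` plus
monomials of larger weight, or of the same weight but larger degree (`substMon_sub_mem`): the
monomials of the `i`-th component of `g n` have weight at least `w i`, and the only one of degree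
one is `e^{w i} x_i` because the linear part is diagonal.  So the linearizations of the `g n` are
triangular in the dual basis, with constant diagonal entries `e^{⟨α, w⟩}` that increase in the
direction of the coupling; each dual basis vector then grows at most at the rate of its own
diagonal entry (`subExp_of_rank_triangular`), the determinants grow at the rate of the sum, and
the criterion above applies (`forwardsRegular_of_conjugate_triangular`).  The linearizations of
`f n` and `g n` are conjugate by the linearizations of the frames, which are subexponential as well.

The exponents are therefore the numbers `⟨α, w⟩ ∈ [-κ, 0]`, the exponent `0` belongs to `α = 0`
only, and the hyperplane of functionals that vanish on constants is spanned by the dual basis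
vectors with `α ≠ 0`.
-/

/-! ### Subexponential sequences -/

/-- A real sequence is subexponential if it is `O(e^{εn})` for every `ε > 0`. -/
def SubExp (a : ℕ → ℝ) : Prop := ∀ ε : ℝ, 0 < ε → ∃ C : ℝ, ∀ n : ℕ, |a n| ≤ C * Real.exp (ε * n)

namespace SubExp

lemma of_abs_le {a b : ℕ → ℝ} (hb : SubExp b) (h : ∀ n, |a n| ≤ |b n|) : SubExp a := fun ε hε =>
  let ⟨C, hC⟩ := hb ε hε
  ⟨C, fun n => (h n).trans (hC n)⟩

lemma of_le {a b : ℕ → ℝ} (hb : SubExp b) (ha : ∀ n, 0 ≤ a n) (h : ∀ n, a n ≤ b n) : SubExp a :=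
  hb.of_abs_le fun n => by
    rw [abs_of_nonneg (ha n)]
    exact (h n).trans (le_abs_self _)

lemma const (c : ℝ) : SubExp fun _ => c := fun ε hε => ⟨|c|, fun n => by
  have : (1 : ℝ) ≤ Real.exp (ε * n) := Real.one_le_exp (by positivity)
  nlinarith [abs_nonneg c]⟩

lemma add {a b : ℕ → ℝ} (ha : SubExp a) (hb : SubExp b) : SubExp fun n => a n + b n := by
  intro ε hε
  obtain ⟨C, hC⟩ := ha ε hε
  obtain ⟨D, hD⟩ := hb ε hε
  refine ⟨C + D, fun n => (abs_add_le _ _).trans ?_⟩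
  linarith [hC n, hD n]

lemma mul {a b : ℕ → ℝ} (ha : SubExp a) (hb : SubExp b) : SubExp fun n => a n * b n := by
  intro ε hε
  obtain ⟨C, hC⟩ := ha (ε / 2) (by positivity)
  obtain ⟨D, hD⟩ := hb (ε / 2) (by positivity)
  refine ⟨C * D, fun n => ?_⟩
  rw [abs_mul]
  refine (mul_le_mul (hC n) (hD n) (abs_nonneg _) ((abs_nonneg _).trans (hC n))).trans
    (le_of_eq ?_)
  rw [show ε * n = ε / 2 * n + ε / 2 * n by ring, Real.exp_add]
  ring

lemma abs {a : ℕ → ℝ} (ha : SubExp a) : SubExp fun n => |a n| :=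
  ha.of_abs_le fun n => by simp

lemma pow {a : ℕ → ℝ} (ha : SubExp a) (k : ℕ) : SubExp fun n => a n ^ k := by
  induction k with
  | zero => simpa using const 1
  | succ k ih => simpa only [pow_succ] using ih.mul ha

lemma sum {ι : Type*} (s : Finset ι) {a : ι → ℕ → ℝ} (ha : ∀ i ∈ s, SubExp (a i)) :
    SubExp fun n => ∑ i ∈ s, a i n := by
  classical
  induction s using Finset.induction_on with
  | empty => simpa using const 0
  | insert i s hi ih =>
    simp only [Finset.sum_insert hi]
    exact (ha i (by simp)).add (ih fun j hj => ha j (by simp [hj]))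

lemma prod {ι : Type*} (s : Finset ι) {a : ι → ℕ → ℝ} (ha : ∀ i ∈ s, SubExp (a i)) :
    SubExp fun n => ∏ i ∈ s, a i n := by
  classical
  induction s using Finset.induction_on with
  | empty => simpa using const 1
  | insert i s hi ih =>
    simp only [Finset.prod_insert hi]
    exact (ha i (by simp)).mul (ih fun j hj => ha j (by simp [hj]))

lemma succ {a : ℕ → ℝ} (ha : SubExp a) : SubExp fun n => a (n + 1) := by
  intro ε hε
  obtain ⟨C, hC⟩ := ha ε hε
  refine ⟨C * Real.exp ε, fun n => (hC (n + 1)).trans (le_of_eq ?_)⟩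
  push_cast
  rw [mul_add, Real.exp_add]
  ring_nf

lemma natCast : SubExp fun n => (n : ℝ) := by
  intro ε hε
  refine ⟨ε⁻¹, fun n => ?_⟩
  rw [abs_of_nonneg (by positivity), inv_mul_eq_div, le_div_iff₀ hε]
  linarith [Real.add_one_le_exp (ε * n)]

lemma partialSum {a : ℕ → ℝ} (ha : SubExp a) : SubExp fun n => ∑ k ∈ Finset.range n, a k := by
  intro ε hε
  obtain ⟨C, hC⟩ := ha (ε / 2) (by positivity)
  have h2 : SubExp fun n => (n : ℝ) * C := natCast.mul (const C)
  obtain ⟨D, hD⟩ := h2 (ε / 2) (by positivity)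
  have hC0 : 0 ≤ C := by simpa using (abs_nonneg _).trans (hC 0)
  refine ⟨D, fun n => ?_⟩
  calc |∑ k ∈ Finset.range n, a k| ≤ ∑ k ∈ Finset.range n, |a k| := Finset.abs_sum_le_sum_abs _ _
    _ ≤ ∑ k ∈ Finset.range n, C * Real.exp (ε / 2 * n) := by
        refine Finset.sum_le_sum fun k hk => (hC k).trans ?_
        have : (k : ℝ) ≤ n := by exact_mod_cast (Finset.mem_range.1 hk).le
        gcongr
    _ = (n * C) * Real.exp (ε / 2 * n) := by simp; ring
    _ ≤ |n * C| * Real.exp (ε / 2 * n) := by gcongr; exact le_abs_self _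
    _ ≤ (D * Real.exp (ε / 2 * n)) * Real.exp (ε / 2 * n) := by gcongr; exact hD n
    _ = D * Real.exp (ε * n) := by
        rw [show ε * n = ε / 2 * n + ε / 2 * n by ring, Real.exp_add]; ring

/-- A solution of `y (n + 1) = q y n + b n` with a contracting factor and subexponential forcing
is subexponential. -/
lemma of_recursion {y b : ℕ → ℝ} {q : ℝ} (hq0 : 0 ≤ q) (hq1 : q ≤ 1) (hb : SubExp b)
    (h : ∀ n, y (n + 1) = q * y n + b n) : SubExp y := by
  refine ((const |y 0|).add hb.abs.partialSum).of_abs_le fun n => ?_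
  rw [abs_of_nonneg (a := |y 0| + _) (by positivity)]
  induction n with
  | zero => simp
  | succ n ih =>
    rw [h, Finset.sum_range_succ]
    refine (abs_add_le _ _).trans ?_
    rw [abs_mul, abs_of_nonneg hq0]
    nlinarith [abs_nonneg (y n), abs_nonneg (b n)]

lemma of_eventually {a : ℕ → ℝ}
    (h : ∀ ε : ℝ, 0 < ε → ∀ᶠ n : ℕ in atTop, |a n| ≤ Real.exp (ε * n)) : SubExp a := by
  intro ε hε
  obtain ⟨N, hN⟩ := eventually_atTop.1 (h ε hε)
  refine ⟨1 + ∑ k ∈ Finset.range N, |a k|, fun n => ?_⟩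
  have h1 : (1 : ℝ) ≤ Real.exp (ε * n) := Real.one_le_exp (by positivity)
  have h0 : 0 ≤ ∑ k ∈ Finset.range N, |a k| := by positivity
  by_cases hn : N ≤ n
  · nlinarith [hN n hn]
  · have := Finset.single_le_sum (f := fun k => |a k|) (fun k _ => abs_nonneg _)
      (Finset.mem_range.2 (not_le.1 hn))
    nlinarith

lemma eventually_le {a : ℕ → ℝ} (h : SubExp a) {ε : ℝ} (hε : 0 < ε) :
    ∀ᶠ n : ℕ in atTop, |a n| ≤ Real.exp (ε * n) := by
  obtain ⟨C, hC⟩ := h (ε / 2) (by positivity)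
  have h1 : Tendsto (fun n : ℕ => Real.exp (ε / 2 * n)) atTop atTop :=
    Real.tendsto_exp_atTop.comp (tendsto_natCast_atTop_atTop.const_mul_atTop (by positivity))
  filter_upwards [h1.eventually_ge_atTop C] with n hn
  refine (hC n).trans ?_
  rw [show ε * n = ε / 2 * n + ε / 2 * n by ring, Real.exp_add]
  gcongr

lemma of_limsup {a : ℕ → ℝ} (ha : ∀ n, 0 ≤ a n)
    (h : limsup (fun n : ℕ => ((Real.log (a n) / n : ℝ) : EReal)) atTop ≤ 0) : SubExp a := by
  refine of_eventually fun ε hε => ?_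
  have h1 : limsup (fun n : ℕ => ((Real.log (a n) / n : ℝ) : EReal)) atTop < (ε : EReal) :=
    h.trans_lt (by exact_mod_cast hε)
  filter_upwards [eventually_lt_of_limsup_lt h1, eventually_gt_atTop 0] with n hn hn0
  rw [abs_of_nonneg (ha n)]
  rcases (ha n).eq_or_lt with h0 | h0
  · rw [← h0]; positivity
  · have hn' : Real.log (a n) / n < ε := by exact_mod_cast hn
    rw [div_lt_iff₀ (by exact_mod_cast hn0)] at hn'
    exact ((Real.log_lt_iff_lt_exp h0).1 hn').le

lemma limsup_le {a : ℕ → ℝ} (ha : ∀ n, 0 ≤ a n) (h : SubExp a) :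
    limsup (fun n : ℕ => ((Real.log (a n) / n : ℝ) : EReal)) atTop ≤ 0 := by
  refine EReal.le_of_forall_lt_iff_le.1 fun ε hε => ?_
  have hε : 0 < ε := by exact_mod_cast hε
  refine limsup_le_of_le (h := ?_)
  filter_upwards [h.eventually_le hε, eventually_gt_atTop 0] with n hn hn0
  rw [abs_of_nonneg (ha n)] at hn
  have : Real.log (a n) / n ≤ ε := by
    rw [div_le_iff₀ (by exact_mod_cast hn0)]
    rcases (ha n).eq_or_lt with h0 | h0
    · rw [← h0, Real.log_zero]; positivity
    · exact (Real.log_le_iff_le_exp h0).2 hn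
  exact_mod_cast this

/-- A subexponential sequence of numbers `≥ 1` has growth rate exactly zero. -/
lemma limsup_eq_zero {a : ℕ → ℝ} (ha : ∀ n, 1 ≤ a n) (h : SubExp a) :
    limsup (fun n : ℕ => ((Real.log (a n) / n : ℝ) : EReal)) atTop = 0 := by
  refine le_antisymm (h.limsup_le fun n => zero_le_one.trans (ha n)) ?_
  refine le_limsup_of_frequently_le (Frequently.of_forall fun n => ?_)
  have : 0 ≤ Real.log (a n) / n := div_nonneg (Real.log_nonneg (ha n)) (by positivity)
  exact_mod_cast this

end SubExp

lemma subExp_of_tendsto_log {a : ℕ → ℝ} (ha : ∀ n, 0 < a n) {c : ℝ}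
    (h : Tendsto (fun n : ℕ => Real.log (a n) / n) atTop (𝓝 c)) :
    SubExp (fun n => Real.exp (-(n * c)) * a n) ∧ SubExp (fun n => Real.exp (n * c) * (a n)⁻¹) := by
  constructor
  · refine SubExp.of_eventually fun ε hε => ?_
    filter_upwards [h.eventually_lt_const (lt_add_of_pos_right c hε), eventually_gt_atTop 0]
      with n hn hn0
    rw [div_lt_iff₀ (by exact_mod_cast hn0), Real.log_lt_iff_lt_exp (ha n)] at hn
    rw [abs_of_nonneg (mul_nonneg (Real.exp_pos _).le (ha n).le)]
    refine (mul_le_mul_of_nonneg_left hn.le (Real.exp_pos _).le).trans (le_of_eq ?_)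
    rw [← Real.exp_add]
    ring_nf
  · refine SubExp.of_eventually fun ε hε => ?_
    filter_upwards [h.eventually_const_lt (sub_lt_self c hε), eventually_gt_atTop 0]
      with n hn hn0
    rw [lt_div_iff₀ (by exact_mod_cast hn0), Real.lt_log_iff_exp_lt (ha n)] at hn
    rw [abs_of_nonneg (mul_nonneg (Real.exp_pos _).le (inv_pos.2 (ha n)).le),
      mul_inv_le_iff₀ (ha n)]
    refine le_trans (le_of_eq ?_) (mul_le_mul_of_nonneg_left hn.le (Real.exp_pos _).le)
    rw [← Real.exp_add]
    ring_nf

lemma tendsto_log_of_subExp {a : ℕ → ℝ} (ha : ∀ n, 0 < a n) {c : ℝ}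
    (h1 : SubExp (fun n => Real.exp (-(n * c)) * a n))
    (h2 : SubExp (fun n => Real.exp (n * c) * (a n)⁻¹)) :
    Tendsto (fun n : ℕ => Real.log (a n) / n) atTop (𝓝 c) := by
  rw [Metric.tendsto_nhds]
  intro ε hε
  filter_upwards [h1.eventually_le (half_pos hε), h2.eventually_le (half_pos hε),
    eventually_gt_atTop 0] with n hn1 hn2 hn0
  have hn : (0 : ℝ) < n := by exact_mod_cast hn0
  rw [abs_of_pos (mul_pos (Real.exp_pos _) (ha n)),
    ← Real.log_le_iff_le_exp (mul_pos (Real.exp_pos _) (ha n)),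
    Real.log_mul (Real.exp_ne_zero _) (ha n).ne', Real.log_exp] at hn1
  rw [abs_of_pos (mul_pos (Real.exp_pos _) (inv_pos.2 (ha n))),
    ← Real.log_le_iff_le_exp (mul_pos (Real.exp_pos _) (inv_pos.2 (ha n))),
    Real.log_mul (Real.exp_ne_zero _) (inv_pos.2 (ha n)).ne', Real.log_exp, Real.log_inv] at hn2
  rw [Real.dist_eq, abs_lt]
  constructor
  · rw [neg_lt_sub_iff_lt_add, ← sub_lt_iff_lt_add', lt_div_iff₀ hn]
    nlinarith
  · rw [sub_lt_iff_lt_add, div_lt_iff₀ hn]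
    nlinarith

/-- The exponential growth rate of a sequence of vectors is at most `χ` if and only if the
sequence is `e^{nχ}` up to a subexponential factor. -/
lemma limsup_log_enorm_le_iff {F : ℕ → Type*} [∀ i, NormedAddCommGroup (F i)] (x : ∀ n, F n)
    (χ : ℝ) :
    limsup (fun n : ℕ => ENNReal.log ‖x n‖ₑ / (n : EReal)) atTop ≤ χ ↔
      SubExp fun n => Real.exp (-(n * χ)) * ‖x n‖ := by
  have key : ∀ (c : ℝ) (n : ℕ), 0 < n →
      (ENNReal.log ‖x n‖ₑ / (n : EReal) ≤ c ↔ ‖x n‖ ≤ Real.exp (n * c)) := by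
    intro c n hn
    rw [EReal.div_le_iff_le_mul (by exact_mod_cast hn) (EReal.natCast_ne_top n)]
    rcases (norm_nonneg (x n)).eq_or_lt with h0 | h0
    · have hx : x n = 0 := norm_eq_zero.1 h0.symm
      simp [hx, Real.exp_nonneg]
    · rw [← ofReal_norm, ENNReal.log_ofReal_of_pos h0, ← Real.log_le_iff_le_exp h0]
      have : ((n : EReal) * (c : EReal)) = ((n * c : ℝ) : EReal) := by simp
      rw [this]
      exact EReal.coe_le_coe_iff
  constructor
  · intro h
    refine SubExp.of_eventually fun ε hε => ?_
    have h1 : limsup (fun n : ℕ => ENNReal.log ‖x n‖ₑ / (n : EReal)) atTop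
        < ((χ + ε : ℝ) : EReal) := h.trans_lt (by exact_mod_cast lt_add_of_pos_right χ hε)
    filter_upwards [eventually_lt_of_limsup_lt h1, eventually_gt_atTop 0] with n hn hn0
    have hn' := (key _ _ hn0).1 hn.le
    rw [abs_of_nonneg (by positivity)]
    refine (mul_le_mul_of_nonneg_left hn' (Real.exp_pos _).le).trans (le_of_eq ?_)
    rw [← Real.exp_add]
    ring_nf
  · intro h
    refine EReal.le_of_forall_lt_iff_le.1 fun c hc => ?_
    have hc : χ < c := by exact_mod_cast hc
    refine limsup_le_of_le (h := ?_)
    filter_upwards [h.eventually_le (sub_pos.2 hc), eventually_gt_atTop 0] with n hn hn0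
    refine (key _ _ hn0).2 ?_
    rw [abs_of_nonneg (by positivity)] at hn
    have := mul_le_mul_of_nonneg_left hn (Real.exp_pos (n * χ)).le
    rw [← mul_assoc, ← Real.exp_add, ← Real.exp_add] at this
    ring_nf at this ⊢
    simpa using this

/-! ### Determinants between inner product spaces -/

/-- Hadamard's inequality for the determinant of a family of vectors in an orthonormal basis. -/
lemma OrthonormalBasis.abs_det_le_prod_norm {F : Type*} [NormedAddCommGroup F]
    [InnerProductSpace ℝ F] {ι : Type*} [Fintype ι] [DecidableEq ι] (c : OrthonormalBasis ι ℝ F)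
    (u : ι → F) : |c.toBasis.det u| ≤ ∏ i, ‖u i‖ := by
  let e := Fintype.equivFin ι
  have : Fact (Module.finrank ℝ F = Fintype.card ι) := ⟨Module.finrank_eq_card_basis c.toBasis⟩
  have h1 : c.toBasis.det u = (c.reindex e).toBasis.det (u ∘ e.symm) := by
    rw [OrthonormalBasis.reindex_toBasis, Module.Basis.det_reindex]
    congr 1
    ext i
    simp
  rw [h1, ← (c.reindex e).toBasis.orientation.volumeForm_robust (c.reindex e) rfl]
  refine (Orientation.abs_volumeForm_apply_le _ _).trans (le_of_eq ?_)
  exact Equiv.prod_comp e.symm fun i => ‖u i‖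

section AbsDet

variable {E F G : Type*} [NormedAddCommGroup E] [InnerProductSpace ℝ E] [FiniteDimensional ℝ E]
  [NormedAddCommGroup F] [InnerProductSpace ℝ F] [FiniteDimensional ℝ F]
  [NormedAddCommGroup G] [InnerProductSpace ℝ G] [FiniteDimensional ℝ G]

lemma absDet_eq_abs_det_toMatrix {ι : Type*} [Fintype ι] [DecidableEq ι]
    (b : OrthonormalBasis ι ℝ E) (c : OrthonormalBasis ι ℝ F) (A : E →L[ℝ] F) :
    absDet A = |(LinearMap.toMatrix b.toBasis c.toBasis (A : E →ₗ[ℝ] F)).det| := by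
  rw [absDet, ← LinearMap.det_toMatrix b.toBasis, LinearMap.toMatrix_comp b.toBasis c.toBasis,
    LinearMap.toMatrix_adjoint b c, Matrix.det_mul, Matrix.det_conjTranspose, star_trivial,
    Real.sqrt_mul_self_eq_abs]

lemma nonempty_orthonormalBasis_of_finrank_eq_card {ι : Type*} [Fintype ι]
    (h : Module.finrank ℝ E = Fintype.card ι) : Nonempty (OrthonormalBasis ι ℝ E) :=
  ⟨(stdOrthonormalBasis ℝ E).reindex ((finCongr h).trans (Fintype.equivFin ι).symm)⟩

lemma nonempty_orthonormalBasis_of_finrank_eq {d : ℕ} (h : Module.finrank ℝ E = d) :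
    Nonempty (OrthonormalBasis (Fin d) ℝ E) :=
  ⟨(stdOrthonormalBasis ℝ E).reindex (finCongr h)⟩

lemma absDet_comp (hEF : Module.finrank ℝ E = Module.finrank ℝ F)
    (hFG : Module.finrank ℝ F = Module.finrank ℝ G) (B : F →L[ℝ] G) (A : E →L[ℝ] F) :
    absDet (B.comp A) = absDet B * absDet A := by
  obtain ⟨a⟩ := nonempty_orthonormalBasis_of_finrank_eq hEF
  obtain ⟨b⟩ := nonempty_orthonormalBasis_of_finrank_eq (rfl : Module.finrank ℝ F = _)
  obtain ⟨c⟩ := nonempty_orthonormalBasis_of_finrank_eq hFG.symm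
  rw [absDet_eq_abs_det_toMatrix a c, absDet_eq_abs_det_toMatrix a b,
    absDet_eq_abs_det_toMatrix b c, ContinuousLinearMap.toLinearMap_comp,
    LinearMap.toMatrix_comp a.toBasis b.toBasis, Matrix.det_mul, abs_mul]

lemma absDet_endomorphism (A : E →L[ℝ] E) : absDet A = |LinearMap.det (A : E →ₗ[ℝ] E)| := by
  rw [absDet_eq_abs_det_toMatrix (stdOrthonormalBasis ℝ E) (stdOrthonormalBasis ℝ E),
    LinearMap.det_toMatrix]

lemma absDet_pos (hEF : Module.finrank ℝ E = Module.finrank ℝ F) {A : E →L[ℝ] F}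
    (hA : Function.Injective A) : 0 < absDet A := by
  refine Real.sqrt_pos.2 (lt_of_le_of_ne ?_ ?_)
  · obtain ⟨a⟩ := nonempty_orthonormalBasis_of_finrank_eq hEF
    obtain ⟨b⟩ := nonempty_orthonormalBasis_of_finrank_eq (rfl : Module.finrank ℝ F = _)
    rw [← LinearMap.det_toMatrix a.toBasis, LinearMap.toMatrix_comp a.toBasis b.toBasis,
      LinearMap.toMatrix_adjoint a b, Matrix.det_mul, Matrix.det_conjTranspose, star_trivial]
    exact mul_self_nonneg _
  · intro h0
    obtain ⟨x, hx, hx0⟩ := SetLike.exists_of_lt (LinearMap.bot_lt_ker_of_det_eq_zero h0.symm)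
    refine hx0 ?_
    have h1 : LinearMap.adjoint (A : E →ₗ[ℝ] F) (A x) = 0 := hx
    have h2 : inner ℝ (A x) (A x) = 0 := by
      have := LinearMap.adjoint_inner_left (A : E →ₗ[ℝ] F) x (A x)
      rw [h1, inner_zero_left] at this
      exact this.symm
    have h3 : A x = 0 := inner_self_eq_zero.1 h2
    exact hA (h3.trans (map_zero A).symm)

/-- Hadamard's inequality for a linear map and an arbitrary family of vectors. -/
lemma absDet_mul_abs_det_le {ι : Type*} [Fintype ι] [DecidableEq ι]
    (hF : Module.finrank ℝ F = Fintype.card ι)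
    (b : OrthonormalBasis ι ℝ E) (A : E →L[ℝ] F) (v : ι → E) :
    absDet A * |b.toBasis.det v| ≤ ∏ i, ‖A (v i)‖ := by
  obtain ⟨c⟩ := nonempty_orthonormalBasis_of_finrank_eq_card hF
  refine le_trans (le_of_eq ?_) (c.abs_det_le_prod_norm fun i => A (v i))
  rw [absDet_eq_abs_det_toMatrix b c, ← abs_mul, Module.Basis.det_apply, Module.Basis.det_apply,
    ← Matrix.det_mul]
  congr 2
  ext i j
  have := congrFun (LinearMap.toMatrix_mulVec_repr b.toBasis c.toBasis (A : E →ₗ[ℝ] F) (v j)) i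
  simpa [Matrix.mul_apply, Matrix.mulVec, dotProduct, Module.Basis.toMatrix_apply] using this

lemma absDet_le_norm_pow {d : ℕ} (hE : Module.finrank ℝ E = d) (hF : Module.finrank ℝ F = d)
    (A : E →L[ℝ] F) : absDet A ≤ ‖A‖ ^ d := by
  obtain ⟨b⟩ := nonempty_orthonormalBasis_of_finrank_eq hE
  have h := absDet_mul_abs_det_le (hF.trans (Fintype.card_fin d).symm) b A b
  rw [← b.coe_toBasis, Module.Basis.det_self, abs_one, mul_one] at h
  refine h.trans ((Finset.prod_le_prod (fun i _ => norm_nonneg _)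
    fun i _ => A.le_opNorm _).trans (le_of_eq ?_))
  simp

/-- A linear map cannot contract a vector strongly unless its determinant is small compared with
its norm. -/
lemma absDet_mul_norm_le {d : ℕ} (hE : Module.finrank ℝ E = d) (hF : Module.finrank ℝ F = d)
    (A : E →L[ℝ] F) (x : E) : absDet A * ‖x‖ ≤ ‖A x‖ * ‖A‖ ^ (d - 1) := by
  rcases eq_or_ne x 0 with rfl | hx
  · simp
  have hx' : ‖x‖ ≠ 0 := norm_ne_zero_iff.2 hx
  have hd : 0 < d := by
    rw [← hE]
    exact Module.finrank_pos_iff_exists_ne_zero.2 ⟨x, hx⟩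
  let i0 : Fin d := ⟨0, hd⟩
  let u : E := ‖x‖⁻¹ • x
  have hu : ‖u‖ = 1 := by simp [u, norm_smul, hx']
  -- Complete the unit vector in the direction of `x` to an orthonormal basis.
  obtain ⟨b, hb⟩ := Orthonormal.exists_orthonormalBasis_extension_of_card_eq (𝕜 := ℝ)
    (ι := Fin d) (v := fun _ => u) (s := {i0}) (by simpa using hE) (by
      constructor
      · intro i; exact hu
      · intro i j hij
        exact (hij (Subsingleton.elim _ _)).elim)
  have hb0 : b i0 = u := hb i0 rfl
  have h := absDet_mul_abs_det_le (hF.trans (Fintype.card_fin d).symm) b A b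
  rw [← b.coe_toBasis, Module.Basis.det_self, abs_one, mul_one, b.coe_toBasis,
    ← Finset.mul_prod_erase _ _ (Finset.mem_univ i0), hb0] at h
  have h2 : ∏ i ∈ Finset.univ.erase i0, ‖A (b i)‖ ≤ ‖A‖ ^ (d - 1) := by
    refine (Finset.prod_le_prod (fun i _ => norm_nonneg _)
      fun i _ => A.le_opNorm _).trans (le_of_eq ?_)
    simp
  have h3 : ‖A u‖ = ‖x‖⁻¹ * ‖A x‖ := by simp [u, norm_smul]
  calc absDet A * ‖x‖ ≤ (‖A u‖ * ‖A‖ ^ (d - 1)) * ‖x‖ := by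
        gcongr
        exact h.trans (by gcongr)
    _ = ‖A x‖ * ‖A‖ ^ (d - 1) := by
        rw [h3]
        field_simp

/-- A bound for the inverse of a linear map in terms of its determinant and its norm; it is used to
turn subexponential control of these two into control of the inverses. -/
lemma norm_symm_le {d : ℕ} (hE : Module.finrank ℝ E = d) (A : E ≃L[ℝ] F) :
    ‖(A.symm : F →L[ℝ] E)‖ ≤ (absDet (A : E →L[ℝ] F))⁻¹ * ‖(A : E →L[ℝ] F)‖ ^ (d - 1) := by
  have hEF := A.toLinearEquiv.finrank_eq
  have hpos : 0 < absDet (A : E →L[ℝ] F) := absDet_pos hEF A.injective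
  refine ContinuousLinearMap.opNorm_le_bound _ (by positivity) fun y => ?_
  have h := absDet_mul_norm_le hE (hEF ▸ hE) (A : E →L[ℝ] F) (A.symm y)
  rw [mul_comm, ← le_div_iff₀ hpos] at h
  refine h.trans (le_of_eq ?_)
  simp
  field_simp

end AbsDet

/-! ### Adapted bases -/

section Adapted

variable {E : Type*} [AddCommGroup E] [Module ℝ E] {ι : Type*}

/-- The basis `b`, with the numbers `χ i` attached to its vectors, is adapted to the
weight-like function `W`: the value of `W` on a vector is the largest `χ i` over the basis vectors
that occur in it.  The formulation by sublevel sets also covers the value `-∞` at `0`. -/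
def IsAdapted (W : E → EReal) (b : Module.Basis ι ℝ E) (χ : ι → ℝ) : Prop :=
  ∀ (x : E) (r : ℝ), W x ≤ r ↔ ∀ i, b.repr x i ≠ 0 → χ i ≤ r

namespace IsAdapted

variable {W : E → EReal} {b : Module.Basis ι ℝ E} {χ : ι → ℝ}

lemma apply_basis (h : IsAdapted W b χ) (i : ι) : W (b i) = χ i := by
  have key : ∀ r : ℝ, W (b i) ≤ r ↔ χ i ≤ r := fun r => by
    rw [h]
    constructor
    · intro hr
      exact hr i (by simp)
    · intro hr j hj
      rw [b.repr_self, Finsupp.single_apply_ne_zero] at hj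
      exact hj.1 ▸ hr
  refine le_antisymm ((key _).2 le_rfl) (EReal.le_of_forall_lt_iff_le.1 fun r hr => ?_)
  exact_mod_cast (key r).1 hr.le

lemma lt_iff (h : IsAdapted W b χ) (x : E) (r : ℝ) :
    W x < r ↔ ∀ i, b.repr x i ≠ 0 → χ i < r := by
  constructor
  · intro hr i hi
    obtain ⟨s, hs, hs'⟩ := EReal.lt_iff_exists_real_btwn.1 hr
    exact ((h x s).1 hs.le i hi).trans_lt (by exact_mod_cast hs')
  · intro hr
    by_cases hx : (b.repr x).support.Nonempty
    · obtain ⟨i, hi, hmax⟩ := Finset.exists_max_image _ χ hx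
      refine lt_of_le_of_lt ((h x (χ i)).2 fun j hj => hmax j (by simpa using hj)) ?_
      exact_mod_cast hr i (by simpa using hi)
    · have : W x ≤ ((r - 1 : ℝ) : EReal) :=
        (h x _).2 fun i hi => (hx ⟨i, by simpa using hi⟩).elim
      exact this.trans_lt (by exact_mod_cast sub_one_lt r)

lemma exists_eq (h : IsAdapted W b χ) {x : E} (hx : x ≠ 0) :
    ∃ i, b.repr x i ≠ 0 ∧ W x = χ i ∧ ∀ j, b.repr x j ≠ 0 → χ j ≤ χ i := by
  have hne : (b.repr x).support.Nonempty := by simpa using hx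
  obtain ⟨i, hi, hmax⟩ := Finset.exists_max_image _ χ hne
  have hi' : b.repr x i ≠ 0 := by simpa using hi
  have hle : W x ≤ χ i := (h x (χ i)).2 fun j hj => hmax j (by simpa using hj)
  refine ⟨i, hi', le_antisymm hle (not_lt.1 fun hlt => ?_), fun j hj => hmax j (by simpa using hj)⟩
  exact lt_irrefl _ ((h.lt_iff x _).1 hlt i hi')

lemma weightValues_eq (h : IsAdapted W b χ) : weightValues W = Set.range χ := by
  ext c
  constructor
  · rintro ⟨x, hx, hc⟩
    obtain ⟨i, -, hi, -⟩ := h.exists_eq hx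
    exact ⟨i, by rw [hi] at hc; exact_mod_cast hc⟩
  · rintro ⟨i, rfl⟩
    exact ⟨b i, b.ne_zero i, h.apply_basis i⟩

end IsAdapted

lemma Module.Basis.finrank_span_setOf_repr [Fintype ι] (b : Module.Basis ι ℝ E) (p : ι → Prop)
    [DecidablePred p] :
    Module.finrank ℝ (Submodule.span ℝ {x : E | ∀ i, b.repr x i ≠ 0 → p i}) =
      (Finset.univ.filter p).card := by
  have h : Submodule.span ℝ {x : E | ∀ i, b.repr x i ≠ 0 → p i} =
      Submodule.span ℝ (Set.range fun i : {i // p i} => b i) := by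
    have h1 : (Set.range fun i : {i // p i} => b i) = b '' {i | p i} := by
      ext; simp
    rw [h1]
    refine le_antisymm (Submodule.span_le.2 fun x hx => ?_) (Submodule.span_mono ?_)
    · rw [SetLike.mem_coe, b.mem_span_image]
      intro i hi
      exact hx i (by simpa using hi)
    · rintro _ ⟨i, hi, rfl⟩ j hj
      rw [b.repr_self, Finsupp.single_apply_ne_zero] at hj
      exact hj.1 ▸ hi
  rw [h, ← Fintype.card_subtype]
  exact finrank_span_eq_card (b.linearIndependent.comp _ Subtype.val_injective)

namespace IsAdapted

variable [Fintype ι] {W : E → EReal} {b : Module.Basis ι ℝ E} {χ : ι → ℝ}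

lemma finrank_le (h : IsAdapted W b χ) (c : ℝ) :
    Module.finrank ℝ (Submodule.span ℝ {x | W x ≤ c}) = (Finset.univ.filter (χ · ≤ c)).card := by
  rw [← b.finrank_span_setOf_repr, (Set.ext fun x => h x c : {x | W x ≤ c} = _)]
  rfl

lemma weightMult_eq (h : IsAdapted W b χ) (c : ℝ) :
    weightMult W c = (Finset.univ.filter (χ · = c)).card := by
  classical
  have h1 : Module.finrank ℝ (Submodule.span ℝ {x | W x < c})
      = (Finset.univ.filter (χ · < c)).card := by
    rw [← b.finrank_span_setOf_repr, (Set.ext fun x => h.lt_iff x c : {x | W x < c} = _)]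
    rfl
  rw [weightMult, h.finrank_le, h1, tsub_eq_iff_eq_add_of_le, add_comm,
    ← Finset.card_union_of_disjoint]
  · congr 1
    ext i
    simp [le_iff_lt_or_eq]
  · rw [Finset.disjoint_filter]
    intro i _ h1 h2
    exact h1.ne h2
  · exact Finset.card_le_card (Finset.monotone_filter_right _ fun i _ hi => le_of_lt hi)

/-- The sum of the values of a weight counted with multiplicity is the sum over an adapted basis. -/
lemma finsum_weightMult (h : IsAdapted W b χ) :
    ∑ᶠ c ∈ weightValues W, (weightMult W c : ℝ) * c = ∑ i, χ i := by
  classical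
  rw [h.weightValues_eq]
  have h1 : (Set.range χ) = ((Finset.univ.image χ : Finset ℝ) : Set ℝ) := by simp
  rw [h1, finsum_mem_coe_finset, Finset.sum_comp (fun c : ℝ => c) χ]
  refine Finset.sum_congr rfl fun c _ => ?_
  rw [h.weightMult_eq, nsmul_eq_mul]

end IsAdapted

/-- Replacing a basis vector by a vector in which it occurs gives a basis. -/
lemma Module.Basis.exists_replace [Fintype ι] [DecidableEq ι] (b : Module.Basis ι ℝ E) {x : E}
    {i : ι} (hi : b.repr x i ≠ 0) :
    ∃ b' : Module.Basis ι ℝ E, ⇑b' = Function.update b i x := by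
  have hdet : b.det (Function.update b i x) = b.repr x i := by
    conv_lhs => rw [← b.sum_repr x]
    rw [AlternatingMap.map_update_sum, Finset.sum_eq_single i]
    · rw [AlternatingMap.map_update_smul, Function.update_eq_self, b.det_self, smul_eq_mul, mul_one]
    · intro j _ hj
      rw [AlternatingMap.map_update_smul, AlternatingMap.map_update_self _ _ hj.symm, smul_zero]
    · simp
  obtain ⟨hli, hsp⟩ := (is_basis_iff_det b).2
    (show IsUnit (b.det (Function.update b i x)) from hdet ▸ isUnit_iff_ne_zero.2 hi)
  exact ⟨Module.Basis.mk hli hsp.ge, Module.Basis.coe_mk _ _⟩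

/-- A basis with the least possible sum of values is adapted: otherwise a basis vector could be
replaced by a vector in which it occurs and on which the weight is smaller. -/
lemma isAdapted_of_minimal [Fintype ι] {W : E → EReal}
    (hW : ∀ r : ℝ, ∃ S : Submodule ℝ E, ∀ x, x ∈ S ↔ W x ≤ r)
    {b : Module.Basis ι ℝ E} {χ : ι → ℝ} (hb : ∀ i, W (b i) ≤ χ i)
    (hmin : ∀ (b' : Module.Basis ι ℝ E) (χ' : ι → ℝ), (∀ i, W (b' i) ≤ χ' i) →
      ∑ i, χ i ≤ ∑ i, χ' i) : IsAdapted W b χ := by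
  classical
  intro x r
  constructor
  · intro hx i hi
    by_contra! hr
    obtain ⟨b', hb'⟩ := b.exists_replace hi
    have h1 := hmin b' (Function.update χ i r) fun j => by
      rw [hb']
      by_cases hj : j = i
      · subst hj; simpa using hx
      · simpa [hj] using hb j
    rw [Finset.sum_update_of_mem (Finset.mem_univ i),
      ← Finset.add_sum_erase _ _ (Finset.mem_univ i), Finset.sdiff_singleton_eq_erase] at h1
    linarith
  · intro h
    obtain ⟨S, hS⟩ := hW r
    rw [← hS, ← b.sum_repr x]
    refine S.sum_mem fun i _ => ?_
    by_cases hi : b.repr x i = 0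
    · simp [hi]
    · exact S.smul_mem _ ((hS _).2 ((hb i).trans (by exact_mod_cast h i hi)))

lemma Weight.exists_submodule (ϖ : Weight E) (r : EReal) :
    ∃ S : Submodule ℝ E, ∀ x, x ∈ S ↔ ϖ x ≤ r :=
  ⟨{ carrier := {x | ϖ x ≤ r}
     add_mem' := fun ha hb => (ϖ.le_max _ _).trans (max_le ha hb)
     zero_mem' := by simp [ϖ.map_zero]
     smul_mem' := fun c _ hx => (ϖ.smul_le c _).trans hx }, fun _ => Iff.rfl⟩

lemma Weight.exists_real (ϖ : Weight E) {x : E} (hx : x ≠ 0) : ∃ r : ℝ, ϖ x = r :=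
  ⟨(ϖ x).toReal, (EReal.coe_toReal (ϖ.ne_top x) fun h => hx ((ϖ.eq_bot_iff x).1 h)).symm⟩

/-- A weight with finitely many values has an adapted basis. -/
lemma Weight.exists_adapted [FiniteDimensional ℝ E] (ϖ : Weight E)
    (hfin : (weightValues ϖ).Finite) :
    ∃ (b : Module.Basis (Fin (Module.finrank ℝ E)) ℝ E) (χ : Fin (Module.finrank ℝ E) → ℝ),
      IsAdapted ϖ b χ := by
  let s : Module.Basis (Fin (Module.finrank ℝ E)) ℝ E → ℝ := fun b => ∑ i, (ϖ (b i)).toReal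
  have hval : ∀ (b : Module.Basis (Fin (Module.finrank ℝ E)) ℝ E) i,
      ϖ (b i) = ((ϖ (b i)).toReal : EReal) := fun b i => by
    obtain ⟨r, hr⟩ := ϖ.exists_real (b.ne_zero i)
    rw [hr, EReal.toReal_coe]
  have hsfin : (Set.range s).Finite := by
    refine ((Set.Finite.pi fun _ : Fin (Module.finrank ℝ E) => hfin).image
      fun c => ∑ i, c i).subset ?_
    rintro _ ⟨b, rfl⟩
    exact ⟨fun i => (ϖ (b i)).toReal, fun i _ => ⟨b i, b.ne_zero i, hval b i⟩, rfl⟩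
  obtain ⟨_, ⟨b, rfl⟩, hb⟩ := Set.exists_min_image (Set.range s) id hsfin
    ⟨_, Module.finBasis ℝ E, rfl⟩
  refine ⟨b, fun i => (ϖ (b i)).toReal, isAdapted_of_minimal (fun r => ϖ.exists_submodule r)
    (fun i => (hval b i).le) fun b' χ' h' => ?_⟩
  refine (hb _ ⟨b', rfl⟩).trans (Finset.sum_le_sum fun i _ => ?_)
  have := h' i
  rw [hval b' i] at this
  exact_mod_cast this

end Adapted

/-! ### Forwards regularity from a basis with good growth -/

section Lyapunov

variable {E : ℕ → Type*} [∀ i, NormedAddCommGroup (E i)] [∀ i, InnerProductSpace ℝ (E i)]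

lemma lyapunovWeight_le_iff (A : ∀ i, E i →L[ℝ] E (i + 1)) (v : E 0) (χ : ℝ) :
    lyapunovWeight A v ≤ χ ↔ SubExp fun n => Real.exp (-(n * χ)) * ‖cocycle A n v‖ :=
  limsup_log_enorm_le_iff (fun n => cocycle A n v) χ

/-- The sublevel sets of the Lyapunov weight are subspaces. -/
lemma lyapunovWeight_exists_submodule (A : ∀ i, E i →L[ℝ] E (i + 1)) (r : ℝ) :
    ∃ S : Submodule ℝ (E 0), ∀ x, x ∈ S ↔ lyapunovWeight A x ≤ r := by
  refine ⟨⟨⟨⟨{x | SubExp fun n => Real.exp (-(n * r)) * ‖cocycle A n x‖}, ?_⟩, ?_⟩, ?_⟩,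
    fun x => (lyapunovWeight_le_iff A x r).symm⟩
  · intro x y hx hy
    refine (SubExp.add hx hy).of_le (fun n => by positivity) fun n => ?_
    rw [map_add, ← mul_add]
    gcongr
    exact norm_add_le _ _
  · simpa using SubExp.const 0
  · intro c x hx
    refine ((SubExp.const ‖c‖).mul hx).of_abs_le fun n => le_of_eq ?_
    rw [map_smul, norm_smul]
    congr 1
    ring

variable [∀ i, FiniteDimensional ℝ (E i)] {ι : Type*} [Fintype ι]

lemma subExp_absDet_cocycle (A : ∀ i, E i →L[ℝ] E (i + 1))
    (hdim : ∀ n, Module.finrank ℝ (E n) = Fintype.card ι) (b : Module.Basis ι ℝ (E 0)) (χ : ι → ℝ)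
    (hb : ∀ i, lyapunovWeight A (b i) ≤ χ i) :
    SubExp fun n : ℕ => Real.exp (-(n * ∑ i, χ i)) * absDet (cocycle A n) := by
  classical
  obtain ⟨o⟩ := nonempty_orthonormalBasis_of_finrank_eq_card (hdim 0)
  have hδ : 0 < |o.toBasis.det b| := abs_pos.2 (o.toBasis.isUnit_det b).ne_zero
  refine ((SubExp.const |o.toBasis.det b|⁻¹).mul (SubExp.prod Finset.univ fun i _ =>
    (lyapunovWeight_le_iff A (b i) (χ i)).1 (hb i))).of_le
      (fun n => mul_nonneg (Real.exp_pos _).le (Real.sqrt_nonneg _)) fun n => ?_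
  rw [Finset.prod_mul_distrib, ← Real.exp_sum, Finset.sum_neg_distrib, ← Finset.mul_sum,
    mul_left_comm]
  gcongr
  rw [inv_mul_eq_div, le_div_iff₀ hδ]
  exact absDet_mul_abs_det_le (hdim n) o (cocycle A n) b

/-- If the vectors of a basis grow at most at the rates `χ i` while the determinants grow at least
at the rate `∑ i, χ i`, then Hadamard's inequality makes the basis adapted to the Lyapunov
weight. -/
lemma isAdapted_lyapunovWeight (A : ∀ i, E i →L[ℝ] E (i + 1))
    (hdim : ∀ n, Module.finrank ℝ (E n) = Fintype.card ι) (b : Module.Basis ι ℝ (E 0)) (χ : ι → ℝ)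
    (hb : ∀ i, lyapunovWeight A (b i) ≤ χ i) (hpos : ∀ n, 0 < absDet (cocycle A n))
    (hdet : SubExp fun n : ℕ => Real.exp (n * ∑ i, χ i) * (absDet (cocycle A n))⁻¹) :
    IsAdapted (lyapunovWeight A) b χ := by
  refine isAdapted_of_minimal (lyapunovWeight_exists_submodule A) hb fun b' χ' hb' => ?_
  have h := hdet.mul (subExp_absDet_cocycle A hdim b' χ' hb')
  by_contra! hlt
  have h2 : ∀ᶠ n : ℕ in atTop, False := by
    filter_upwards [h.eventually_le (half_pos (sub_pos.2 hlt)), eventually_gt_atTop 0] with n hn hn0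
    have hn0' : (0 : ℝ) < n := by exact_mod_cast hn0
    rw [mul_mul_mul_comm, inv_mul_cancel₀ (hpos n).ne', mul_one, ← Real.exp_add, Real.abs_exp,
      Real.exp_le_exp] at hn
    nlinarith
  exact h2.exists.choose_spec

lemma tendsto_log_absDet_cocycle (A : ∀ i, E i →L[ℝ] E (i + 1))
    (hdim : ∀ n, Module.finrank ℝ (E n) = Fintype.card ι) (b : Module.Basis ι ℝ (E 0)) (χ : ι → ℝ)
    (hb : ∀ i, lyapunovWeight A (b i) ≤ χ i) (hpos : ∀ n, 0 < absDet (cocycle A n))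
    (hdet : SubExp fun n : ℕ => Real.exp (n * ∑ i, χ i) * (absDet (cocycle A n))⁻¹) :
    Tendsto (fun n : ℕ => Real.log (absDet (cocycle A n)) / n) atTop (𝓝 (∑ i, χ i)) :=
  tendsto_log_of_subExp hpos (subExp_absDet_cocycle A hdim b χ hb) hdet

end Lyapunov

/-! ### Diagonal maps -/

section Diagonal

variable {E : Type*} [NormedAddCommGroup E] [NormedSpace ℝ E] [FiniteDimensional ℝ E]
  {ι : Type*}

/-- The linear automorphism that multiplies the basis vector `b i` by `e^{t i}`. -/
noncomputable def diagExp (b : Module.Basis ι ℝ E) (t : ι → ℝ) : E ≃L[ℝ] E :=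
  (LinearEquiv.ofLinearMap (b.constr ℝ fun i => Real.exp (t i) • b i)
    (b.constr ℝ fun i => Real.exp (-t i) • b i)
    (b.ext fun i => by simp [smul_smul, ← Real.exp_add])
    (b.ext fun i => by simp [smul_smul, ← Real.exp_add])).toContinuousLinearEquiv

@[simp]
lemma diagExp_basis (b : Module.Basis ι ℝ E) (t : ι → ℝ) (i : ι) :
    diagExp b t (b i) = Real.exp (t i) • b i := by
  show (b.constr ℝ fun i => Real.exp (t i) • b i) (b i) = _
  rw [b.constr_basis]

lemma repr_diagExp (b : Module.Basis ι ℝ E) (t : ι → ℝ) (x : E) (i : ι) :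
    b.repr (diagExp b t x) i = Real.exp (t i) * b.repr x i := by
  have : b.coord i ∘ₗ ((diagExp b t : E →L[ℝ] E) : E →ₗ[ℝ] E) = Real.exp (t i) • b.coord i := by
    refine b.ext fun j => ?_
    rcases eq_or_ne j i with rfl | h
    · simp
    · simp [Finsupp.single_eq_of_ne' h]
  exact LinearMap.congr_fun this x

lemma IsAdapted.diagExp {W : E → EReal} {b : Module.Basis ι ℝ E} {χ : ι → ℝ}
    (h : IsAdapted W b χ) (t : ι → ℝ) (x : E) (r : ℝ) : W (diagExp b t x) ≤ r ↔ W x ≤ r := by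
  rw [h, h]
  simp [repr_diagExp]

lemma det_diagExp [Fintype ι] (b : Module.Basis ι ℝ E) (t : ι → ℝ) :
    LinearMap.det ((diagExp b t : E →L[ℝ] E) : E →ₗ[ℝ] E) = Real.exp (∑ i, t i) := by
  classical
  rw [← LinearMap.det_toMatrix b, Real.exp_sum, ← Matrix.det_diagonal]
  congr 1
  ext i j
  rw [LinearMap.toMatrix_apply]
  rcases eq_or_ne i j with rfl | h
  · simp
  · simp [Matrix.diagonal_apply_ne _ h, Finsupp.single_eq_of_ne h]

/-- The norm of a linear map is controlled by the images of a fixed basis. -/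
lemma ContinuousLinearMap.norm_le_sum_basis [Fintype ι] {F : Type*} [NormedAddCommGroup F]
    [NormedSpace ℝ F] (b : Module.Basis ι ℝ E) (A : E →L[ℝ] F) :
    ‖A‖ ≤ ∑ i, ‖LinearMap.toContinuousLinearMap (b.coord i)‖ * ‖A (b i)‖ := by
  refine A.opNorm_le_bound (by positivity) fun x => ?_
  conv_lhs => rw [← b.sum_repr x, map_sum]
  rw [Finset.sum_mul]
  refine (norm_sum_le _ _).trans (Finset.sum_le_sum fun i _ => ?_)
  rw [map_smul, norm_smul, mul_right_comm]
  gcongr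
  exact (LinearMap.toContinuousLinearMap (b.coord i)).le_opNorm x

end Diagonal

/-! ### Subresonant maps -/

section Subresonant

variable {V W U : Type*} [NormedAddCommGroup V] [NormedSpace ℝ V]
  [NormedAddCommGroup W] [NormedSpace ℝ W] [NormedAddCommGroup U] [NormedSpace ℝ U]

lemma polarization_one_apply (f : V → W) (v : Fin 1 → V) :
    polarization 1 f v = fderiv ℝ f 0 (v 0) := by
  simp [polarization, iteratedFDeriv_one_apply]

lemma weight_fderiv_le {ϖV : Weight V} {ϖW : Weight W} (f : polyLE ϖV ϖW 0) (v : V) :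
    ϖW (fderiv ℝ f.1 0 v) ≤ ϖV v := by
  have h := polyLE_polarization_le f.2 1 fun _ => v
  rw [polarization_one_apply] at h
  simpa using h

lemma continuousLinearMap_mem_polyLE {ϖV : Weight V} {ϖW : Weight W} {κ : ℝ} (T : V →L[ℝ] W)
    (hT : ∀ v, ϖW (T v) ≤ κ + ϖV v) : (T : V → W) ∈ polyLE ϖV ϖW κ := by
  refine multilinear_diag_mem_polyLE
    (MultilinearMap.ofSubsingleton ℝ V W () (T : V →ₗ[ℝ] W)) ?_ fun v => ?_
  · exact T.continuous.comp (continuous_apply ())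
  · simpa using hT (v ())

lemma IsPolynomialMap.linear_comp_comp {X Y : Type*} [NormedAddCommGroup X] [NormedSpace ℝ X]
    [NormedAddCommGroup Y] [NormedSpace ℝ Y] {f : V → W}
    (hf : IsPolynomialMap f) (S : W →L[ℝ] Y) (T : X →L[ℝ] V) (k : ℕ) :
    polarization k (fun x => S (f (T x))) =
      S.compContinuousMultilinearMap
        ((polarization k f).compContinuousLinearMap fun _ => T) := by
  obtain ⟨p, d, h⟩ := hf
  ext v
  have h' : ∀ x, S (f (T x)) = ∑ k ∈ Finset.range d,
      (fun k => S.compContinuousMultilinearMap ((p k).compContinuousLinearMap fun _ => T) :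
        FormalMultilinearSeries ℝ X Y) k (fun _ => x) := fun x => by
    rw [h, map_sum]
    rfl
  rw [polarization_apply h']
  simp only [ContinuousLinearMap.compContinuousMultilinearMap_coe, Function.comp_apply,
    ContinuousMultilinearMap.compContinuousLinearMap_apply]
  rw [polarization_apply h, map_smul, map_sum]
  congr 1
  refine Finset.sum_congr rfl fun σ _ => ?_
  split_ifs <;> simp

lemma norm_polarization_le_polyNorm {f : V → W} (hf : IsPolynomialMap f) (k : ℕ) :
    ‖polarization k f‖ ≤ polyNorm f := by
  refine single_le_finsum (f := fun k => ‖polarization k f‖) k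
    (hf.finite_support.subset fun k hk => ?_) fun j => norm_nonneg (polarization j f)
  exact norm_ne_zero_iff.1 hk

lemma norm_polarization_linear_comp_comp_le {X Y : Type*} [NormedAddCommGroup X] [NormedSpace ℝ X]
    [NormedAddCommGroup Y] [NormedSpace ℝ Y] {f : V → W}
    (hf : IsPolynomialMap f) (S : W →L[ℝ] Y) (T : X →L[ℝ] V) (k : ℕ) :
    ‖polarization k (fun x => S (f (T x)))‖ ≤ ‖S‖ * (polyNorm f * ‖T‖ ^ k) := by
  rw [hf.linear_comp_comp]
  refine (ContinuousLinearMap.norm_compContinuousMultilinearMap_le _ _).trans ?_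
  gcongr
  refine (ContinuousMultilinearMap.norm_compContinuousLinearMap_le _ _).trans ?_
  rw [Fin.prod_const]
  gcongr
  exact norm_polarization_le_polyNorm hf k

end Subresonant

/-! ### Linear maps between compatible weights -/

section Compatible

variable {V W : Type*} [NormedAddCommGroup V] [NormedSpace ℝ V] [FiniteDimensional ℝ V]
  [NormedAddCommGroup W] [NormedSpace ℝ W] [FiniteDimensional ℝ W]

lemma Weight.Compatible.finrank_le_eq {ϖV : Weight V} {ϖW : Weight W} (h : ϖV.Compatible ϖW)
    (hfin : (weightValues ϖV).Finite) (c : ℝ) :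
    Module.finrank ℝ (Submodule.span ℝ {x | ϖV x ≤ c}) =
      Module.finrank ℝ (Submodule.span ℝ {x | ϖW x ≤ c}) := by
  classical
  obtain ⟨b, χ, hb⟩ := ϖV.exists_adapted hfin
  obtain ⟨b', χ', hb'⟩ := ϖW.exists_adapted (h.1 ▸ hfin)
  have hmem : ∀ a, a ∈ Set.range χ ↔ a ∈ Set.range χ' := fun a => by
    rw [← hb.weightValues_eq, h.1, hb'.weightValues_eq]
  rw [hb.finrank_le, hb'.finrank_le, Finset.card_eq_sum_card_image χ,
    Finset.card_eq_sum_card_image χ']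
  have himg : (Finset.univ.filter (χ · ≤ c)).image χ =
      (Finset.univ.filter (χ' · ≤ c)).image χ' := by
    ext a
    have := hmem a
    simp only [Set.mem_range] at this
    simp only [Finset.mem_image, Finset.mem_filter, Finset.mem_univ, true_and]
    constructor
    · rintro ⟨i, hi, rfl⟩
      obtain ⟨j, hj⟩ := this.1 ⟨i, rfl⟩
      exact ⟨j, hj ▸ hi, hj⟩
    · rintro ⟨i, hi, rfl⟩
      obtain ⟨j, hj⟩ := this.2 ⟨i, rfl⟩
      exact ⟨j, hj ▸ hi, hj⟩
  rw [himg]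
  refine Finset.sum_congr rfl fun a ha => ?_
  obtain ⟨j, hj, rfl⟩ := Finset.mem_image.1 ha
  have hj : χ' j ≤ c := by simpa using hj
  have h1 := h.2 (χ' j) (by rw [hb.weightValues_eq, hmem]; exact ⟨j, rfl⟩)
  rw [hb.weightMult_eq, hb'.weightMult_eq] at h1
  rw [Finset.filter_filter, Finset.filter_filter]
  convert h1 using 2
  · ext i
    simp only [Finset.mem_filter, Finset.mem_univ, true_and, and_iff_right_iff_imp]
    exact fun hi => hi ▸ hj
  · ext i
    simp only [Finset.mem_filter, Finset.mem_univ, true_and, and_iff_right_iff_imp]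
    exact fun hi => hi ▸ hj

/-- An isomorphism between spaces with compatible weights that does not increase weights
preserves them, because the sublevel spaces have the same dimensions. -/
lemma Weight.Compatible.map_eq {ϖV : Weight V} {ϖW : Weight W} (h : ϖV.Compatible ϖW)
    (hfin : (weightValues ϖV).Finite) (T : V ≃L[ℝ] W) (hT : ∀ v, ϖW (T v) ≤ ϖV v) (v : V) :
    ϖW (T v) = ϖV v := by
  refine le_antisymm (hT v) (EReal.le_of_forall_lt_iff_le.1 fun r hr => ?_)
  obtain ⟨S, hS⟩ := ϖV.exists_submodule r
  obtain ⟨S', hS'⟩ := ϖW.exists_submodule r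
  have hdim := h.finrank_le_eq hfin r
  rw [← (Set.ext hS : (S : Set V) = {x | ϖV x ≤ r}),
    ← (Set.ext hS' : (S' : Set W) = {x | ϖW x ≤ r})] at hdim
  rw [Submodule.span_eq, Submodule.span_eq] at hdim
  have hmap : S.map (T.toLinearEquiv : V →ₗ[ℝ] W) = S' := by
    refine Submodule.eq_of_le_of_finrank_eq ?_ ?_
    · rintro _ ⟨x, hx, rfl⟩
      exact (hS' _).2 ((hT x).trans ((hS x).1 hx))
    · rw [LinearEquiv.finrank_map_eq, hdim]
  have hv : T v ∈ S.map (T.toLinearEquiv : V →ₗ[ℝ] W) := hmap ▸ (hS' _).2 hr.le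
  obtain ⟨x, hx, hxv⟩ := hv
  have : x = v := T.injective hxv
  exact (hS v).1 (this ▸ hx)

end Compatible

/-! ### Straightening a regular sequence -/

section Frame

/-- The two functions also agree at `0`, where the Lyapunov weight is `log 0 = -∞`. -/
lemma lyapunovWeight_eq_weight {V : ℕ → Type*} [∀ i, NormedAddCommGroup (V i)]
    [∀ i, InnerProductSpace ℝ (V i)] {A : ∀ i, V i →L[ℝ] V (i + 1)} {ϖ : Weight (V 0)}
    (h : ∀ v : V 0, v ≠ 0 →
      Tendsto (fun n : ℕ => ENNReal.log ‖cocycle A n v‖ₑ / (n : EReal)) atTop (𝓝 (ϖ v))) :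
    lyapunovWeight A = ϖ := by
  funext v
  rcases eq_or_ne v 0 with rfl | hv
  · rw [ϖ.map_zero]
    refine le_bot_iff.1 (EReal.le_of_forall_lt_iff_le.1 fun r _ => ?_)
    rw [lyapunovWeight_le_iff]
    simpa using SubExp.const 0
  · exact (h v hv).limsup_eq

variable {V : ℕ → Type*} [∀ i, NormedAddCommGroup (V i)] [∀ i, InnerProductSpace ℝ (V i)]
  [∀ i, FiniteDimensional ℝ (V i)]

/-- If the growth rates of a regular sequence are given by the weight, then the maps
`B n = A₀⁽ⁿ⁾ ∘ D⁻ⁿ`, where `D` is diagonal in an adapted basis, have subexponential norms and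
inverses, preserve weights, and conjugate every `A n` to the same map `D`. -/
lemma exists_straightening_frame {ϖ : ∀ i, Weight (V i)}
    (hcompat : ∀ i j, (ϖ i).Compatible (ϖ j)) (hfin : (weightValues (ϖ 0)).Finite)
    {A : ∀ i, V i →L[ℝ] V (i + 1)} (hA : ∀ i v, ϖ (i + 1) (A i v) ≤ ϖ i v)
    (hreg : ForwardsRegular A)
    (hweight : ∀ v : V 0, v ≠ 0 →
      Tendsto (fun n : ℕ => ENNReal.log ‖cocycle A n v‖ₑ / (n : EReal)) atTop (𝓝 (ϖ 0 v))) :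
    ∃ (b : Module.Basis (Fin (Module.finrank ℝ (V 0))) ℝ (V 0))
      (w : Fin (Module.finrank ℝ (V 0)) → ℝ) (B : ∀ n, V 0 ≃L[ℝ] V n),
      IsAdapted (ϖ 0) b w ∧ (∀ n x, ϖ n (B n x) = ϖ 0 x) ∧
      SubExp (fun n => ‖(B n : V 0 →L[ℝ] V n)‖) ∧
      SubExp (fun n => ‖((B n).symm : V n →L[ℝ] V 0)‖) ∧
      ∀ n j, A n (B n (b j)) = Real.exp (w j) • B (n + 1) (b j) := by
  obtain ⟨b, w, hb⟩ := (ϖ 0).exists_adapted hfin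
  choose a ha using hreg.invertible
  obtain ⟨Aeq, hAeq0, hAeqS⟩ : ∃ Aeq : ∀ n, V 0 ≃L[ℝ] V n,
      (∀ x, Aeq 0 x = x) ∧ ∀ n x, Aeq (n + 1) x = a n (Aeq n x) :=
    ⟨fun n => Nat.rec (ContinuousLinearEquiv.refl ℝ (V 0)) (fun n e => e.trans (a n)) n,
      fun _ => rfl, fun _ _ => rfl⟩
  have hAeq : ∀ n x, Aeq n x = cocycle A n x := by
    intro n
    induction n with
    | zero => exact hAeq0
    | succ n ih =>
      intro x
      rw [hAeqS, ih]
      exact congrArg (fun T : V n →L[ℝ] V (n + 1) => T (cocycle A n x)) (ha n)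
  have hAeq' : ∀ n, (Aeq n : V 0 →L[ℝ] V n) = cocycle A n := fun n => by
    ext x
    exact hAeq n x
  have hAw : ∀ n x, ϖ n (Aeq n x) = ϖ 0 x := by
    intro n
    induction n with
    | zero => intro x; rw [hAeq0]
    | succ n ih =>
      intro x
      rw [hAeqS, (hcompat n (n + 1)).map_eq ((hcompat 0 n).1 ▸ hfin) (a n) fun v => ?_, ih]
      have := hA n v
      rw [← ha n] at this
      exact this
  have hDw : ∀ t x, ϖ 0 (diagExp b t x) = ϖ 0 x := by
    refine fun t x => (hcompat 0 0).map_eq hfin (diagExp b t) (fun v => ?_) x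
    exact EReal.le_of_forall_lt_iff_le.1 fun r hr => (hb.diagExp t v r).2 hr.le
  let B : ∀ n, V 0 ≃L[ℝ] V n := fun n => (diagExp b fun i => -(n * w i)).trans (Aeq n)
  have hBb : ∀ n j, B n (b j) = Real.exp (-(n * w j)) • cocycle A n (b j) := fun n j => by
    show Aeq n (diagExp b _ (b j)) = _
    rw [diagExp_basis, map_smul, hAeq]
  have hly := lyapunovWeight_eq_weight hweight
  have hB1 : SubExp (fun n => ‖(B n : V 0 →L[ℝ] V n)‖) := by
    refine (SubExp.sum Finset.univ fun i _ => (SubExp.const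
      ‖LinearMap.toContinuousLinearMap (b.coord i)‖).mul ((lyapunovWeight_le_iff A (b i) (w i)).1
        ?_)).of_le (fun n => norm_nonneg _) fun n => ?_
    · rw [hly, hb.apply_basis]
    · refine (ContinuousLinearMap.norm_le_sum_basis b _).trans (le_of_eq ?_)
      refine Finset.sum_congr rfl fun i _ => ?_
      rw [ContinuousLinearEquiv.coe_coe, hBb, norm_smul, Real.norm_eq_abs, Real.abs_exp]
  have hdet : ∀ n, absDet (B n : V 0 →L[ℝ] V n) =
      Real.exp (-(n * ∑ i, w i)) * absDet (cocycle A n) := by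
    intro n
    have h1 : (B n : V 0 →L[ℝ] V n) =
        (cocycle A n).comp (diagExp b fun i => -(n * w i) : V 0 →L[ℝ] V 0) := by
      rw [← hAeq']; rfl
    rw [h1, absDet_comp rfl (Aeq n).toLinearEquiv.finrank_eq, absDet_endomorphism, det_diagExp,
      Real.abs_exp, Finset.sum_neg_distrib, ← Finset.mul_sum, mul_comm]
  have hpos : ∀ n, 0 < absDet (cocycle A n) := fun n => by
    rw [← hAeq']
    exact absDet_pos (Aeq n).toLinearEquiv.finrank_eq (Aeq n).injective
  have hdetinv : SubExp fun n => (absDet (B n : V 0 →L[ℝ] V n))⁻¹ := by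
    have h := hreg.regular
    rw [lyapunovExponents, hly, hb.finsum_weightMult] at h
    refine (subExp_of_tendsto_log hpos h).2.of_abs_le fun n => le_of_eq ?_
    rw [hdet, mul_inv, ← Real.exp_neg, neg_neg]
  refine ⟨b, w, B, hb, fun n x => ?_, hB1, ?_, fun n j => ?_⟩
  · show ϖ n (Aeq n (diagExp b _ x)) = _
    rw [hAw, hDw]
  · refine (hdetinv.mul (hB1.pow (Module.finrank ℝ (V 0) - 1))).of_le
      (fun n => norm_nonneg _) fun n => norm_symm_le rfl (B n)
  · rw [hBb, hBb, map_smul, smul_smul, ← Real.exp_add]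
    push_cast
    rw [show w j + -((n + 1) * w j) = -(n * w j) by ring]
    rfl

end Frame

/-! ### Triangular systems -/

section Triangular

variable {ι ρ : Type*} [Fintype ι] [LinearOrder ρ]

/-- The determinant of a matrix that is triangular with respect to a preorder on the indices and
has diagonal blocks that are diagonal matrices. -/
lemma det_of_rank_triangular [DecidableEq ι] (r : ι → ρ) (M : Matrix ι ι ℝ)
    (h : ∀ i j, i ≠ j → M i j ≠ 0 → r i < r j) : M.det = ∏ i, M i i := by
  let e := Fintype.equivFin ι
  -- Ties between indices of equal rank are broken by an enumeration of the index set.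
  let f : ι → ρ ×ₗ Fin (Fintype.card ι) := fun i => toLex (r i, e i)
  have hf : Function.Injective f := fun i j hij => by
    have := congrArg (fun p => (ofLex p).2) hij
    exact e.injective this
  let : LinearOrder ι := LinearOrder.lift' f hf
  refine Matrix.det_of_isUpperTriangular fun i j hij => ?_
  by_contra hM
  have hji : f j < f i := hij
  rcases eq_or_ne i j with rfl | hne
  · exact lt_irrefl _ hji
  · exact lt_asymm hji (Prod.Lex.toLex_lt_toLex.2 (Or.inl (h i j hne hM)))

/-- In a triangular system whose diagonal entries `e^{χ i}` increase in the direction of the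
coupling, the solution that starts at the basis vector `k` grows at most at the rate `χ k`. -/
lemma subExp_of_rank_triangular (r : ι → ρ) (χ : ι → ℝ)
    (hrχ : ∀ i j, r i < r j → χ i ≤ χ j) (M : ℕ → Matrix ι ι ℝ)
    (hdiag : ∀ n i, M n i i = Real.exp (χ i))
    (htri : ∀ n i j, i ≠ j → M n i j ≠ 0 → r i < r j)
    (hM : ∀ i j, SubExp fun n => M n i j) (k : ι) (u : ℕ → ι → ℝ)
    (hu0 : ∀ i, i ≠ k → u 0 i = 0) (hu : ∀ n i, u (n + 1) i = ∑ j, M n i j * u n j) (i : ι) :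
    SubExp fun n => Real.exp (-(n * χ k)) * u n i := by
  classical
  have hzero : ∀ n i, i ≠ k → r k ≤ r i → u n i = 0 := by
    intro n
    induction n with
    | zero => exact fun i hi _ => hu0 i hi
    | succ n ih =>
      intro i hi hki
      rw [hu]
      refine Finset.sum_eq_zero fun j _ => ?_
      by_cases hMij : M n i j = 0
      · rw [hMij, zero_mul]
      · rcases eq_or_ne i j with rfl | hij
        · rw [ih i hi hki, mul_zero]
        · have hlt := hki.trans_lt (htri n i j hij hMij)
          rw [ih j (fun h => (h ▸ hlt).false) hlt.le, mul_zero]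
  have hwf : WellFounded fun i j : ι => r j < r i :=
    have : IsTrans ι fun i j : ι => r j < r i := ⟨fun _ _ _ h1 h2 => h2.trans h1⟩
    have : Std.Irrefl fun i j : ι => r j < r i := ⟨fun _ => lt_irrefl _⟩
    Finite.wellFounded_of_trans_of_irrefl _
  induction i using hwf.induction with
  | _ i ih =>
  by_cases hi : i ≠ k ∧ r k ≤ r i
  · simpa [hzero _ i hi.1 hi.2] using SubExp.const 0
  have hχ : χ i ≤ χ k := by
    by_cases hik : i = k
    · rw [hik]
    · exact hrχ i k (not_le.1 fun h => hi ⟨hik, h⟩)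
  refine SubExp.of_recursion (q := Real.exp (χ i - χ k))
    (b := fun n => Real.exp (-χ k) * ∑ j ∈ Finset.univ.filter (r i < r ·),
      M n i j * (Real.exp (-(n * χ k)) * u n j)) (Real.exp_pos _).le
    (Real.exp_le_one_iff.2 (sub_nonpos.2 hχ)) ?_ fun n => ?_
  · refine (SubExp.const _).mul (SubExp.sum _ fun j hj => (hM i j).mul (ih j ?_))
    simpa using hj
  · have hsum : u (n + 1) i = Real.exp (χ i) * u n i +
        ∑ j ∈ Finset.univ.filter (r i < r ·), M n i j * u n j := by
      rw [hu, ← Finset.add_sum_erase _ _ (Finset.mem_univ i), hdiag]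
      congr 1
      symm
      refine Finset.sum_subset (fun j hj => ?_) fun j hj hj' => ?_
      · have : r i < r j := by simpa using hj
        exact Finset.mem_erase.2 ⟨fun h => (h ▸ this).false, Finset.mem_univ j⟩
      · by_contra hne
        have hlt := htri n i j (Finset.ne_of_mem_erase hj).symm (left_ne_zero_of_mul hne)
        exact hj' (by simpa using hlt)
    rw [hsum, mul_add, Finset.mul_sum, Finset.mul_sum]
    congr 1
    · rw [← mul_assoc, ← mul_assoc, ← Real.exp_add, ← Real.exp_add]
      push_cast
      ring_nf
    · refine Finset.sum_congr rfl fun j _ => ?_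
      have : Real.exp (-(((n + 1 : ℕ) : ℝ) * χ k)) =
          Real.exp (-χ k) * Real.exp (-(n * χ k)) := by
        rw [← Real.exp_add]
        push_cast
        ring_nf
      rw [this]
      ring

end Triangular

/-! ### Polynomials in adapted coordinates -/

section MonomialWeight

variable {ι : Type*} [Fintype ι] (w : ι → ℝ)

/-- The weight `⟨α, w⟩` of the monomial `x^α`. -/
noncomputable def monWeight (α : ι →₀ ℕ) : ℝ := ∑ i, (α i : ℝ) * w i

/-- Monomials are ranked by weight, and by degree among those of equal weight. -/
noncomputable def monRank (α : ι →₀ ℕ) : ℝ ×ₗ ℕ := toLex (monWeight w α, α.degree)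

lemma monRank_lt_iff {α β : ι →₀ ℕ} : monRank w α < monRank w β ↔
    monWeight w α < monWeight w β ∨ monWeight w α = monWeight w β ∧ α.degree < β.degree :=
  Prod.Lex.toLex_lt_toLex

@[simp]
lemma monWeight_zero : monWeight w 0 = 0 := by simp [monWeight]

lemma monWeight_add (α β : ι →₀ ℕ) : monWeight w (α + β) = monWeight w α + monWeight w β := by
  simp [monWeight, add_mul, Finset.sum_add_distrib]

@[simp]
lemma monWeight_single (i : ι) : monWeight w (Finsupp.single i 1) = w i := by
  classical
  rw [monWeight, Finset.sum_eq_single i]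
  · simp
  · intro j _ hj
    simp [Finsupp.single_eq_of_ne hj]
  · simp

lemma monWeight_sum_single {k : ℕ} (j : Fin k → ι) :
    monWeight w (∑ m, Finsupp.single (j m) 1) = ∑ m, w (j m) := by
  have : ∀ s : Finset (Fin k), monWeight w (∑ m ∈ s, Finsupp.single (j m) 1) =
      ∑ m ∈ s, w (j m) := by
    classical
    intro s
    induction s using Finset.induction_on with
    | empty => simp
    | insert a s ha ih => rw [Finset.sum_insert ha, Finset.sum_insert ha, monWeight_add, ih,
        monWeight_single]
  exact this _

variable {w}

lemma monWeight_nonpos (hw : ∀ i, w i < 0) (α : ι →₀ ℕ) : monWeight w α ≤ 0 :=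
  Finset.sum_nonpos fun i _ => mul_nonpos_of_nonneg_of_nonpos (Nat.cast_nonneg _) (hw i).le

lemma monWeight_neg (hw : ∀ i, w i < 0) {α : ι →₀ ℕ} (hα : α ≠ 0) : monWeight w α < 0 := by
  obtain ⟨i, hi⟩ := Finsupp.ne_iff.1 hα
  refine Finset.sum_neg' (fun i _ => mul_nonpos_of_nonneg_of_nonpos (Nat.cast_nonneg _) (hw i).le)
    ⟨i, Finset.mem_univ i, mul_neg_of_pos_of_neg ?_ (hw i)⟩
  exact_mod_cast Nat.pos_of_ne_zero hi

end MonomialWeight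

section Coordinates

lemma EReal.coe_finsetSum {ι : Type*} (s : Finset ι) (f : ι → ℝ) :
    ((∑ i ∈ s, f i : ℝ) : EReal) = ∑ i ∈ s, (f i : EReal) := by
  classical
  induction s using Finset.induction_on with
  | empty => simp
  | insert a s ha ih => rw [Finset.sum_insert ha, Finset.sum_insert ha, EReal.coe_add, ih]

lemma subExp_coeff_mul {ι : Type*} {p q : ℕ → MvPolynomial ι ℝ}
    (hp : ∀ α, SubExp fun n => MvPolynomial.coeff α (p n))
    (hq : ∀ α, SubExp fun n => MvPolynomial.coeff α (q n)) (α : ι →₀ ℕ) :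
    SubExp fun n => MvPolynomial.coeff α (p n * q n) := by
  classical
  simp only [MvPolynomial.coeff_mul]
  exact SubExp.sum _ fun _ _ => (hp _).mul (hq _)

variable {V : Type*} [NormedAddCommGroup V] [NormedSpace ℝ V]
  {ι : Type*} (b : Module.Basis ι ℝ V)

/-- The polynomial function on `V` given by a polynomial in the coordinates of the basis `b`. -/
noncomputable def polyFun : MvPolynomial ι ℝ →ₐ[ℝ] (V → ℝ) :=
  MvPolynomial.aeval fun i x => b.repr x i

lemma polyFun_apply (p : MvPolynomial ι ℝ) (x : V) :
    polyFun b p x = MvPolynomial.eval (fun i => b.repr x i) p := by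
  have : (Pi.evalAlgHom ℝ (fun _ : V => ℝ) x).comp (polyFun b) =
      MvPolynomial.aeval fun i => b.repr x i := by
    ext i
    simp [polyFun]
  exact AlgHom.congr_fun this p

variable [Fintype ι]

lemma polyFun_injective : Function.Injective (polyFun b) := by
  intro p q h
  refine MvPolynomial.funext fun c => ?_
  have := congrFun h (∑ i, c i • b i)
  rwa [polyFun_apply, polyFun_apply, b.repr_sum_self] at this

lemma polyFun_monomial (α : ι →₀ ℕ) (x : V) :
    polyFun b (MvPolynomial.monomial α 1) x = ∏ i, b.repr x i ^ α i := by
  rw [polyFun_apply, MvPolynomial.eval_monomial, one_mul, Finsupp.prod_fintype]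
  simp

/-- The coordinate polynomial of degree less than `K` whose coefficients are the values of the
polarizations of `h` on the basis vectors. -/
noncomputable def coordPoly (K : ℕ) (h : V → ℝ) : MvPolynomial ι ℝ :=
  ∑ k ∈ Finset.range K, ∑ j : Fin k → ι,
    MvPolynomial.monomial (∑ m, Finsupp.single (j m) 1) (polarization k h fun m => b (j m))

lemma polyFun_coordPoly {h : V → ℝ} (hh : IsPolynomialMap h) {K : ℕ}
    (hK : ∀ k, K ≤ k → polarization k h = 0) : polyFun b (coordPoly b K h) = h := by
  obtain ⟨d, hd, hsum⟩ := hh.eq_sum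
  funext x
  have h1 : ∀ N, (∀ k, N ≤ k → polarization k h = 0) →
      ∑ k ∈ Finset.range N, polarization k h (fun _ => x) =
        ∑ k ∈ Finset.range (max d K), polarization k h (fun _ => x) ∨ max d K < N := by
    intro N hN
    by_cases hlt : max d K < N
    · exact Or.inr hlt
    · refine Or.inl (Finset.sum_subset (Finset.range_mono (not_lt.1 hlt)) fun k _ hk => ?_)
      rw [hN k (by simpa using hk)]
      rfl
  have h2 := (h1 d hd).resolve_right (by simp)
  have h3 := (h1 K hK).resolve_right (by simp)
  rw [hsum x, h2, ← h3, coordPoly, map_sum, Finset.sum_apply]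
  refine Finset.sum_congr rfl fun k _ => ?_
  rw [map_sum, Finset.sum_apply]
  conv_rhs =>
    rw [← b.sum_repr x]
    rw [ContinuousMultilinearMap.map_sum]
  refine Finset.sum_congr rfl fun j _ => ?_
  rw [ContinuousMultilinearMap.map_smul_univ, polyFun_apply, MvPolynomial.eval_monomial, mul_comm,
    smul_eq_mul]
  congr 1
  have : ∀ s : Finset (Fin k), ((∑ m ∈ s, Finsupp.single (j m) 1 : ι →₀ ℕ).prod
      fun n e => (b.repr x) n ^ e) = ∏ m ∈ s, b.repr x (j m) := by
    classical
    intro s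
    induction s using Finset.induction_on with
    | empty => simp
    | insert a s ha ih =>
      rw [Finset.sum_insert ha, Finset.prod_insert ha, Finsupp.prod_add_index', ih,
        Finsupp.prod_single_index]
      · simp
      · simp
      · simp
      · intros; rw [pow_add]
  exact this _

lemma coeff_coordPoly [DecidableEq ι] (K : ℕ) (h : V → ℝ) (α : ι →₀ ℕ) :
    MvPolynomial.coeff α (coordPoly b K h) = ∑ k ∈ Finset.range K, ∑ j : Fin k → ι,
      if ∑ m, Finsupp.single (j m) 1 = α then polarization k h (fun m => b (j m)) else 0 := by
  simp only [coordPoly, MvPolynomial.coeff_sum, MvPolynomial.coeff_monomial]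

lemma coeff_single_coordPoly {K : ℕ} (hK : 1 < K) (h : V → ℝ) (i : ι) :
    MvPolynomial.coeff (Finsupp.single i 1) (coordPoly b K h) = fderiv ℝ h 0 (b i) := by
  classical
  rw [coeff_coordPoly, Finset.sum_eq_single 1]
  · rw [Finset.sum_eq_single fun _ => i]
    · simp [polarization_one_apply]
    · intro j _ hj
      rw [if_neg]
      intro h1
      apply hj
      rw [Fin.sum_univ_one] at h1
      funext m
      rw [Subsingleton.elim m 0]
      exact Finsupp.single_left_injective one_ne_zero h1
    · simp
  · intro k _ hk
    refine Finset.sum_eq_zero fun j _ => if_neg fun h1 => hk ?_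
    have := congrArg Finsupp.degree h1
    simpa [map_sum] using this
  · simp [hK]

lemma subExp_coeff_coordPoly (K : ℕ) (h : ℕ → V → ℝ)
    (hh : ∀ k, SubExp fun n => ‖polarization k (h n)‖) (α : ι →₀ ℕ) :
    SubExp fun n => MvPolynomial.coeff α (coordPoly b K (h n)) := by
  classical
  simp only [coeff_coordPoly]
  refine SubExp.sum _ fun k _ => SubExp.sum _ fun j _ => ?_
  split_ifs
  · refine ((hh k).mul (SubExp.const (∏ m, ‖b (j m)‖))).of_abs_le fun n => ?_
    rw [abs_of_nonneg (a := _ * _) (by positivity)]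
    exact (polarization k (h n)).le_opNorm _
  · exact SubExp.const 0

variable {b} {w : ι → ℝ} {ϖ : Weight V}

/-- The monomials of a polynomial function of weight at most `κ` have weight at most `κ` as
functions, that is, `⟨α, w⟩ ≥ -κ`. -/
lemma coordPoly_mem_restrictSupport (hb : IsAdapted ϖ b w) {κ : ℝ} {h : V → ℝ}
    (hh : h ∈ polyLE ϖ trivialWeight κ) (K : ℕ) :
    coordPoly b K h ∈ MvPolynomial.restrictSupport ℝ {α | -κ ≤ monWeight w α} := by
  refine Submodule.sum_mem _ fun k _ => Submodule.sum_mem _ fun j _ => ?_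
  rw [MvPolynomial.monomial_mem_restrictSupport]
  by_cases h0 : polarization k h (fun m => b (j m)) = 0
  · exact Or.inr h0
  · refine Or.inl ?_
    have h1 := polyLE_polarization_le hh k fun m => b (j m)
    have h2 : trivialWeight (polarization k h fun m => b (j m)) = 0 := if_neg h0
    simp only [h2, hb.apply_basis] at h1
    have h3 : (0 : ℝ) ≤ κ + ∑ m, w (j m) := by
      rw [← EReal.coe_le_coe_iff, EReal.coe_add, EReal.coe_finsetSum]
      exact h1
    show -κ ≤ monWeight w _
    rw [monWeight_sum_single]
    linarith

variable [FiniteDimensional ℝ V]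

lemma polyFun_monomial_mem (hb : IsAdapted ϖ b w) {κ : ℝ} {α : ι →₀ ℕ}
    (hα : -κ ≤ monWeight w α) :
    polyFun b (MvPolynomial.monomial α 1) ∈ polyLE ϖ trivialWeight κ := by
  let T : MultilinearMap ℝ (fun _ : Σ i : ι, Fin (α i) => V) ℝ :=
    (MultilinearMap.mkPiAlgebra ℝ (Σ i : ι, Fin (α i)) ℝ).compLinearMap fun s => b.coord s.1
  have hT : ∀ v, T v = ∏ s, b.repr (v s) s.1 := fun v => rfl
  have hcont : Continuous T := by
    refine continuous_finsetProd _ fun s _ => ?_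
    exact (LinearMap.continuous_of_finiteDimensional (b.coord s.1)).comp (continuous_apply s)
  convert multilinear_diag_mem_polyLE (ϖV := ϖ) (ϖW := trivialWeight) (κ := κ) T hcont ?_ using 1
  · funext x
    rw [polyFun_monomial, hT, Fintype.prod_sigma]
    simp
  · intro v
    by_cases h0 : T v = 0
    · rw [h0, trivialWeight.map_zero]
      exact bot_le
    · have h1 : trivialWeight (T v) = 0 := if_neg h0
      rw [h1]
      have hne : ∀ s, b.repr (v s) s.1 ≠ 0 := fun s hs => by
        exact h0 ((hT v).trans (Finset.prod_eq_zero (Finset.mem_univ s) hs))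
      have hle : ∀ s : (Σ i : ι, Fin (α i)), ((w s.1 : ℝ) : EReal) ≤ ϖ (v s) := fun s =>
        EReal.le_of_forall_lt_iff_le.1 fun r hr => by
          exact_mod_cast (hb (v s) r).1 hr.le s.1 (hne s)
      have h2 : (0 : ℝ) ≤ κ + ∑ s : (Σ i : ι, Fin (α i)), w s.1 := by
        rw [Fintype.sum_sigma]
        simp only [Finset.sum_const, Finset.card_univ, Fintype.card_fin, nsmul_eq_mul]
        rw [monWeight] at hα
        linarith
      calc (0 : EReal) ≤ ((κ + ∑ s : (Σ i : ι, Fin (α i)), w s.1 : ℝ) : EReal) := by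
            exact_mod_cast h2
        _ = κ + ∑ s : (Σ i : ι, Fin (α i)), ((w s.1 : ℝ) : EReal) := by
            rw [EReal.coe_add, EReal.coe_finsetSum]
        _ ≤ κ + ∑ s, ϖ (v s) := add_le_add le_rfl (Finset.sum_le_sum fun s _ => hle s)

/-- Conversely, a combination of monomials `x^α` with `⟨α, w⟩ ≥ -κ` has weight at most `κ`. -/
lemma polyFun_mem (hb : IsAdapted ϖ b w) {κ : ℝ} {p : MvPolynomial ι ℝ}
    (hp : p ∈ MvPolynomial.restrictSupport ℝ {α | -κ ≤ monWeight w α}) :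
    polyFun b p ∈ polyLE ϖ trivialWeight κ := by
  rw [MvPolynomial.restrictSupport_eq_span] at hp
  have h : Submodule.span ℝ ((fun α => MvPolynomial.monomial α (1 : ℝ)) ''
      {α | -κ ≤ monWeight w α}) ≤
      (polyLE ϖ trivialWeight κ).comap (polyFun b).toLinearMap := by
    rw [Submodule.span_le]
    rintro _ ⟨α, hα, rfl⟩
    exact polyFun_monomial_mem hb hα
  exact h hp

/-- Polynomials of bounded weight have bounded degree. -/
lemma exists_degree_bound [ϖ.Negative] (κ : ℝ) :
    ∃ N : ℕ, ∀ h ∈ polyLE ϖ trivialWeight κ, ∀ k, N ≤ k → polarization k h = 0 := by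
  obtain ⟨c, hc, hϖ⟩ := ϖ.exists_neg_bound
  obtain ⟨N, hN⟩ := exists_nat_gt (κ / (-c))
  refine ⟨N, fun h hh k hk => ?_⟩
  ext v
  by_contra hne
  have h1 := polyLE_polarization_le hh k v
  have h3 : trivialWeight (polarization k h v) = 0 := if_neg hne
  rw [h3] at h1
  have h2 : (0 : EReal) ≤ ((κ + ∑ _i : Fin k, c : ℝ) : EReal) := by
    rw [EReal.coe_add, EReal.coe_finsetSum]
    exact h1.trans (add_le_add le_rfl (Finset.sum_le_sum fun i _ => hϖ _))
  have h5 : (0 : ℝ) ≤ κ + ∑ _i : Fin k, c := by exact_mod_cast h2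
  rw [Fin.sum_const, nsmul_eq_mul] at h5
  rw [div_lt_iff₀ (by linarith)] at hN
  have : (N : ℝ) ≤ k := by exact_mod_cast hk
  nlinarith

end Coordinates

/-! ### The monomial basis and its dual -/

section MonomialBasis

variable {V : Type*} [NormedAddCommGroup V] [InnerProductSpace ℝ V] [FiniteDimensional ℝ V]
  {ι : Type*} [Fintype ι] {b : Module.Basis ι ℝ V} {w : ι → ℝ} {ϖ : Weight V}

/-- The exponents of the monomials of weight at least `-κ`; these are the monomials in
`P_{≤ κ}(V)`. -/
def MonIndex (w : ι → ℝ) (κ : ℝ) : Type _ := {α : ι →₀ ℕ // -κ ≤ monWeight w α}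

/-- Polynomials in adapted coordinates with monomials of weight at least `-κ` are the same as
polynomial functions of weight at most `κ`. -/
noncomputable def polyEquiv [ϖ.Negative] (hb : IsAdapted ϖ b w) (κ : ℝ) :
    MvPolynomial.restrictSupport ℝ {α | -κ ≤ monWeight w α} ≃ₗ[ℝ] WPoly ϖ κ :=
  LinearEquiv.ofBijective
    { toFun := fun p => ⟨polyFun b p.1, polyFun_mem hb p.2⟩
      map_add' := fun p q => Subtype.ext (map_add (polyFun b) p.1 q.1)
      map_smul' := fun c p => Subtype.ext (map_smul (polyFun b) c p.1) }
    ⟨fun p q h => Subtype.ext (polyFun_injective b (congrArg Subtype.val h)), fun h => by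
      obtain ⟨N, hN⟩ := exists_degree_bound (ϖ := ϖ) κ
      exact ⟨⟨coordPoly b N h, coordPoly_mem_restrictSupport hb h.2 N⟩,
        Subtype.ext (polyFun_coordPoly b h.2.1 (hN _ h.2))⟩⟩

/-- The basis of `P_{≤ κ}(V)` by monomials in adapted coordinates. -/
noncomputable def monBasis [ϖ.Negative] (hb : IsAdapted ϖ b w) (κ : ℝ) :
    Module.Basis (MonIndex w κ) ℝ (WPoly ϖ κ) :=
  (MvPolynomial.basisRestrictSupport ℝ {α | -κ ≤ monWeight w α}).map (polyEquiv hb κ)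

variable [ϖ.Negative] (hb : IsAdapted ϖ b w) (κ : ℝ)

lemma monBasis_repr (h : WPoly ϖ κ) {p : MvPolynomial ι ℝ} (hp : polyFun b p = (h : V → ℝ))
    (hmem : p ∈ MvPolynomial.restrictSupport ℝ {α | -κ ≤ monWeight w α}) (α : MonIndex w κ) :
    (monBasis hb κ).repr h α = MvPolynomial.coeff α.1 p := by
  have h1 : (polyEquiv hb κ).symm h = ⟨p, hmem⟩ := by
    rw [LinearEquiv.symm_apply_eq]
    exact Subtype.ext hp.symm
  show (MvPolynomial.basisRestrictSupport ℝ {α | -κ ≤ monWeight w α}).repr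
    ((polyEquiv hb κ).symm h) α = _
  rw [h1]
  rfl

lemma monBasis_coe (α : MonIndex w κ) :
    (monBasis hb κ α : V → ℝ) = polyFun b (MvPolynomial.monomial α.1 1) := by
  classical
  let h : WPoly ϖ κ := ⟨polyFun b (MvPolynomial.monomial α.1 1), polyFun_monomial_mem hb α.2⟩
  have h1 : monBasis hb κ α = h := by
    apply (monBasis hb κ).repr.injective
    ext γ
    rw [monBasis_repr hb κ h rfl ((MvPolynomial.monomial_mem_restrictSupport ℝ).2 (Or.inl α.2)),
      Module.Basis.repr_self, MvPolynomial.coeff_monomial, Finsupp.single_apply]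
    exact if_congr Subtype.ext_iff rfl rfl
  rw [h1]

/-- The basis of `𝐕 = (P_{≤ κ}(V))*` dual to the monomial basis. -/
noncomputable def dualMonBasis [Finite (MonIndex w κ)] :
    Module.Basis (MonIndex w κ) ℝ (LinSpace ϖ κ) :=
  letI := Classical.decEq (MonIndex w κ)
  (monBasis hb κ).dualBasis.map LinearMap.toContinuousLinearMap

lemma dualMonBasis_apply [Finite (MonIndex w κ)] (α : MonIndex w κ) (h : WPoly ϖ κ) :
    dualMonBasis hb κ α h = (monBasis hb κ).repr h α := by
  classical
  show (monBasis hb κ).dualBasis α h = _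
  simp

lemma dualMonBasis_repr [Finite (MonIndex w κ)] (ξ : LinSpace ϖ κ) (α : MonIndex w κ) :
    (dualMonBasis hb κ).repr ξ α = ξ (monBasis hb κ α) := by
  classical
  show (monBasis hb κ).dualBasis.repr (LinearMap.toContinuousLinearMap.symm ξ) α = _
  rw [Module.Basis.dualBasis_repr]
  rfl

end MonomialBasis

/-! ### Pullback of monomials -/

section Leading

lemma MvPolynomial.mul_mem_restrictSupport {ι : Type*} {s t u : Set (ι →₀ ℕ)}
    (h : ∀ a ∈ s, ∀ c ∈ t, a + c ∈ u) {p q : MvPolynomial ι ℝ}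
    (hp : p ∈ MvPolynomial.restrictSupport ℝ s) (hq : q ∈ MvPolynomial.restrictSupport ℝ t) :
    p * q ∈ MvPolynomial.restrictSupport ℝ u := by
  have h1 : p * q ∈ MvPolynomial.restrictSupport ℝ s * MvPolynomial.restrictSupport ℝ t :=
    Submodule.mul_mem_mul hp hq
  open scoped Pointwise in
  rw [← MvPolynomial.restrictSupport_add] at h1
  refine MvPolynomial.restrictSupport_mono ℝ ?_ h1
  open scoped Pointwise in
  rintro _ ⟨a, ha, c, hc, rfl⟩
  exact h a ha c hc

variable {ι : Type*} [Fintype ι] {w : ι → ℝ}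

/-- The polynomial obtained by substituting `q i` for the variables in the monomial `x^α`. -/
noncomputable def substMon (q : ι → MvPolynomial ι ℝ) (α : ι →₀ ℕ) : MvPolynomial ι ℝ :=
  ∏ i, q i ^ α i

lemma polyFun_substMon {V : Type*} [NormedAddCommGroup V] [NormedSpace ℝ V]
    {b : Module.Basis ι ℝ V} {q : ι → MvPolynomial ι ℝ} {g : V → V}
    (hq : ∀ i, polyFun b (q i) = fun x => b.repr (g x) i) (α : ι →₀ ℕ) :
    polyFun b (substMon q α) = polyFun b (MvPolynomial.monomial α 1) ∘ g := by
  funext x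
  rw [Function.comp_apply, polyFun_monomial, substMon, map_prod, Finset.prod_apply]
  refine Finset.prod_congr rfl fun i _ => ?_
  rw [map_pow, Pi.pow_apply, hq]

lemma substMon_add (q : ι → MvPolynomial ι ℝ) (α β : ι →₀ ℕ) :
    substMon q (α + β) = substMon q α * substMon q β := by
  simp [substMon, pow_add, Finset.prod_mul_distrib]

lemma substMon_single (q : ι → MvPolynomial ι ℝ) (i : ι) :
    substMon q (Finsupp.single i 1) = q i := by
  classical
  rw [substMon, Finset.prod_eq_single i]
  · simp
  · intro j _ hj
    simp [Finsupp.single_eq_of_ne hj]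
  · simp

lemma subExp_coeff_substMon {q : ℕ → ι → MvPolynomial ι ℝ}
    (hq : ∀ i γ, SubExp fun n => MvPolynomial.coeff γ (q n i)) (α γ : ι →₀ ℕ) :
    SubExp fun n => MvPolynomial.coeff γ (substMon (q n) α) := by
  have hone : ∀ γ : ι →₀ ℕ, SubExp fun _ => MvPolynomial.coeff γ (1 : MvPolynomial ι ℝ) :=
    fun γ => SubExp.const _
  have hpow : ∀ i k γ, SubExp fun n => MvPolynomial.coeff γ (q n i ^ k) := by
    intro i k
    induction k with
    | zero => simpa only [pow_zero] using hone
    | succ k ih => simpa only [pow_succ] using subExp_coeff_mul ih (hq i)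
  have : ∀ (s : Finset ι) γ, SubExp fun n => MvPolynomial.coeff γ (∏ i ∈ s, q n i ^ α i) := by
    classical
    intro s
    induction s using Finset.induction_on with
    | empty => simpa only [Finset.prod_empty] using hone
    | insert i s hi ih =>
      simpa only [Finset.prod_insert hi] using subExp_coeff_mul (hpow i (α i)) ih
  exact this Finset.univ γ

lemma monRank_add_lt {α β γ δ : ι →₀ ℕ} (h1 : monRank w α < monRank w γ)
    (h2 : monRank w β < monRank w δ) : monRank w (α + β) < monRank w (γ + δ) := by
  rw [monRank_lt_iff] at *
  simp only [monWeight_add, map_add]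
  rcases h1 with h1 | ⟨h1, h1'⟩ <;> rcases h2 with h2 | ⟨h2, h2'⟩
  · left; linarith
  · left; linarith
  · left; linarith
  · right; constructor
    · linarith
    · omega

lemma monRank_add_lt_left (α : ι →₀ ℕ) {β δ : ι →₀ ℕ}
    (h2 : monRank w β < monRank w δ) : monRank w (α + β) < monRank w (α + δ) := by
  rw [monRank_lt_iff] at *
  simp only [monWeight_add, map_add]
  rcases h2 with h2 | ⟨h2, h2'⟩
  · left; linarith
  · right; constructor
    · linarith
    · omega

/-- If every `q i` is `e^{w i} x_i` plus monomials of higher rank, then substitution in `x^α` gives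
`e^{⟨α, w⟩} x^α` plus monomials of higher rank. -/
lemma substMon_sub_mem {q : ι → MvPolynomial ι ℝ}
    (hq : ∀ i, q i - MvPolynomial.monomial (Finsupp.single i 1) (Real.exp (w i)) ∈
      MvPolynomial.restrictSupport ℝ {γ | monRank w (Finsupp.single i 1) < monRank w γ})
    (α : ι →₀ ℕ) :
    substMon q α - MvPolynomial.monomial α (Real.exp (monWeight w α)) ∈
      MvPolynomial.restrictSupport ℝ {γ | monRank w α < monRank w γ} := by
  have hadd : ∀ α β : ι →₀ ℕ,
      substMon q α - MvPolynomial.monomial α (Real.exp (monWeight w α)) ∈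
        MvPolynomial.restrictSupport ℝ {γ | monRank w α < monRank w γ} →
      substMon q β - MvPolynomial.monomial β (Real.exp (monWeight w β)) ∈
        MvPolynomial.restrictSupport ℝ {γ | monRank w β < monRank w γ} →
      substMon q (α + β) - MvPolynomial.monomial (α + β) (Real.exp (monWeight w (α + β))) ∈
        MvPolynomial.restrictSupport ℝ {γ | monRank w (α + β) < monRank w γ} := by
    intro α β hα hβ
    have hm : MvPolynomial.monomial (α + β) (Real.exp (monWeight w (α + β))) =
        MvPolynomial.monomial α (Real.exp (monWeight w α)) *
          MvPolynomial.monomial β (Real.exp (monWeight w β)) := by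
      rw [MvPolynomial.monomial_mul, monWeight_add, Real.exp_add]
    have hself : ∀ (γ : ι →₀ ℕ) (c : ℝ),
        MvPolynomial.monomial γ c ∈ MvPolynomial.restrictSupport ℝ {γ} := fun γ c =>
      (MvPolynomial.monomial_mem_restrictSupport ℝ).2 (Or.inl rfl)
    have hsplit : substMon q (α + β) - MvPolynomial.monomial α (Real.exp (monWeight w α)) *
          MvPolynomial.monomial β (Real.exp (monWeight w β)) =
        MvPolynomial.monomial α (Real.exp (monWeight w α)) *
          (substMon q β - MvPolynomial.monomial β (Real.exp (monWeight w β))) +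
        MvPolynomial.monomial β (Real.exp (monWeight w β)) *
          (substMon q α - MvPolynomial.monomial α (Real.exp (monWeight w α))) +
        (substMon q α - MvPolynomial.monomial α (Real.exp (monWeight w α))) *
          (substMon q β - MvPolynomial.monomial β (Real.exp (monWeight w β))) := by
      rw [substMon_add]
      ring
    rw [hm, hsplit]
    refine Submodule.add_mem _ (Submodule.add_mem _ ?_ ?_) ?_
    · refine MvPolynomial.mul_mem_restrictSupport ?_ (hself _ _) hβ
      rintro _ rfl c hc
      exact monRank_add_lt_left _ hc
    · refine MvPolynomial.mul_mem_restrictSupport ?_ (hself _ _) hα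
      rintro _ rfl c hc
      show monRank w (α + _) < monRank w (_ + c)
      rw [add_comm α]
      exact monRank_add_lt_left _ hc
    · exact MvPolynomial.mul_mem_restrictSupport (fun a ha c hc => monRank_add_lt ha hc) hα hβ
  have hzero : substMon q 0 - MvPolynomial.monomial 0 (Real.exp (monWeight w 0)) ∈
      MvPolynomial.restrictSupport ℝ {γ | monRank w 0 < monRank w γ} := by
    have : substMon q 0 - MvPolynomial.monomial 0 (Real.exp (monWeight w 0)) = 0 := by
      simp [substMon]
    rw [this]
    exact Submodule.zero_mem _
  induction α using Finsupp.induction_linear with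
  | zero => exact hzero
  | add α β hα hβ => exact hadd α β hα hβ
  | single i n =>
    induction n with
    | zero => simpa only [Finsupp.single_zero] using hzero
    | succ n ih =>
      rw [Finsupp.single_add]
      refine hadd _ _ ih ?_
      rw [substMon_single, monWeight_single]
      exact hq i

end Leading

/-! ### The linearization of a subresonant map with diagonal linear part -/

section Linearized

variable {V : Type*} [NormedAddCommGroup V] [InnerProductSpace ℝ V] [FiniteDimensional ℝ V]
  {ι : Type*} {b : Module.Basis ι ℝ V} {w : ι → ℝ} {ϖ : Weight V}

lemma coord_comp_mem_polyLE (hb : IsAdapted ϖ b w) (g : polyLE ϖ ϖ 0) (i : ι) :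
    (fun x => b.repr (g.1 x) i) ∈ polyLE ϖ trivialWeight (-w i) := by
  refine comp_mem_polyLE (ϖW := ϖ) (g := LinearMap.toContinuousLinearMap (b.coord i))
    (continuousLinearMap_mem_polyLE _ fun v => ?_) g.2
  by_cases h0 : b.repr v i = 0
  · have : trivialWeight (LinearMap.toContinuousLinearMap (b.coord i) v) = ⊥ := if_pos h0
    rw [this]
    exact bot_le
  · have : trivialWeight (LinearMap.toContinuousLinearMap (b.coord i) v) = 0 := if_neg h0
    rw [this]
    have hle : ((w i : ℝ) : EReal) ≤ ϖ v := EReal.le_of_forall_lt_iff_le.1 fun r hr => by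
      exact_mod_cast (hb v r).1 hr.le i h0
    calc (0 : EReal) = ((-w i : ℝ) : EReal) + (w i : EReal) := by
          rw [← EReal.coe_add, neg_add_cancel, EReal.coe_zero]
      _ ≤ _ := add_le_add le_rfl hle

lemma fderiv_coord_comp {g : V → V} (hg : IsPolynomialMap g) (i : ι) (v : V) :
    fderiv ℝ (fun x => b.repr (g x) i) 0 v = b.repr (fderiv ℝ g 0 v) i := by
  have h1 : HasFDerivAt g (fderiv ℝ g 0) 0 :=
    (hg.contDiff (n := 1).differentiable one_ne_zero 0).hasFDerivAt
  have h2 := ((LinearMap.toContinuousLinearMap (b.coord i)).hasFDerivAt (x := g 0)).comp 0 h1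
  have h3 : fderiv ℝ (fun x => b.repr (g x) i) 0 =
      (LinearMap.toContinuousLinearMap (b.coord i)).comp (fderiv ℝ g 0) := h2.fderiv
  rw [h3]
  rfl

variable [Fintype ι]

/-- A component of a subresonant map with diagonal linear part is its linear term plus monomials of
higher rank: monomials of the same weight are allowed, but they have degree at least two. -/
lemma coordPoly_sub_mem (hb : IsAdapted ϖ b w) (hw : ∀ i, w i < 0) (g : polyLE ϖ ϖ 0)
    (hg : ∀ j, fderiv ℝ g.1 0 (b j) = Real.exp (w j) • b j) {K : ℕ} (hK : 1 < K) (i : ι) :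
    coordPoly b K (fun x => b.repr (g.1 x) i) -
        MvPolynomial.monomial (Finsupp.single i 1) (Real.exp (w i)) ∈
      MvPolynomial.restrictSupport ℝ {γ | monRank w (Finsupp.single i 1) < monRank w γ} := by
  classical
  rw [MvPolynomial.mem_restrictSupport_iff]
  intro γ hγ
  rw [Finset.mem_coe, MvPolynomial.mem_support_iff] at hγ
  have hle : w i ≤ monWeight w γ := by
    have hmem : coordPoly b K (fun x => b.repr (g.1 x) i) -
        MvPolynomial.monomial (Finsupp.single i 1) (Real.exp (w i)) ∈
        MvPolynomial.restrictSupport ℝ {α | -(-w i) ≤ monWeight w α} := by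
      refine Submodule.sub_mem _
        (coordPoly_mem_restrictSupport hb (coord_comp_mem_polyLE hb g i) K) ?_
      exact (MvPolynomial.monomial_mem_restrictSupport ℝ).2 (Or.inl (by simp))
    rw [MvPolynomial.mem_restrictSupport_iff] at hmem
    simpa using hmem (MvPolynomial.mem_support_iff.2 hγ)
  show monRank w _ < monRank w γ
  rw [monRank_lt_iff, monWeight_single, Finsupp.degree_single]
  by_contra hcon
  push Not at hcon
  have heq : w i = monWeight w γ := le_antisymm hle hcon.1
  have hdeg := hcon.2 heq
  rcases Nat.le_one_iff_eq_zero_or_eq_one.1 hdeg with h0 | h1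
  · rw [Finsupp.degree_eq_zero_iff] at h0
    rw [h0, monWeight_zero] at heq
    exact (hw i).ne heq
  · obtain ⟨j, rfl⟩ : ∃ j, γ = Finsupp.single j 1 := by
      obtain ⟨j, hj⟩ := Finsupp.ne_iff.1 (show γ ≠ 0 by rintro rfl; simp at h1)
      obtain ⟨δ, rfl⟩ := le_iff_exists_add.1
        (Finsupp.single_le_iff.2 (Nat.one_le_iff_ne_zero.2 hj) : Finsupp.single j 1 ≤ γ)
      have hδ : δ.degree = 0 := by simpa using h1
      exact ⟨j, by rw [(Finsupp.degree_eq_zero_iff δ).1 hδ, add_zero]⟩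
    apply hγ
    rw [MvPolynomial.coeff_sub, coeff_single_coordPoly b hK, fderiv_coord_comp g.2.1, hg,
      MvPolynomial.coeff_monomial, map_smul, b.repr_self]
    rcases eq_or_ne i j with rfl | hij
    · simp
    · rw [if_neg fun h => hij (Finsupp.single_left_injective one_ne_zero h)]
      simp [Finsupp.single_eq_of_ne hij]

variable [ϖ.Negative] (hb : IsAdapted ϖ b w) (κ : ℝ)

/-- The entries of the matrix of `g*` in the monomial basis. -/
lemma monBasis_repr_pullback (g : polyLE ϖ ϖ 0) {q : ι → MvPolynomial ι ℝ}
    (hq : ∀ i, polyFun b (q i) = fun x => b.repr (g.1 x) i)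
    (hlead : ∀ i, q i - MvPolynomial.monomial (Finsupp.single i 1) (Real.exp (w i)) ∈
      MvPolynomial.restrictSupport ℝ {γ | monRank w (Finsupp.single i 1) < monRank w γ})
    (α γ : MonIndex w κ) :
    (monBasis hb κ).repr (pullback κ g (monBasis hb κ α)) γ =
      MvPolynomial.coeff γ.1 (substMon q α.1) := by
  refine monBasis_repr hb κ _ ?_ ?_ γ
  · rw [polyFun_substMon hq, ← monBasis_coe hb κ α]
    rfl
  · have h := substMon_sub_mem hlead α.1
    have h2 : substMon q α.1 - MvPolynomial.monomial α.1 (Real.exp (monWeight w α.1)) ∈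
        MvPolynomial.restrictSupport ℝ {α | -κ ≤ monWeight w α} := by
      refine MvPolynomial.restrictSupport_mono ℝ (fun γ hγ => ?_) h
      rcases (monRank_lt_iff w).1 hγ with h | h
      · exact α.2.trans h.le
      · exact α.2.trans h.1.le
    have h3 := Submodule.add_mem _ h2 ((MvPolynomial.monomial_mem_restrictSupport ℝ).2
      (Or.inl α.2 : _ ∨ Real.exp (monWeight w α.1) = 0))
    rwa [sub_add_cancel] at h3

end Linearized

/-! ### Functoriality and norm of the linearization -/

section FormInner

variable {X V : Type*} [NormedAddCommGroup X] [InnerProductSpace ℝ X] [FiniteDimensional ℝ X]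
  [NormedAddCommGroup V] [InnerProductSpace ℝ V] [FiniteDimensional ℝ V]

lemma formInner_self_nonneg {k : ℕ} (S : V [×k]→L[ℝ] ℝ) : 0 ≤ WPoly.formInner k S S :=
  Finset.sum_nonneg fun _ _ => mul_self_nonneg _

/-- A multilinear form is bounded by its Hilbert–Schmidt norm. -/
lemma sq_apply_le_formInner {k : ℕ} (S : V [×k]→L[ℝ] ℝ) (v : Fin k → V) :
    S v ^ 2 ≤ WPoly.formInner k S S * ∏ i, ‖v i‖ ^ 2 := by
  let e := stdOrthonormalBasis ℝ V
  have h1 : S v = ∑ j : Fin k → Fin (Module.finrank ℝ V),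
      (∏ i, inner ℝ (e (j i)) (v i)) * S fun i => e (j i) := by
    have h0 : v = fun i => ∑ l, inner ℝ (e l) (v i) • e l :=
      funext fun i => (e.sum_repr' (v i)).symm
    conv_lhs => rw [h0]
    rw [ContinuousMultilinearMap.map_sum]
    refine Finset.sum_congr rfl fun j _ => ?_
    rw [ContinuousMultilinearMap.map_smul_univ, smul_eq_mul]
  have h2 : ∑ j : Fin k → Fin (Module.finrank ℝ V), (∏ i, inner ℝ (e (j i)) (v i)) ^ 2 =
      ∏ i, ‖v i‖ ^ 2 := by
    simp only [← Finset.prod_pow]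
    rw [← Fintype.prod_sum fun i l => (inner ℝ (e l) (v i) : ℝ) ^ 2]
    refine Finset.prod_congr rfl fun i _ => ?_
    rw [← e.sum_sq_norm_inner_right (v i)]
    simp
  rw [h1, mul_comm, ← h2]
  refine (Finset.sum_mul_sq_le_sq_mul_sq _ _ _).trans (le_of_eq ?_)
  congr 1
  refine Finset.sum_congr rfl fun j _ => ?_
  rw [sq]

lemma formInner_compContinuousLinearMap_le {k : ℕ} (S : V [×k]→L[ℝ] ℝ) (T : X →L[ℝ] V) :
    WPoly.formInner k (S.compContinuousLinearMap fun _ => T)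
        (S.compContinuousLinearMap fun _ => T) ≤
      (Module.finrank ℝ X * ‖T‖ ^ 2) ^ k * WPoly.formInner k S S := by
  have h : ∀ j : Fin k → Fin (Module.finrank ℝ X),
      S (fun i => T (stdOrthonormalBasis ℝ X (j i))) *
        S (fun i => T (stdOrthonormalBasis ℝ X (j i))) ≤
      WPoly.formInner k S S * (‖T‖ ^ 2) ^ k := by
    intro j
    rw [← sq]
    refine (sq_apply_le_formInner S _).trans ?_
    refine mul_le_mul_of_nonneg_left ?_ (formInner_self_nonneg S)
    refine (Finset.prod_le_prod (fun _ _ => by positivity) fun i _ =>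
      pow_le_pow_left₀ (norm_nonneg _) (T.le_opNorm _) 2).trans (le_of_eq ?_)
    simp
  refine (Finset.sum_le_sum fun j _ => h j).trans (le_of_eq ?_)
  simp
  ring

end FormInner

section Functoriality

variable {X V W : Type*} [NormedAddCommGroup X] [InnerProductSpace ℝ X] [FiniteDimensional ℝ X]
  [NormedAddCommGroup V] [InnerProductSpace ℝ V] [FiniteDimensional ℝ V]
  [NormedAddCommGroup W] [InnerProductSpace ℝ W] [FiniteDimensional ℝ W]
  {ϖX : Weight X} {ϖV : Weight V} {ϖW : Weight W} {κ : ℝ}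

lemma WPoly.norm_sq_eq (h : WPoly ϖX κ) :
    ‖h‖ ^ 2 = ∑ᶠ k, WPoly.formInner k (polarization k (h : X → ℝ)) (polarization k (h : X → ℝ)) :=
  (real_inner_self_eq_norm_sq h).symm

lemma WPoly.sum_formInner_le_norm_sq (h : WPoly ϖX κ) (s : Finset ℕ) :
    ∑ k ∈ s, WPoly.formInner k (polarization k (h : X → ℝ)) (polarization k (h : X → ℝ)) ≤
      ‖h‖ ^ 2 := by
  rw [WPoly.norm_sq_eq,
    finsum_eq_sum_of_support_subset (s := (WPoly.support_finite h h).toFinset ∪ s)]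
  · exact Finset.sum_le_sum_of_subset_of_nonneg Finset.subset_union_right
      fun k _ _ => formInner_self_nonneg _
  · simp

lemma const_mem_polyLE {X : Type*} [NormedAddCommGroup X] [NormedSpace ℝ X]
    {ϖX : Weight X} (hκ : 0 ≤ κ) (c : ℝ) : (fun _ : X => c) ∈ polyLE ϖX trivialWeight κ := by
  refine multilinear_diag_mem_polyLE (ι := Empty)
    (MultilinearMap.constOfIsEmpty ℝ (fun _ : Empty => X) c) continuous_const fun v => ?_
  have : trivialWeight c ≤ 0 := by
    show (if c = 0 then (⊥ : EReal) else 0) ≤ 0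
    split_ifs <;> simp
  refine this.trans ?_
  simpa using hκ

/-- The constant function `1` as an element of `P_{≤ κ}(V)`. -/
noncomputable def WPoly.one (ϖX : Weight X) {κ : ℝ} (hκ : 0 ≤ κ) : WPoly ϖX κ :=
  ⟨fun _ => 1, const_mem_polyLE hκ 1⟩

lemma WPoly.norm_one (hκ : 0 ≤ κ) : ‖WPoly.one ϖX hκ‖ = 1 := by
  have h0 : ∀ k, k ≠ 0 → polarization k (WPoly.one ϖX hκ : X → ℝ) = 0 := fun k hk => by
    show (k ! : ℝ)⁻¹ • iteratedFDeriv ℝ k (fun _ : X => (1 : ℝ)) 0 = 0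
    rw [iteratedFDeriv_const_of_ne hk]
    simp
  have h1 : ∀ v, polarization 0 (WPoly.one ϖX hκ : X → ℝ) v = 1 := fun v => by
    show ((0 ! : ℝ)⁻¹ • iteratedFDeriv ℝ 0 (fun _ : X => (1 : ℝ)) 0) v = 1
    simp
  have hsq : ‖WPoly.one ϖX hκ‖ ^ 2 = 1 := by
    rw [WPoly.norm_sq_eq, finsum_eq_single _ 0]
    · simp [WPoly.formInner, h1]
    · intro k hk
      simp [WPoly.formInner, h0 k hk]
  exact (pow_eq_one_iff_of_nonneg (norm_nonneg _) two_ne_zero).1 hsq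

lemma mem_linSubspace_iff (hκ : 0 ≤ κ) (ξ : LinSpace ϖX κ) :
    ξ ∈ linSubspace ϖX κ ↔ ξ (WPoly.one ϖX hκ) = 0 := by
  constructor
  · exact fun h => h _ ⟨1, fun _ => rfl⟩
  · rintro h p ⟨c, hc⟩
    have : p = c • WPoly.one ϖX hκ := Subtype.ext (funext fun x => by
      refine (hc x).trans ?_
      show c = c * 1
      rw [mul_one])
    rw [this, map_smul, h, smul_zero]

/-- A functional that takes the value `1` at the constant `1` has norm at least `1`. -/
lemma one_le_norm_of_apply_one (hκ : 0 ≤ κ) (ξ : LinSpace ϖX κ) (hξ : ξ (WPoly.one ϖX hκ) = 1) :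
    1 ≤ ‖ξ‖ := by
  have h1 : ‖ξ (WPoly.one ϖX hκ)‖ ≤ ‖ξ‖ * ‖WPoly.one ϖX hκ‖ := ξ.le_opNorm _
  rwa [hξ, WPoly.norm_one, mul_one, Real.norm_eq_abs, abs_one] at h1

section Negative

variable [ϖX.Negative] [ϖV.Negative] [ϖW.Negative]

lemma linearize_apply (f : polyLE ϖV ϖW 0) (ξ : LinSpace ϖV κ) (h : WPoly ϖW κ) :
    linearize κ f ξ h = ξ (pullback κ f h) := rfl

lemma linearize_linearize (g : polyLE ϖV ϖW 0) (f : polyLE ϖX ϖV 0) (h : polyLE ϖX ϖW 0)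
    (hcomp : ∀ x, g.1 (f.1 x) = h.1 x) (ξ : LinSpace ϖX κ) :
    linearize κ g (linearize κ f ξ) = linearize κ h ξ := by
  ext p
  rw [linearize_apply, linearize_apply, linearize_apply]
  congr 1
  refine Subtype.ext (funext fun x => ?_)
  exact congrArg p.1 (hcomp x)

lemma linearize_eq_self (f : polyLE ϖX ϖX 0) (hf : ∀ x, f.1 x = x) (ξ : LinSpace ϖX κ) :
    linearize κ f ξ = ξ := by
  ext p
  rw [linearize_apply]
  congr 1
  refine Subtype.ext (funext fun x => ?_)
  exact congrArg p.1 (hf x)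

/-- The linearization of a linear map is bounded by a polynomial in the norm of the map. -/
lemma norm_linearize_apply_le (T : X →L[ℝ] V) (f : polyLE ϖX ϖV 0) (hf : ∀ x, f.1 x = T x) {N : ℕ}
    (hN : ∀ (h : WPoly ϖV κ) (k : ℕ), N ≤ k → polarization k (fun x => h (T x)) = 0)
    (ξ : LinSpace ϖX κ) :
    ‖linearize κ f ξ‖ ≤
      (1 + ∑ k ∈ Finset.range N, (Module.finrank ℝ X * ‖T‖ ^ 2) ^ k) * ‖ξ‖ := by
  set C : ℝ := ∑ k ∈ Finset.range N, (Module.finrank ℝ X * ‖T‖ ^ 2) ^ k with hC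
  have hC0 : 0 ≤ C := Finset.sum_nonneg fun k _ => by positivity
  have hpull : ∀ h : WPoly ϖV κ, ‖pullback κ f h‖ ≤ (1 + C) * ‖h‖ := by
    intro h
    have hcoe : ((pullback κ f h : WPoly ϖX κ) : X → ℝ) = fun x => h (T x) :=
      funext fun x => congrArg h.1 (hf x)
    have hpol : ∀ k, polarization k (fun x => h (T x)) =
        (polarization k (h : V → ℝ)).compContinuousLinearMap fun _ => T := fun k => by
      have := h.2.1.linear_comp_comp (ContinuousLinearMap.id ℝ ℝ) T k
      exact this
    have hsq : ‖pullback κ f h‖ ^ 2 ≤ C * ‖h‖ ^ 2 := by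
      rw [WPoly.norm_sq_eq, hcoe, finsum_eq_sum_of_support_subset (s := Finset.range N)]
      · rw [hC, Finset.sum_mul]
        refine Finset.sum_le_sum fun k _ => ?_
        rw [hpol]
        refine (formInner_compContinuousLinearMap_le _ T).trans ?_
        gcongr
        simpa using WPoly.sum_formInner_le_norm_sq h {k}
      · intro k hk
        by_contra hkN
        refine hk ?_
        simp [hN h k (by simpa using hkN), WPoly.formInner]
    refine abs_le_of_sq_le_sq' ?_ (by positivity) |>.2
    refine hsq.trans ?_
    rw [mul_pow]
    gcongr
    nlinarith
  refine ContinuousLinearMap.opNorm_le_bound _ (by positivity) fun h => ?_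
  rw [linearize_apply]
  refine (ξ.le_opNorm _).trans ?_
  calc ‖ξ‖ * ‖pullback κ f h‖ ≤ ‖ξ‖ * ((1 + C) * ‖h‖) := by gcongr; exact hpull h
    _ = (1 + C) * ‖ξ‖ * ‖h‖ := by ring

lemma exists_norm_eq_one_apply_one (hκ : 0 ≤ κ) :
    ∃ ξ : LinSpace ϖX κ, ‖ξ‖ = 1 ∧ ξ (WPoly.one ϖX hκ) = 1 := by
  refine ⟨InnerProductSpace.toDual ℝ (WPoly ϖX κ) (WPoly.one ϖX hκ), ?_, ?_⟩
  · rw [LinearIsometryEquiv.norm_map, WPoly.norm_one]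
  · rw [InnerProductSpace.toDual_apply_apply, real_inner_self_eq_norm_sq, WPoly.norm_one, one_pow]

/-- The functionals that vanish on constants form a hyperplane. -/
lemma finrank_linSubspace (hκ : 0 ≤ κ) :
    Module.finrank ℝ (linSubspace ϖX κ) + 1 = Module.finrank ℝ (LinSpace ϖX κ) := by
  let ev : LinSpace ϖX κ →ₗ[ℝ] ℝ :=
    { toFun := fun ξ => ξ (WPoly.one ϖX hκ)
      map_add' := fun _ _ => rfl
      map_smul' := fun _ _ => rfl }
  have hker : linSubspace ϖX κ = LinearMap.ker ev := by
    ext ξ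
    exact mem_linSubspace_iff hκ ξ
  have hsurj : LinearMap.range ev = ⊤ := by
    refine LinearMap.range_eq_top.2 fun c => ?_
    obtain ⟨ξ, -, hξ⟩ := exists_norm_eq_one_apply_one (ϖX := ϖX) hκ
    refine ⟨c • ξ, ?_⟩
    show c * ξ (WPoly.one ϖX hκ) = c
    rw [hξ, mul_one]
  have h := LinearMap.finrank_range_add_finrank_ker ev
  rw [hsurj, finrank_top, Module.finrank_self] at h
  rw [hker]
  omega

end Negative

end Functoriality

/-! ### Forwards regularity of sequences conjugate to triangular ones -/

section Conjugate

variable {E : ℕ → Type*} [∀ i, NormedAddCommGroup (E i)] [∀ i, InnerProductSpace ℝ (E i)]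
  {F : Type*} [NormedAddCommGroup F] [InnerProductSpace ℝ F]
  {ι ρ : Type*} [Fintype ι] [LinearOrder ρ]

lemma subExp_norm_of_repr (b : Module.Basis ι ℝ F) (x : ℕ → F)
    (hx : ∀ i, SubExp fun n => b.repr (x n) i) : SubExp fun n => ‖x n‖ := by
  refine (SubExp.sum Finset.univ fun i _ => (hx i).abs.mul (SubExp.const ‖b i‖)).of_le
    (fun n => norm_nonneg _) fun n => ?_
  conv_lhs => rw [← b.sum_repr (x n)]
  refine (norm_sum_le _ _).trans (Finset.sum_le_sum fun i _ => ?_)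
  rw [norm_smul, Real.norm_eq_abs]

/-- The product of the maps `G 0, …, G (n - 1)` of a fixed space. -/
def iterProd (G : ℕ → F →L[ℝ] F) : ℕ → F →L[ℝ] F
  | 0 => ContinuousLinearMap.id ℝ F
  | n + 1 => (G n).comp (iterProd G n)

lemma det_iterProd (G : ℕ → F →L[ℝ] F) {s : ℝ}
    (hG : ∀ n, LinearMap.det (G n : F →ₗ[ℝ] F) = Real.exp s) (n : ℕ) :
    LinearMap.det (iterProd G n : F →ₗ[ℝ] F) = Real.exp (n * s) := by
  induction n with
  | zero => simp [iterProd]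
  | succ n ih =>
    rw [iterProd, ContinuousLinearMap.toLinearMap_comp, LinearMap.det_comp, hG, ih, ← Real.exp_add]
    push_cast
    ring_nf

variable [∀ i, FiniteDimensional ℝ (E i)] [FiniteDimensional ℝ F]

/-- Let `A n` be conjugate, by maps that are subexponential together with their inverses, to maps
`G n` of a fixed space that are triangular in a fixed basis, with subexponential entries and
constant diagonal entries `e^{χ i}` that increase in the direction of the coupling.  If the `A n`
and their inverses are not contractions, then the sequence is forwards regular and the basis is
adapted to its Lyapunov weight. -/
theorem forwardsRegular_of_conjugate_triangular (A : ∀ i, E i →L[ℝ] E (i + 1))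
    (P : ∀ n, F ≃L[ℝ] E n) (G : ℕ → F →L[ℝ] F) (hconj : ∀ n x, A n (P n x) = P (n + 1) (G n x))
    {c c' : ℕ → ℝ} (hc : SubExp c) (hPc : ∀ n x, ‖P n x‖ ≤ c n * ‖x‖)
    (hc' : SubExp c') (hPc' : ∀ n x, ‖(P n).symm x‖ ≤ c' n * ‖x‖)
    (b : Module.Basis ι ℝ F) (r : ι → ρ) (χ : ι → ℝ) (hrχ : ∀ i j, r i < r j → χ i ≤ χ j)
    (hdiag : ∀ n i, b.repr (G n (b i)) i = Real.exp (χ i))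
    (htri : ∀ n i j, i ≠ j → b.repr (G n (b j)) i ≠ 0 → r i < r j)
    (hM : ∀ i j, SubExp fun n => b.repr (G n (b j)) i)
    (hone : ∀ n, ∃ ξ : E n, ‖ξ‖ = 1 ∧ 1 ≤ ‖A n ξ‖)
    (hone' : ∀ n, ∃ η : E (n + 1), ‖η‖ = 1 ∧ ∀ ξ, A n ξ = η → 1 ≤ ‖ξ‖) :
    ForwardsRegular A ∧ IsAdapted (lyapunovWeight A) (b.map (P 0).toLinearEquiv) χ := by
  classical
  have hdimF : Module.finrank ℝ F = Fintype.card ι := Module.finrank_eq_card_basis b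
  have hdim : ∀ n, Module.finrank ℝ (E n) = Fintype.card ι := fun n => by
    rw [← (P n).toLinearEquiv.finrank_eq, hdimF]
  have hPn : SubExp fun n => ‖(P n : F →L[ℝ] E n)‖ :=
    hc.abs.of_le (fun n => norm_nonneg _) fun n =>
      ContinuousLinearMap.opNorm_le_bound _ (abs_nonneg _) fun x =>
        (hPc n x).trans (by gcongr; exact le_abs_self _)
  have hPn' : SubExp fun n => ‖((P n).symm : E n →L[ℝ] F)‖ :=
    hc'.abs.of_le (fun n => norm_nonneg _) fun n =>
      ContinuousLinearMap.opNorm_le_bound _ (abs_nonneg _) fun x =>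
        (hPc' n x).trans (by gcongr; exact le_abs_self _)
  -- The maps `G n` are bounded subexponentially together with their inverses.
  have hGn : SubExp fun n => ‖G n‖ := by
    refine (SubExp.sum Finset.univ fun i _ => (SubExp.const
      ‖LinearMap.toContinuousLinearMap (b.coord i)‖).mul (subExp_norm_of_repr b
        (fun n => G n (b i)) fun j => hM j i)).of_le (fun n => norm_nonneg _) fun n => ?_
    exact ContinuousLinearMap.norm_le_sum_basis b _
  have hdetG : ∀ n, LinearMap.det (G n : F →ₗ[ℝ] F) = Real.exp (∑ i, χ i) := fun n => by
    rw [← LinearMap.det_toMatrix b, det_of_rank_triangular r, Real.exp_sum]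
    · refine Finset.prod_congr rfl fun i _ => ?_
      rw [LinearMap.toMatrix_apply]
      exact hdiag n i
    · intro i j hij h
      rw [LinearMap.toMatrix_apply] at h
      exact htri n i j hij h
  have hGeq : ∀ n, ∃ e : F ≃L[ℝ] F, (e : F →L[ℝ] F) = G n := fun n => by
    have hu : IsUnit (LinearMap.det (G n : F →ₗ[ℝ] F)) := by
      rw [hdetG n]
      exact isUnit_iff_ne_zero.2 (Real.exp_ne_zero _)
    refine ⟨(LinearEquiv.ofIsUnitDet (v := b) (v' := b) (f := (G n : F →ₗ[ℝ] F))
      (by rwa [LinearMap.det_toMatrix])).toContinuousLinearEquiv, ?_⟩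
    ext x
    rfl
  choose e he using hGeq
  have hen : SubExp fun n => ‖((e n).symm : F →L[ℝ] F)‖ := by
    refine ((SubExp.const (Real.exp (∑ i, χ i))⁻¹).mul (hGn.pow (Fintype.card ι - 1))).of_le
      (fun n => norm_nonneg _) fun n => ?_
    have h := norm_symm_le hdimF (e n)
    rwa [absDet_endomorphism, he, hdetG, Real.abs_exp] at h
  -- Hence the same holds for the maps `A n`.
  let a : ∀ n, E n ≃L[ℝ] E (n + 1) := fun n => ((P n).symm.trans (e n)).trans (P (n + 1))
  have ha : ∀ n, (a n : E n →L[ℝ] E (n + 1)) = A n := fun n => by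
    ext x
    show P (n + 1) ((e n : F →L[ℝ] F) ((P n).symm x)) = A n x
    rw [he, ← hconj, ContinuousLinearEquiv.apply_symm_apply]
  have hinv : ∀ n, (A n).inverse = ((a n).symm : E (n + 1) →L[ℝ] E n) := fun n => by
    rw [← ha, ContinuousLinearMap.inverse_equiv]
  have hAn : SubExp fun n => ‖A n‖ := by
    refine (hPn.succ.mul (hGn.mul hPn')).of_le (fun n => norm_nonneg _) fun n => ?_
    have : A n = (P (n + 1) : F →L[ℝ] E (n + 1)).comp
        ((G n).comp ((P n).symm : E n →L[ℝ] F)) := by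
      rw [← ha, ← he]; rfl
    rw [this]
    exact (ContinuousLinearMap.opNorm_comp_le _ _).trans
      (mul_le_mul_of_nonneg_left (ContinuousLinearMap.opNorm_comp_le _ _) (norm_nonneg _))
  have hAn' : SubExp fun n => ‖(A n).inverse‖ := by
    refine (hPn.mul (hen.mul hPn'.succ)).of_le (fun n => norm_nonneg _) fun n => ?_
    have : (A n).inverse = (P n : F →L[ℝ] E n).comp
        (((e n).symm : F →L[ℝ] F).comp ((P (n + 1)).symm : E (n + 1) →L[ℝ] F)) := by
      rw [hinv]; rfl
    rw [this]
    exact (ContinuousLinearMap.opNorm_comp_le _ _).trans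
      (mul_le_mul_of_nonneg_left (ContinuousLinearMap.opNorm_comp_le _ _) (norm_nonneg _))
  have hA1 : ∀ n, 1 ≤ ‖A n‖ := fun n => by
    obtain ⟨ξ, hξ, hA⟩ := hone n
    have := (A n).le_opNorm ξ
    rw [hξ, mul_one] at this
    exact hA.trans this
  have hA1' : ∀ n, 1 ≤ ‖(A n).inverse‖ := fun n => by
    obtain ⟨η, hη, hA⟩ := hone' n
    have h := (A n).inverse.le_opNorm η
    rw [hη, mul_one] at h
    refine (hA _ ?_).trans h
    rw [hinv, ← ha]
    exact (a n).apply_symm_apply η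
  -- The products.
  have hprod : ∀ n x, cocycle A n (P 0 x) = P n (iterProd G n x) := by
    intro n
    induction n with
    | zero => intro x; rfl
    | succ n ih =>
      intro x
      show A n (cocycle A n (P 0 x)) = _
      rw [ih, hconj]
      rfl
  have hgrow : ∀ k, lyapunovWeight A (b.map (P 0).toLinearEquiv k) ≤ χ k := by
    intro k
    rw [lyapunovWeight_le_iff]
    have h1 : ∀ i, SubExp fun n => Real.exp (-(n * χ k)) * b.repr (iterProd G n (b k)) i := by
      refine fun i => subExp_of_rank_triangular r χ hrχ (fun n i j => b.repr (G n (b j)) i) hdiag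
        htri hM k (fun n i => b.repr (iterProd G n (b k)) i) (fun i hi => ?_) (fun n i => ?_) i
      · show b.repr (b k) i = 0
        rw [b.repr_self, Finsupp.single_eq_of_ne hi]
      · show b.repr (G n (iterProd G n (b k))) i = _
        conv_lhs => rw [← b.sum_repr (iterProd G n (b k))]
        rw [map_sum, map_sum, Finsupp.finsetSum_apply]
        refine Finset.sum_congr rfl fun j _ => ?_
        rw [map_smul, map_smul, Finsupp.smul_apply, smul_eq_mul, mul_comm]
    have h2 := subExp_norm_of_repr b (fun n => Real.exp (-(n * χ k)) • iterProd G n (b k))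
      fun i => by simpa using h1 i
    refine (hPn.mul h2).of_le (fun n => by positivity) fun n => ?_
    have h3 : cocycle A n (b.map (P 0).toLinearEquiv k) = P n (iterProd G n (b k)) := hprod n (b k)
    rw [h3, norm_smul, Real.norm_eq_abs, Real.abs_exp, mul_left_comm]
    gcongr
    exact (P n : F →L[ℝ] E n).le_opNorm _
  have hdetA : ∀ n, absDet (cocycle A n) * absDet (P 0 : F →L[ℝ] E 0) =
      absDet (P n : F →L[ℝ] E n) * Real.exp (n * ∑ i, χ i) := fun n => by
    rw [← absDet_comp (hdimF.trans (hdim 0).symm) ((hdim 0).trans (hdim n).symm)]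
    have : (cocycle A n).comp (P 0 : F →L[ℝ] E 0) = (P n : F →L[ℝ] E n).comp (iterProd G n) := by
      ext x
      exact hprod n x
    rw [this, absDet_comp rfl (hdimF.trans (hdim n).symm), absDet_endomorphism,
      det_iterProd G hdetG, Real.abs_exp]
  have hPpos : ∀ n, 0 < absDet (P n : F →L[ℝ] E n) := fun n =>
    absDet_pos (hdimF.trans (hdim n).symm) (P n).injective
  have hpos : ∀ n, 0 < absDet (cocycle A n) := fun n => by
    have h := mul_pos (hPpos n) (Real.exp_pos (n * ∑ i, χ i))
    rw [← hdetA] at h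
    exact pos_of_mul_pos_left h (hPpos 0).le
  have hPinv : ∀ n, (absDet (P n : F →L[ℝ] E n))⁻¹ =
      absDet ((P n).symm : E n →L[ℝ] F) := fun n => by
    refine inv_eq_of_mul_eq_one_right ?_
    rw [← absDet_comp ((hdim n).trans hdimF.symm) (hdimF.trans (hdim n).symm)]
    have : (P n : F →L[ℝ] E n).comp ((P n).symm : E n →L[ℝ] F) =
        ContinuousLinearMap.id ℝ (E n) := by
      ext x
      simp
    rw [this, absDet_endomorphism]
    simp
  have hdet : SubExp fun n : ℕ => Real.exp (n * ∑ i, χ i) * (absDet (cocycle A n))⁻¹ := by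
    refine ((SubExp.const (absDet (P 0 : F →L[ℝ] E 0))).mul
      (hPn'.pow (Fintype.card ι))).of_le
        (fun n => mul_nonneg (Real.exp_pos _).le (inv_pos.2 (hpos n)).le) fun n => ?_
    have h1 : Real.exp (n * ∑ i, χ i) * (absDet (cocycle A n))⁻¹ =
        absDet (P 0 : F →L[ℝ] E 0) * (absDet (P n : F →L[ℝ] E n))⁻¹ := by
      have := hdetA n
      have h2 := (hpos n).ne'
      have h3 := (hPpos n).ne'
      field_simp
      linarith
    rw [h1, hPinv]
    exact mul_le_mul_of_nonneg_left (absDet_le_norm_pow (hdim n) hdimF _) (hPpos 0).le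
  have hadapt : IsAdapted (lyapunovWeight A) (b.map (P 0).toLinearEquiv) χ :=
    isAdapted_lyapunovWeight A hdim _ χ hgrow hpos hdet
  refine ⟨⟨fun n => ⟨a n, ha n⟩, hAn.limsup_eq_zero hA1, hAn'.limsup_eq_zero hA1', fun v hv => ?_,
    ?_⟩, hadapt⟩
  · obtain ⟨i, -, hi, -⟩ := hadapt.exists_eq hv
    exact ⟨χ i, hi⟩
  · rw [lyapunovExponents, hadapt.finsum_weightMult]
    exact tendsto_log_absDet_cocycle A hdim _ χ hgrow hpos hdet

end Conjugate

/-! ### Straightening a sequence of subresonant maps -/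

section Values

variable {ι σ : Type*} [Fintype ι] [Fintype σ]

/-- The weights of monomials are the combinations of the weights of the coordinates with
non-negative integer coefficients. -/
lemma exists_monWeight_eq_iff {w : ι → ℝ} {lam : σ → ℝ} (h : Set.range w = Set.range lam) (c : ℝ) :
    (∃ α, monWeight w α = c) ↔ ∃ n : σ → ℕ, c = ∑ s, n s * lam s := by
  classical
  constructor
  · rintro ⟨α, rfl⟩
    induction α using Finsupp.induction_linear with
    | zero => exact ⟨0, by simp⟩
    | add α β hα hβ =>
      obtain ⟨n, hn⟩ := hα
      obtain ⟨m, hm⟩ := hβ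
      exact ⟨n + m, by simp [monWeight_add, hn, hm, add_mul, Finset.sum_add_distrib]⟩
    | single i k =>
      obtain ⟨s, hs⟩ : w i ∈ Set.range lam := h ▸ Set.mem_range_self i
      refine ⟨Pi.single s k, ?_⟩
      rw [Finset.sum_eq_single s]
      · simp [monWeight, hs, Finsupp.single_apply]
      · intro t _ ht
        simp [Pi.single_eq_of_ne ht]
      · simp
  · rintro ⟨n, rfl⟩
    have hj : ∀ s, ∃ i, w i = lam s := fun s => by
      have : lam s ∈ Set.range w := h ▸ Set.mem_range_self s
      exact this
    choose j hj using hj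
    refine ⟨∑ s, Finsupp.single (j s) (n s), ?_⟩
    have hsum : ∀ t : Finset σ, monWeight w (∑ s ∈ t, Finsupp.single (j s) (n s)) =
        ∑ s ∈ t, n s * lam s := by
      intro t
      induction t using Finset.induction_on with
      | empty => simp
      | insert s t hs ih =>
        rw [Finset.sum_insert hs, Finset.sum_insert hs, monWeight_add, ih, ← hj]
        simp [monWeight, Finsupp.single_apply]
    exact hsum Finset.univ

end Values

section LinearMaps

variable {X V W : Type*} [NormedAddCommGroup X] [InnerProductSpace ℝ X] [FiniteDimensional ℝ X]
  [NormedAddCommGroup V] [InnerProductSpace ℝ V] [FiniteDimensional ℝ V]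
  [NormedAddCommGroup W] [InnerProductSpace ℝ W] [FiniteDimensional ℝ W]
  {ϖX : Weight X} {ϖV : Weight V} {ϖW : Weight W}

/-- A linear map that does not increase weights, as a subresonant polynomial map. -/
def linearSubresonant (T : X →L[ℝ] V) (hT : ∀ x, ϖV (T x) ≤ ϖX x) : polyLE ϖX ϖV 0 :=
  ⟨T, continuousLinearMap_mem_polyLE T fun x => by simpa using hT x⟩

/-- The composition of subresonant polynomial maps. -/
def subresonantComp (g : polyLE ϖV ϖW 0) (f : polyLE ϖX ϖV 0) : polyLE ϖX ϖW 0 :=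
  ⟨g.1 ∘ f.1, comp_mem_polyLE g.2 f.2⟩

/-- The linearization of a weight preserving linear isomorphism. -/
noncomputable def linearizeEquiv [ϖX.Negative] [ϖV.Negative] (κ : ℝ) (T : X ≃L[ℝ] V)
    (hT : ∀ x, ϖV (T x) ≤ ϖX x) (hT' : ∀ y, ϖX (T.symm y) ≤ ϖV y) :
    LinSpace ϖX κ ≃L[ℝ] LinSpace ϖV κ :=
  ContinuousLinearEquiv.equivOfInverse
    (linearize κ (linearSubresonant (T : X →L[ℝ] V) hT))
    (linearize κ (linearSubresonant (T.symm : V →L[ℝ] X) hT'))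
    (fun ξ => (linearize_linearize _ _ (subresonantComp (linearSubresonant (T.symm : V →L[ℝ] X) hT')
      (linearSubresonant (T : X →L[ℝ] V) hT)) (fun _ => rfl) ξ).trans
        (linearize_eq_self _ (fun x => T.symm_apply_apply x) ξ))
    (fun ξ => (linearize_linearize _ _ (subresonantComp (linearSubresonant (T : X →L[ℝ] V) hT)
      (linearSubresonant (T.symm : V →L[ℝ] X) hT')) (fun _ => rfl) ξ).trans
        (linearize_eq_self _ (fun x => T.apply_symm_apply x) ξ))

end LinearMaps

section Straighten

variable {V : ℕ → Type*} [∀ i, NormedAddCommGroup (V i)] [∀ i, InnerProductSpace ℝ (V i)]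
  {ϖ : ∀ i, Weight (V i)}

/-- A sequence of subresonant maps `f n`, written in frames `B n` that diagonalize its linear
parts: `B (n + 1)⁻¹ ∘ f n ∘ B n`. -/
def straighten (f : ∀ i, polyLE (ϖ i) (ϖ (i + 1)) 0) (B : ∀ n, V 0 ≃L[ℝ] V n)
    (hB : ∀ n x, ϖ n (B n x) ≤ ϖ 0 x) (hB' : ∀ n y, ϖ 0 ((B n).symm y) ≤ ϖ n y) (n : ℕ) :
    polyLE (ϖ 0) (ϖ 0) 0 :=
  subresonantComp (linearSubresonant ((B (n + 1)).symm : V (n + 1) →L[ℝ] V 0) (hB' (n + 1)))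
    (subresonantComp (f n) (linearSubresonant (B n : V 0 →L[ℝ] V n) (hB n)))

variable (f : ∀ i, polyLE (ϖ i) (ϖ (i + 1)) 0) (B : ∀ n, V 0 ≃L[ℝ] V n)
  (hB : ∀ n x, ϖ n (B n x) ≤ ϖ 0 x) (hB' : ∀ n y, ϖ 0 ((B n).symm y) ≤ ϖ n y)

lemma fderiv_straighten (n : ℕ) (v : V 0) :
    fderiv ℝ (straighten f B hB hB' n).1 0 v =
      (B (n + 1)).symm (linearParts f n (B n v)) := by
  have h := (f n).2.1.linear_comp_comp ((B (n + 1)).symm : V (n + 1) →L[ℝ] V 0)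
    (B n : V 0 →L[ℝ] V n) 1
  have h2 := congrArg (fun T => T fun _ => v) h
  simp only [polarization_one_apply] at h2
  refine h2.trans ?_
  show (B (n + 1)).symm (polarization 1 (f n).1 fun _ => B n v) = _
  rw [polarization_one_apply]
  rfl

variable [∀ i, FiniteDimensional ℝ (V i)]

/-- The linearizations of `f n` are conjugate, by the linearizations of the frames, to those of the
straightened maps. -/
lemma linearizations_conj [∀ i, (ϖ i).Negative] (κ : ℝ) (n : ℕ) (ξ : LinSpace (ϖ 0) κ) :
    linearizations κ f n (linearizeEquiv κ (B n) (hB n) (hB' n) ξ) =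
      linearizeEquiv κ (B (n + 1)) (hB (n + 1)) (hB' (n + 1))
        (linearize κ (straighten f B hB hB' n) ξ) := by
  refine (linearize_linearize (f n) (linearSubresonant (B n : V 0 →L[ℝ] V n) (hB n))
    (subresonantComp (f n) (linearSubresonant (B n : V 0 →L[ℝ] V n) (hB n)))
      (fun _ => rfl) ξ).trans (linearize_linearize _ _ _ (fun x => ?_) ξ).symm
  exact (B (n + 1)).apply_symm_apply _

/-- Only the first `N` homogeneous components of `h ∘ B n` matter, so that the linearizations of
the frames are bounded by a fixed polynomial in `‖B n‖`. -/
lemma exists_subExp_linearizeEquiv [∀ i, (ϖ i).Negative] (κ : ℝ)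
    (hBn : SubExp fun n => ‖(B n : V 0 →L[ℝ] V n)‖) :
    ∃ c, SubExp c ∧ ∀ n ξ, ‖linearizeEquiv κ (B n) (hB n) (hB' n) ξ‖ ≤ c n * ‖ξ‖ := by
  obtain ⟨N, hN⟩ := exists_degree_bound (ϖ := ϖ 0) κ
  refine ⟨fun n => 1 + ∑ k ∈ Finset.range N,
    (Module.finrank ℝ (V 0) * ‖(B n : V 0 →L[ℝ] V n)‖ ^ 2) ^ k, ?_, fun n ξ => ?_⟩
  · exact (SubExp.const 1).add (SubExp.sum _ fun k _ =>
      ((SubExp.const _).mul (hBn.pow 2)).pow k)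
  · exact norm_linearize_apply_le (B n : V 0 →L[ℝ] V n) _ (fun _ => rfl)
      (fun h k hk => hN _ (comp_mem_polyLE h.2 (linearSubresonant (B n : V 0 →L[ℝ] V n) (hB n)).2)
        k hk) ξ

lemma exists_subExp_linearizeEquiv_symm [∀ i, (ϖ i).Negative] (κ : ℝ)
    (hBn : SubExp fun n => ‖((B n).symm : V n →L[ℝ] V 0)‖) :
    ∃ c, SubExp c ∧ ∀ n ξ, ‖(linearizeEquiv κ (B n) (hB n) (hB' n)).symm ξ‖ ≤ c n * ‖ξ‖ := by
  obtain ⟨N, hN⟩ := exists_degree_bound (ϖ := ϖ 0) κ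
  refine ⟨fun n => 1 + ∑ k ∈ Finset.range N,
    (Module.finrank ℝ (V 0) * ‖((B n).symm : V n →L[ℝ] V 0)‖ ^ 2) ^ k, ?_, fun n ξ => ?_⟩
  · exact (SubExp.const 1).add (SubExp.sum _ fun k _ =>
      ((SubExp.const _).mul (hBn.pow 2)).pow k)
  · rw [(B n).toLinearEquiv.finrank_eq]
    refine norm_linearize_apply_le ((B n).symm : V n →L[ℝ] V 0) _ (fun _ => rfl)
      (fun h k hk => ?_) ξ
    have h1 := h.2.1.linear_comp_comp (ContinuousLinearMap.id ℝ ℝ)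
      ((B n).symm : V n →L[ℝ] V 0) k
    refine h1.trans ?_
    rw [hN h.1 h.2 k hk]
    ext
    simp

lemma subExp_polarization_straighten (b : Module.Basis ι ℝ (V 0)) (i : ι)
    (hf : SubExp fun n => polyNorm (f n).1)
    (hBn : SubExp fun n => ‖(B n : V 0 →L[ℝ] V n)‖)
    (hBn' : SubExp fun n => ‖((B n).symm : V n →L[ℝ] V 0)‖) (k : ℕ) :
    SubExp fun n => ‖polarization k fun x => b.repr ((straighten f B hB hB' n).1 x) i‖ := by
  let T := LinearMap.toContinuousLinearMap (b.coord i)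
  refine (((SubExp.const ‖T‖).mul hBn'.succ).mul (hf.mul (hBn.pow k))).of_le
    (fun n => norm_nonneg _) fun n => ?_
  refine (norm_polarization_linear_comp_comp_le (f n).2.1
    (T.comp ((B (n + 1)).symm : V (n + 1) →L[ℝ] V 0)) (B n : V 0 →L[ℝ] V n) k).trans ?_
  refine mul_le_mul_of_nonneg_right (ContinuousLinearMap.opNorm_comp_le _ _) ?_
  exact mul_nonneg (finsum_nonneg fun _ => norm_nonneg _) (by positivity)

end Straighten

/-! ### Lyapunov exponents of the linearized sequence -/

section Main

variable {V : ℕ → Type*} [∀ i, NormedAddCommGroup (V i)] [∀ i, InnerProductSpace ℝ (V i)]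
  [∀ i, FiniteDimensional ℝ (V i)] {ϖ : ∀ i, Weight (V i)} [∀ i, (ϖ i).Negative]

lemma linearizations_apply_one {κ : ℝ} (hκ : 0 ≤ κ) (f : ∀ i, polyLE (ϖ i) (ϖ (i + 1)) 0) (i : ℕ)
    (ξ : LinSpace (ϖ i) κ) :
    linearizations κ f i ξ (WPoly.one (ϖ (i + 1)) hκ) = ξ (WPoly.one (ϖ i) hκ) := rfl

/-- In adapted coordinates `w` of `V 0`, the linearized sequence is forwards regular and has an
adapted basis indexed by the monomials of weight at least `-κ`; the exponents are the weights of the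
monomials, and the coordinate of the trivial monomial is the evaluation at the constant `1`. -/
theorem exists_adapted_linearizations (hcompat : ∀ i j, (ϖ i).Compatible (ϖ j))
    (hfin : (weightValues (ϖ 0)).Finite) (f : ∀ i, polyLE (ϖ i) (ϖ (i + 1)) 0)
    (hnorm : limsup (fun n : ℕ => ((Real.log (polyNorm (f n).1) / n : ℝ) : EReal)) atTop = 0)
    (hreg : ForwardsRegular (linearParts f))
    (hweight : ∀ v : V 0, v ≠ 0 →
      Tendsto (fun n : ℕ => ENNReal.log ‖cocycle (linearParts f) n v‖ₑ / (n : EReal)) atTop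
        (𝓝 (ϖ 0 v))) {κ : ℝ} (hκ : 0 ≤ κ) :
    ∃ w : Fin (Module.finrank ℝ (V 0)) → ℝ, (∀ i, w i < 0) ∧
      Set.range w = weightValues (ϖ 0) ∧ Finite (MonIndex w κ) ∧
      ForwardsRegular (E := fun i => LinSpace (ϖ i) κ) (linearizations κ f) ∧
      ∃ e : Module.Basis (MonIndex w κ) ℝ (LinSpace (ϖ 0) κ),
        IsAdapted (lyapunovWeight (E := fun i => LinSpace (ϖ i) κ) (linearizations κ f)) e
          (fun α => monWeight w α.1) ∧
        ∀ (ξ : LinSpace (ϖ 0) κ) (α : MonIndex w κ), α.1 = 0 →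
          e.repr ξ α = ξ (WPoly.one (ϖ 0) hκ) := by
  classical
  obtain ⟨b, w, B, hb, hBw, hBn, hBn', hAB⟩ := exists_straightening_frame hcompat hfin
    (A := linearParts f) (fun i v => weight_fderiv_le (f i) v) hreg hweight
  have hw : ∀ i, w i < 0 := fun i => by
    have := Weight.Negative.neg (ϖ := ϖ 0) (b i)
    rw [hb.apply_basis] at this
    exact_mod_cast this
  have hB : ∀ n x, ϖ n (B n x) ≤ ϖ 0 x := fun n x => (hBw n x).le
  have hB' : ∀ n y, ϖ 0 ((B n).symm y) ≤ ϖ n y := fun n y => by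
    rw [← hBw n, ContinuousLinearEquiv.apply_symm_apply]
  let g := straighten f B hB hB'
  have hg : ∀ n j, fderiv ℝ (g n).1 0 (b j) = Real.exp (w j) • b j := fun n j => by
    rw [fderiv_straighten f B hB hB', hAB, map_smul, ContinuousLinearEquiv.symm_apply_apply]
  have hpoly : SubExp fun n => polyNorm (f n).1 :=
    SubExp.of_limsup (fun n => finsum_nonneg fun _ => norm_nonneg _) hnorm.le
  -- The components of `g n` as polynomials in adapted coordinates.
  choose N hN using fun i => exists_degree_bound (ϖ := ϖ 0) (-w i)
  let q : ℕ → Fin (Module.finrank ℝ (V 0)) → MvPolynomial (Fin (Module.finrank ℝ (V 0))) ℝ :=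
    fun n i => coordPoly b (N i + 2) fun x => b.repr ((g n).1 x) i
  have hqf : ∀ n i, polyFun b (q n i) = fun x => b.repr ((g n).1 x) i := fun n i =>
    polyFun_coordPoly b (coord_comp_mem_polyLE hb (g n) i).1 fun k hk =>
      hN i _ (coord_comp_mem_polyLE hb (g n) i) k (by omega)
  have hqlead : ∀ n i, q n i - MvPolynomial.monomial (Finsupp.single i 1) (Real.exp (w i)) ∈
      MvPolynomial.restrictSupport ℝ {γ | monRank w (Finsupp.single i 1) < monRank w γ} :=
    fun n i => coordPoly_sub_mem hb hw (g n) (hg n) (by omega) i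
  have hqsub : ∀ i γ, SubExp fun n => MvPolynomial.coeff γ (q n i) := fun i γ =>
    subExp_coeff_coordPoly b (N i + 2) (fun n x => b.repr ((g n).1 x) i)
      (subExp_polarization_straighten f B hB hB' b i hpoly hBn hBn') γ
  have hfinite : Finite (MonIndex w κ) := Module.Finite.finite_basis (monBasis hb κ)
  have := Fintype.ofFinite (MonIndex w κ)
  -- In the dual basis the linearization has the transpose of the matrix of the pullback.
  have hentry : ∀ n (α β : MonIndex w κ),
      (dualMonBasis hb κ).repr (linearize κ (g n) (dualMonBasis hb κ β)) α =
        MvPolynomial.coeff β.1 (substMon (q n) α.1) := fun n α β => by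
    rw [dualMonBasis_repr, linearize_apply, dualMonBasis_apply,
      monBasis_repr_pullback hb κ (g n) (hqf n) (hqlead n)]
  obtain ⟨c, hc, hPc⟩ := exists_subExp_linearizeEquiv B hB hB' κ hBn
  obtain ⟨c', hc', hPc'⟩ := exists_subExp_linearizeEquiv_symm B hB hB' κ hBn'
  obtain ⟨hR, hadapt⟩ := forwardsRegular_of_conjugate_triangular
    (E := fun i => LinSpace (ϖ i) κ) (linearizations κ f)
    (fun n => linearizeEquiv κ (B n) (hB n) (hB' n)) (fun n => linearize κ (g n))
    (fun n ξ => linearizations_conj f B hB hB' κ n ξ) hc hPc hc' hPc' (dualMonBasis hb κ)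
    (fun α => monRank w α.1) (fun α => monWeight w α.1)
    (fun α β h => by
      rcases (monRank_lt_iff w).1 h with h | h
      exacts [h.le, h.1.le])
    (fun n α => by
      have h := substMon_sub_mem (hqlead n) α.1
      rw [MvPolynomial.mem_restrictSupport_iff] at h
      rw [hentry]
      by_contra hne
      refine lt_irrefl (monRank w α.1) (@h α.1 ?_)
      rw [Finset.mem_coe, MvPolynomial.mem_support_iff, MvPolynomial.coeff_sub,
        MvPolynomial.coeff_monomial, if_pos rfl]
      exact sub_ne_zero.2 hne)
    (fun n α β hαβ h => by
      have h1 := substMon_sub_mem (hqlead n) α.1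
      rw [MvPolynomial.mem_restrictSupport_iff] at h1
      rw [hentry] at h
      refine @h1 β.1 ?_
      rw [Finset.mem_coe, MvPolynomial.mem_support_iff, MvPolynomial.coeff_sub,
        MvPolynomial.coeff_monomial, if_neg (fun h => hαβ (Subtype.ext h)), sub_zero]
      exact h)
    (fun α β => by
      simp only [hentry]
      exact subExp_coeff_substMon hqsub α.1 β.1)
    -- Linearizations preserve evaluation at the constant `1`, which is a functional of norm one;
    -- hence neither they nor their inverses are contractions.
    (fun n => by
      obtain ⟨ξ, hξ, hξ1⟩ := exists_norm_eq_one_apply_one (ϖX := ϖ n) hκ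
      exact ⟨ξ, hξ, one_le_norm_of_apply_one hκ _ ((linearizations_apply_one hκ f n ξ).trans hξ1)⟩)
    (fun n => by
      obtain ⟨η, hη, hη1⟩ := exists_norm_eq_one_apply_one (ϖX := ϖ (n + 1)) hκ
      refine ⟨η, hη, fun ξ hξ => one_le_norm_of_apply_one hκ _ ?_⟩
      rw [← linearizations_apply_one hκ f n ξ, hξ, hη1])
  refine ⟨w, hw, hb.weightValues_eq.symm, hfinite, hR, _, hadapt, fun ξ α hα => ?_⟩
  have hone : monBasis hb κ α = WPoly.one (ϖ 0) hκ := by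
    refine Subtype.ext ((monBasis_coe hb κ α).trans ?_)
    rw [hα]
    funext x
    rw [polyFun_monomial]
    simp [WPoly.one]
  show (dualMonBasis hb κ).repr ((linearizeEquiv κ (B 0) (hB 0) (hB' 0)).symm ξ) α = _
  rw [dualMonBasis_repr, hone]
  rfl

end Main

theorem mainTheorem3 {ℓ : ℕ} [NeZero ℓ] (lam : Fin ℓ → ℝ) (hlam : StrictMono lam)
    (V : ℕ → Type*) [∀ i, NormedAddCommGroup (V i)] [∀ i, InnerProductSpace ℝ (V i)]
    [∀ i, FiniteDimensional ℝ (V i)]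
    (ϖ : ∀ i, Weight (V i)) [∀ i, (ϖ i).Negative]
    (hcompat : ∀ i j, (ϖ i).Compatible (ϖ j))
    (hvalues : ∀ i, weightValues (ϖ i) = Set.range lam)
    (f : ∀ i, polyLE (ϖ i) (ϖ (i + 1)) 0)
    (hinv : ∀ i, (linearParts f i).IsInvertible)
    (hnorm : limsup (fun n : ℕ => ((Real.log (polyNorm (f n).1) / n : ℝ) : EReal)) atTop = 0)
    (hreg : ForwardsRegular (linearParts f))
    (hweight : ∀ v : V 0, v ≠ 0 →
      Tendsto (fun n : ℕ => ENNReal.log ‖cocycle (linearParts f) n v‖ₑ / (n : EReal)) atTop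
        (𝓝 (ϖ 0 v))) :
    ForwardsRegular (E := fun i => LinSpace (ϖ i) (-lam 0)) (linearizations (-lam 0) f) ∧
    lyapunovExponents (E := fun i => LinSpace (ϖ i) (-lam 0)) (linearizations (-lam 0) f) =
      {c : ℝ | (∃ n : Fin ℓ → ℕ, c = ∑ s, n s * lam s) ∧ lam 0 ≤ c ∧ c ≤ 0} ∧
    weightMult (lyapunovWeight (E := fun i => LinSpace (ϖ i) (-lam 0))
      (linearizations (-lam 0) f)) 0 = 1 ∧
    (∀ i, Module.finrank ℝ (linSubspace (ϖ i) (-lam 0)) + 1 =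
      Module.finrank ℝ (LinSpace (ϖ i) (-lam 0))) ∧
    (∀ i, ∀ ξ ∈ linSubspace (ϖ i) (-lam 0),
      linearizations (-lam 0) f i ξ ∈ linSubspace (ϖ (i + 1)) (-lam 0)) ∧
    lyapunovExponentsOn (E := fun i => LinSpace (ϖ i) (-lam 0)) (linearizations (-lam 0) f)
        (linSubspace (ϖ 0) (-lam 0)) =
      {c : ℝ | (∃ n : Fin ℓ → ℕ, n ≠ 0 ∧ c = ∑ s, n s * lam s) ∧ lam 0 ≤ c ∧ c < 0} := by
  classical
  have hlam0 : lam 0 < 0 := by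
    obtain ⟨v, -, hv⟩ : lam 0 ∈ weightValues (ϖ 0) := hvalues 0 ▸ Set.mem_range_self 0
    have := Weight.Negative.neg (ϖ := ϖ 0) v
    rw [hv] at this
    exact_mod_cast this
  have hκ : 0 ≤ -lam 0 := by linarith
  obtain ⟨w, hw, hwlam, hfinite, hR, e, he, he0⟩ := exists_adapted_linearizations hcompat
    (hvalues 0 ▸ Set.finite_range lam) f hnorm hreg hweight hκ
  rw [hvalues 0] at hwlam
  have := Fintype.ofFinite (MonIndex w (-lam 0))
  let o : MonIndex w (-lam 0) := ⟨0, by simp [hlam0.le]⟩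
  have hmem : ∀ ξ, ξ ∈ linSubspace (ϖ 0) (-lam 0) ↔ e.repr ξ o = 0 := fun ξ => by
    rw [mem_linSubspace_iff hκ, he0 ξ o rfl]
  refine ⟨hR, ?_, ?_, fun i => finrank_linSubspace hκ, fun i ξ hξ => ?_, ?_⟩
  · rw [lyapunovExponents, he.weightValues_eq]
    ext c
    constructor
    · rintro ⟨α, rfl⟩
      exact ⟨(exists_monWeight_eq_iff hwlam _).1 ⟨α.1, rfl⟩, by simpa using α.2,
        monWeight_nonpos hw α.1⟩
    · rintro ⟨hc, hc1, -⟩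
      obtain ⟨α, rfl⟩ := (exists_monWeight_eq_iff hwlam _).2 hc
      exact ⟨⟨α, by simpa using hc1⟩, rfl⟩
  · rw [he.weightMult_eq, Finset.card_eq_one]
    refine ⟨o, ?_⟩
    ext α
    rw [Finset.mem_filter, Finset.mem_singleton]
    constructor
    · rintro ⟨-, h⟩
      by_contra hα
      exact (monWeight_neg hw fun h0 => hα (Subtype.ext h0)).ne h
    · rintro rfl
      exact ⟨Finset.mem_univ _, monWeight_zero w⟩
  · rw [mem_linSubspace_iff hκ] at hξ ⊢
    exact (linearizations_apply_one hκ f i ξ).trans hξ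
  · ext c
    constructor
    · rintro ⟨⟨ξ, hξ⟩, hξ0, hc⟩
      obtain ⟨α, hα, hval, -⟩ := he.exists_eq (x := ξ) fun h => hξ0 (Subtype.ext h)
      have hcα : c = monWeight w α.1 := by
        have : ((c : ℝ) : EReal) = (monWeight w α.1 : ℝ) := hc.symm.trans hval
        exact_mod_cast this
      have hα0 : α.1 ≠ 0 := fun h => hα (by
        rw [show α = o from Subtype.ext h]
        exact (hmem ξ).1 hξ)
      have hneg : c < 0 := hcα ▸ monWeight_neg hw hα0
      obtain ⟨n, hn⟩ := (exists_monWeight_eq_iff hwlam c).1 ⟨α.1, hcα.symm⟩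
      refine ⟨⟨n, ?_, hn⟩, ?_, hneg⟩
      · rintro rfl
        simp at hn
        exact hneg.ne hn
      · rw [hcα]
        simpa using α.2
    · rintro ⟨⟨n, -, hn⟩, hc1, hc0⟩
      obtain ⟨α, rfl⟩ := (exists_monWeight_eq_iff hwlam c).2 ⟨n, hn⟩
      let a : MonIndex w (-lam 0) := ⟨α, by simpa using hc1⟩
      have hao : a ≠ o := fun h => by
        have h1 : α = 0 := congrArg Subtype.val h
        rw [h1, monWeight_zero] at hc0
        exact lt_irrefl _ hc0
      refine ⟨⟨e a, (hmem _).2 ?_⟩, fun h => e.ne_zero a (congrArg Subtype.val h),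
        he.apply_basis a⟩
      rw [e.repr_self, Finsupp.single_eq_of_ne hao.symm]
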